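/- Let $N\ge 1$ and $\mathcal H=\ell^2(\mathbb Z^2)\otimes\mathbb C^N$. For a bounded operator $A$ on $\mathcal H$ and $x,y\in\mathbb Z^2$ let $A_{xy}=\langle\delta_x,A\delta_y\rangle$ be its $N\times N$ blocks. Let $H$ be a bounded self-adjoint operator on $\mathcal H$ which is local: for all sufficiently large $\alpha\in\mathbb N$ there is $C_\alpha<\infty$ with $\|H_{xy}\|\le C_\alpha(1+\|x-y\|)^{-\alpha}$ for all $x,y\in\mathbb Z^2$. Let $\Delta\subset\mathbb R$ be an interval with more than one point, and suppose that $H$ is mobility-gapped on $\Delta$, that is: (1) there is $\nu\in\mathbb N$ such that for all sufficiently large $m\in\mathbb N$ there is $C_m<\infty$ with $\|f(H)_{xy}\|\le C_m(1+\|x-y\|)^{-m}(1+\|x\|)^{\nu}$ for all $x,y\in\mathbb Z^2$ and all Borel functions $f:\mathbb R\to\mathbb R$ with $|f|\le 1$ that are constant on $(-\infty,\inf\Delta]$ and constant on $[\sup\Delta,\infty)$; (2) every eigenvalue of $H$ in $\Delta$ has finite multiplicity. Let $\mu\in\Delta$ and let $P=\chi_{(-\infty,\mu)}(H)$ be the Fermi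 projection, $P^\perp=1-P$. Let $U=\exp(\mathrm i\arg(X_1+\mathrm iX_2))$ be the flux insertion operator, where $X_1,X_2$ are the position operators (and $\arg 0=0$), and let $\Lambda_1,\Lambda_2$ be the orthogonal projections onto the half planes $x_1\ge 0$ and $x_2\ge 0$. For self-adjoint $A$ put $\mathbb W_1A=\Lambda_1\mathrm e^{-2\pi\mathrm iA}\Lambda_1+1-\Lambda_1$. For a Fredholm operator $F$ put $\operatorname{index}F=\dim\ker F-\dim\ker F^*$ and $\operatorname{index}_2F=\dim\ker F \bmod 2$. Then $PUP+P^\perp$, $\mathbb W_1(P\Lambda_2P)$ and $\Lambda_1\mathrm e^{2\pi\mathrm iP\Lambda_2P}\Lambda_1+1-\Lambda_1$ are Fredholm, and $$\operatorname{index}(PUP+P^\perp)=\operatorname{index}\bigl(\Lambda_1\mathrm e^{2\pi\mathrm iP\Lambda_2P}\Lambda_1+1-\Lambda_1\bigr)=-\operatorname{index}\mathbb W_1(P\Lambda_2P).$$ Moreover, let $\Theta$ be an antilinear map on $\mathcal H$ with $\langle\Theta\psi,\Theta\varphi\rangle=\langle\varphi,\psi\rangle$ for all $\psi,\varphi$,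 with $\Theta^2=-1$ and $[\Theta,X_1]=[\Theta,X_2]=0$, and suppose that $[H,\Theta]=0$. Then $F=PUP+P^\perp$ and $F=\mathbb W_1(P\Lambda_2P)$ both satisfy $F=-\Theta F^*\Theta$, and $$\operatorname{index}_2(PUP+P^\perp)=\operatorname{index}_2\mathbb W_1(P\Lambda_2P).$$ -/

import Mathlib

open scoped InnerProductSpace CompactlySupported
open MeasureTheory Filter

noncomputable section

namespace FluxKitaev

section BorelCalculus

variable {E : Type*} [NormedAddCommGroup E] [InnerProductSpace ℂ E] [CompleteSpace E]

/-- The positive functional `g ↦ ⟨ψ, g(H) ψ⟩` on compactly supported continuous functions on `ℝ`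
(`g(H)` is the continuous functional calculus of the bounded self-adjoint operator `H`). -/
def spectralFunctional (H : E →L[ℂ] E) (ψ : E) : C_c(ℝ, ℝ) →ₚ[ℝ] ℝ :=
  PositiveLinearMap.mk₀
    { toFun := fun g => (⟪ψ, cfc (fun t : ℝ => g t) H ψ⟫_ℂ).re
      map_add' := fun f g => by
        have hf : Continuous (fun t : ℝ => f t) := f.continuous
        have hg : Continuous (fun t : ℝ => g t) := g.continuous
        have := cfc_add (a := H) (fun t : ℝ => f t) (fun t : ℝ => g t)
          hf.continuousOn hg.continuousOn
        simp only [CompactlySupportedContinuousMap.add_apply]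
        rw [this]
        simp
      map_smul' := fun c g => by
        have hg : Continuous (fun t : ℝ => g t) := g.continuous
        have := cfc_smul (a := H) c (fun t : ℝ => g t) hg.continuousOn
        simp only [CompactlySupportedContinuousMap.smul_apply]
        rw [this, smul_apply, inner_smul_right_eq_smul]
        simp }
    (fun g hg => by
      have h0 : (0 : E →L[ℂ] E) ≤ cfc (fun t : ℝ => g t) H :=
        cfc_nonneg (fun t _ => hg t)
      rw [ContinuousLinearMap.nonneg_iff_isPositive] at h0
      exact h0.re_inner_nonneg_right ψ)

/-- The scalar spectral measure of `H` in the vector `ψ`: the measure `μ` on `ℝ` that represents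
`g ↦ ⟨ψ, g(H) ψ⟩` by the Riesz-Markov-Kakutani theorem. -/
def spectralMeasure (H : E →L[ℂ] E) (ψ : E) : Measure ℝ :=
  RealRMK.rieszMeasure (spectralFunctional H ψ)

instance (H : E →L[ℂ] E) (ψ : E) : (spectralMeasure H ψ).Regular :=
  inferInstanceAs (RealRMK.rieszMeasure (spectralFunctional H ψ)).Regular

theorem integral_spectralMeasure (H : E →L[ℂ] E) (ψ : E) (g : C_c(ℝ, ℝ)) :
    ∫ t, g t ∂(spectralMeasure H ψ) = (⟪ψ, cfc (fun t : ℝ => g t) H ψ⟫_ℂ).re :=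
  RealRMK.integral_rieszMeasure (spectralFunctional H ψ) g

/-- `A = f(H)`: the operator `A` satisfies `⟨ψ, A ψ⟩ = ∫ f dμ_ψ` for every vector `ψ`,
`μ_ψ` being the spectral measure of `H` in `ψ`. -/
def IsBorelCalculus (H : E →L[ℂ] E) (f : ℝ → ℝ) (A : E →L[ℂ] E) : Prop :=
  ∀ ψ : E, ⟪ψ, A ψ⟫_ℂ = ((∫ t, f t ∂(spectralMeasure H ψ) : ℝ) : ℂ)

open Classical in
/-- The operator `f(H)` for a bounded self-adjoint operator `H` and a bounded Borel function
`f : ℝ → ℝ` (Borel functional calculus). It exists and is unique, see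
`isBorelCalculus_borelCalculus` and `IsBorelCalculus.unique` below. -/
def borelCalculus (H : E →L[ℂ] E) (f : ℝ → ℝ) : E →L[ℂ] E :=
  if h : ∃ A, IsBorelCalculus H f A then h.choose else 0

theorem IsBorelCalculus.unique {H : E →L[ℂ] E} {f : ℝ → ℝ} {A B : E →L[ℂ] E}
    (hA : IsBorelCalculus H f A) (hB : IsBorelCalculus H f B) : A = B := by
  rw [← ContinuousLinearMap.coe_inj, ← ext_inner_map]
  intro ψ
  have h := (hA ψ).trans (hB ψ).symm
  have h2 := congrArg (starRingEnd ℂ) h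
  simpa [inner_conj_symm] using h2

theorem spectralMeasure_univ_le (H : E →L[ℂ] E) (ψ : E) :
    spectralMeasure H ψ Set.univ ≤ ENNReal.ofReal (‖ψ‖ ^ 2) := by
  rw [isOpen_univ.measure_eq_iSup_isCompact]
  refine iSup₂_le fun K _ => iSup_le fun hK => ?_
  obtain ⟨g, hg1, -, hgc, hg01⟩ :=
    exists_continuous_one_zero_of_isCompact hK isClosed_empty (Set.disjoint_empty K)
  let g' : C_c(ℝ, ℝ) := ⟨g, hgc⟩
  refine (RealRMK.rieszMeasure_le_of_eq_one (spectralFunctional H ψ) (f := g')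
    (fun x => (hg01 x).1) hK (fun x hx => hg1 hx)).trans (ENNReal.ofReal_le_ofReal ?_)
  change (⟪ψ, cfc (fun t : ℝ => g t) H ψ⟫_ℂ).re ≤ _
  have hn : ‖cfc (fun t : ℝ => g t) H‖ ≤ 1 :=
    norm_cfc_le zero_le_one fun t _ => by
      rw [Real.norm_eq_abs, abs_of_nonneg (hg01 t).1]; exact (hg01 t).2
  calc (⟪ψ, cfc (fun t : ℝ => g t) H ψ⟫_ℂ).re
      ≤ ‖⟪ψ, cfc (fun t : ℝ => g t) H ψ⟫_ℂ‖ := Complex.re_le_norm _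
    _ ≤ ‖ψ‖ * ‖cfc (fun t : ℝ => g t) H ψ‖ := norm_inner_le_norm _ _
    _ ≤ ‖ψ‖ * (1 * ‖ψ‖) := by
        gcongr
        exact ContinuousLinearMap.le_of_opNorm_le _ hn ψ
    _ = ‖ψ‖ ^ 2 := by ring

instance (H : E →L[ℂ] E) (ψ : E) : IsFiniteMeasure (spectralMeasure H ψ) :=
  ⟨(spectralMeasure_univ_le H ψ).trans_lt ENNReal.ofReal_lt_top⟩

theorem integrable_spectralMeasure (H : E →L[ℂ] E) (ψ : E) {f : ℝ → ℝ} (hf : Measurable f)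
    {C : ℝ} (hC : ∀ t, |f t| ≤ C) : Integrable f (spectralMeasure H ψ) :=
  Integrable.of_bound hf.aestronglyMeasurable C (Eventually.of_forall hC)

/-- A linear relation between the values `⟨v i, T (v i)⟩` that holds for all operators `T` also
holds between the integrals of a bounded Borel function against the spectral measures. -/
theorem sum_integral_eq_zero {n : ℕ} (H : E →L[ℂ] E) (c : Fin n → ℝ) (v : Fin n → E)
    (hT : ∀ T : E →L[ℂ] E, ∑ i, c i * (⟪v i, T (v i)⟫_ℂ).re = 0)
    {f : ℝ → ℝ} (hf : Measurable f) {C : ℝ} (hC : ∀ t, |f t| ≤ C) :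
    ∑ i, c i * ∫ t, f t ∂(spectralMeasure H (v i)) = 0 := by
  set ν : Measure ℝ := Measure.sum fun i => spectralMeasure H (v i) with hν
  have : IsFiniteMeasure ν := by
    rw [hν, Measure.sum_fintype]; infer_instance
  have hfi : Integrable f ν := Integrable.of_bound hf.aestronglyMeasurable C (Eventually.of_forall hC)
  have key : ∀ ε > 0, |∑ i, c i * ∫ t, f t ∂(spectralMeasure H (v i))| ≤ (∑ i, |c i|) * ε := by
    intro ε hε
    obtain ⟨g, hgs, hgε, hgc, hgi⟩ := hfi.exists_hasCompactSupport_integral_sub_le hε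
    let g' : C_c(ℝ, ℝ) := ⟨⟨g, hgc⟩, hgs⟩
    have h0 : ∑ i, c i * ∫ t, g t ∂(spectralMeasure H (v i)) = 0 := by
      rw [← hT (cfc (fun t : ℝ => g' t) H)]
      exact Finset.sum_congr rfl fun i _ => by rw [← integral_spectralMeasure H (v i) g']; rfl
    have hle : ∀ i, |∫ t, f t ∂(spectralMeasure H (v i)) - ∫ t, g t ∂(spectralMeasure H (v i))|
        ≤ ε := by
      intro i
      have hm : spectralMeasure H (v i) ≤ ν := Measure.le_sum _ i
      rw [← integral_sub (hfi.mono_measure hm) (hgi.mono_measure hm)]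
      calc |∫ t, (f t - g t) ∂(spectralMeasure H (v i))|
          ≤ ∫ t, ‖f t - g t‖ ∂(spectralMeasure H (v i)) := by
            simpa only [Real.norm_eq_abs] using
              norm_integral_le_integral_norm (μ := spectralMeasure H (v i)) (fun t => f t - g t)
        _ ≤ ∫ t, ‖f t - g t‖ ∂ν :=
            integral_mono_measure hm (Eventually.of_forall fun _ => norm_nonneg _)
              (hfi.sub hgi).norm
        _ ≤ ε := hgε
    rw [← sub_zero (∑ i, c i * ∫ t, f t ∂(spectralMeasure H (v i))), ← h0,
      ← Finset.sum_sub_distrib, Finset.sum_mul]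
    refine (Finset.abs_sum_le_sum_abs _ _).trans (Finset.sum_le_sum fun i _ => ?_)
    rw [← mul_sub, abs_mul]
    exact mul_le_mul_of_nonneg_left (hle i) (abs_nonneg _)
  by_contra hne
  have hpos : 0 < |∑ i, c i * ∫ t, f t ∂(spectralMeasure H (v i))| := abs_pos.mpr hne
  set S := |∑ i, c i * ∫ t, f t ∂(spectralMeasure H (v i))|
  set D := ∑ i, |c i|
  have hD : 0 ≤ D := Finset.sum_nonneg fun i _ => abs_nonneg _
  have h1 := key (S / (2 * (D + 1))) (by positivity)
  have h2 : D * (S / (2 * (D + 1))) ≤ S / 2 := by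
    rw [mul_div_assoc', div_le_div_iff₀ (by positivity) (by positivity)]
    nlinarith
  linarith

/-- The real part of the polarization of the quadratic form `ψ ↦ ∫ f dμ_ψ`. -/
def realForm (H : E →L[ℂ] E) (f : ℝ → ℝ) (φ ψ : E) : ℝ :=
  ((∫ t, f t ∂(spectralMeasure H (φ + ψ))) - ∫ t, f t ∂(spectralMeasure H (φ - ψ))) / 4

theorem realForm_add_right (H : E →L[ℂ] E) {f : ℝ → ℝ} (hf : Measurable f) {C : ℝ}
    (hC : ∀ t, |f t| ≤ C) (φ ψ χ : E) :
    realForm H f φ (ψ + χ) = realForm H f φ ψ + realForm H f φ χ := by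
  have := sum_integral_eq_zero H ![1, -1, -1, 1, -1, 1]
    ![φ + (ψ + χ), φ - (ψ + χ), φ + ψ, φ - ψ, φ + χ, φ - χ] (fun T => by
      simp [Fin.sum_univ_succ]
      ring) hf hC
  simp [Fin.sum_univ_succ] at this
  unfold realForm
  linarith

theorem realForm_symm (H : E →L[ℂ] E) {f : ℝ → ℝ} (hf : Measurable f) {C : ℝ}
    (hC : ∀ t, |f t| ≤ C) (φ ψ : E) : realForm H f φ ψ = realForm H f ψ φ := by
  have := sum_integral_eq_zero H ![1, -1, -1, 1]
    ![φ + ψ, φ - ψ, ψ + φ, ψ - φ] (fun T => by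
      simp [Fin.sum_univ_succ]
      ring) hf hC
  simp [Fin.sum_univ_succ] at this
  unfold realForm
  linarith

theorem realForm_smul_right (H : E →L[ℂ] E) {f : ℝ → ℝ} (hf : Measurable f) {C : ℝ}
    (hC : ∀ t, |f t| ≤ C) (a : ℝ) (φ ψ : E) :
    realForm H f φ ((a : ℂ) • ψ) = a * realForm H f φ ψ := by
  have := sum_integral_eq_zero H ![1, -1, -a, a]
    ![φ + (a : ℂ) • ψ, φ - (a : ℂ) • ψ, φ + ψ, φ - ψ] (fun T => by
      simp [Fin.sum_univ_succ]
      ring) hf hC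
  simp only [Fin.sum_univ_succ, Matrix.cons_val_zero, Matrix.cons_val_succ,
    Fin.sum_univ_zero, add_zero, one_mul, neg_mul] at this
  unfold realForm
  linarith

theorem realForm_I_I (H : E →L[ℂ] E) {f : ℝ → ℝ} (hf : Measurable f) {C : ℝ}
    (hC : ∀ t, |f t| ≤ C) (φ ψ : E) :
    realForm H f (Complex.I • φ) (Complex.I • ψ) = realForm H f φ ψ := by
  have := sum_integral_eq_zero H ![1, -1, -1, 1]
    ![Complex.I • φ + Complex.I • ψ, Complex.I • φ - Complex.I • ψ, φ + ψ, φ - ψ] (fun T => by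
      simp [Fin.sum_univ_succ]
      ring) hf hC
  simp [Fin.sum_univ_succ] at this
  unfold realForm
  linarith

theorem realForm_self (H : E →L[ℂ] E) {f : ℝ → ℝ} (hf : Measurable f) {C : ℝ}
    (hC : ∀ t, |f t| ≤ C) (ψ : E) : realForm H f ψ ψ = ∫ t, f t ∂(spectralMeasure H ψ) := by
  have := sum_integral_eq_zero H ![1, -1, -4]
    ![ψ + ψ, ψ - ψ, ψ] (fun T => by
      simp [Fin.sum_univ_succ]
      ring) hf hC
  simp [Fin.sum_univ_succ] at this
  unfold realForm
  simp
  linarith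

theorem realForm_self_I (H : E →L[ℂ] E) {f : ℝ → ℝ} (hf : Measurable f) {C : ℝ}
    (hC : ∀ t, |f t| ≤ C) (ψ : E) : realForm H f ψ (Complex.I • ψ) = 0 := by
  have := sum_integral_eq_zero H ![1, -1]
    ![ψ + Complex.I • ψ, ψ - Complex.I • ψ] (fun T => by
      simp [Fin.sum_univ_succ]
      ring) hf hC
  simp [Fin.sum_univ_succ] at this
  unfold realForm
  linarith

theorem abs_integral_le (H : E →L[ℂ] E) {f : ℝ → ℝ} (hf : Measurable f) {C : ℝ}
    (hC : ∀ t, |f t| ≤ C) (ψ : E) : |∫ t, f t ∂(spectralMeasure H ψ)| ≤ C * ‖ψ‖ ^ 2 := by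
  have hC0 : 0 ≤ C := (abs_nonneg _).trans (hC 0)
  have h := norm_integral_le_of_norm_le_const (μ := spectralMeasure H ψ) (f := f)
    (C := C) (Eventually.of_forall fun t => hC t)
  refine h.trans (mul_le_mul_of_nonneg_left ?_ hC0)
  exact ENNReal.toReal_le_of_le_ofReal (by positivity) (spectralMeasure_univ_le H ψ)

theorem abs_realForm_le (H : E →L[ℂ] E) {f : ℝ → ℝ} (hf : Measurable f) {C : ℝ}
    (hC : ∀ t, |f t| ≤ C) (φ ψ : E) : |realForm H f φ ψ| ≤ C * ‖φ‖ * ‖ψ‖ := by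
  have h1 : ∀ φ ψ : E, |realForm H f φ ψ| ≤ C * (‖φ‖ ^ 2 + ‖ψ‖ ^ 2) / 2 := by
    intro φ ψ
    have ha := abs_integral_le H hf hC (φ + ψ)
    have hb := abs_integral_le H hf hC (φ - ψ)
    have hp := parallelogram_law_with_norm ℂ φ ψ
    have hs := abs_sub (∫ t, f t ∂(spectralMeasure H (φ + ψ)))
      (∫ t, f t ∂(spectralMeasure H (φ - ψ)))
    unfold realForm
    rw [abs_div, abs_of_pos (by norm_num : (0 : ℝ) < 4)]
    have : C * ‖φ + ψ‖ ^ 2 + C * ‖φ - ψ‖ ^ 2 = 2 * C * (‖φ‖ ^ 2 + ‖ψ‖ ^ 2) := by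
      linear_combination C * hp
    linarith
  have hs : realForm H f ((‖ψ‖ : ℂ) • φ) ((‖φ‖ : ℂ) • ψ)
      = ‖φ‖ * (‖ψ‖ * realForm H f φ ψ) := by
    rw [realForm_smul_right H hf hC, realForm_symm H hf hC, realForm_smul_right H hf hC,
      realForm_symm H hf hC]
  rcases eq_or_ne φ 0 with rfl | hφ
  · have := realForm_smul_right H hf hC 0 ψ 0
    rw [realForm_symm H hf hC]
    simp at this
    simp [this]
  rcases eq_or_ne ψ 0 with rfl | hψ
  · have := realForm_smul_right H hf hC 0 φ 0
    simp at this
    simp [this]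
  have h2 := h1 ((‖ψ‖ : ℂ) • φ) ((‖φ‖ : ℂ) • ψ)
  rw [hs] at h2
  simp only [abs_mul, abs_norm, norm_smul, Complex.norm_real, norm_norm] at h2
  have hp : 0 < ‖φ‖ * ‖ψ‖ := mul_pos (norm_pos_iff.mpr hφ) (norm_pos_iff.mpr hψ)
  refine le_of_mul_le_mul_left ?_ hp
  calc ‖φ‖ * ‖ψ‖ * |realForm H f φ ψ| = ‖φ‖ * (‖ψ‖ * |realForm H f φ ψ|) := by ring
    _ ≤ _ := h2
    _ = ‖φ‖ * ‖ψ‖ * (C * ‖φ‖ * ‖ψ‖) := by ring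

/-- Bounded Borel functions of a bounded operator exist. -/
theorem exists_isBorelCalculus (H : E →L[ℂ] E) {f : ℝ → ℝ} (hf : Measurable f) {C : ℝ}
    (hC : ∀ t, |f t| ≤ C) : ∃ A, IsBorelCalculus H f A := by
  have hC0 : 0 ≤ C := (abs_nonneg _).trans (hC 0)
  have hadd := realForm_add_right H hf hC
  have hsymm := realForm_symm H hf hC
  have hsm := realForm_smul_right H hf hC
  have hII := realForm_I_I H hf hC
  have hdec : ∀ (c : ℂ) (ψ : E), c • ψ = (c.re : ℂ) • ψ + (c.im : ℂ) • (Complex.I • ψ) := by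
    intro c ψ
    rw [smul_smul, ← add_smul, Complex.re_add_im]
  have hneg : ∀ φ ψ : E, realForm H f φ (-ψ) = - realForm H f φ ψ := by
    intro φ ψ
    have := hsm (-1) φ ψ
    simpa using this
  have hII' : ∀ ψ : E, Complex.I • (Complex.I • ψ) = -ψ := by
    intro ψ; rw [smul_smul, Complex.I_mul_I, neg_one_smul]
  have haddl : ∀ φ ψ χ : E, realForm H f (φ + ψ) χ = realForm H f φ χ + realForm H f ψ χ := by
    intro φ ψ χ
    rw [hsymm, hadd, hsymm χ, hsymm χ]
  have hsml : ∀ (a : ℝ) (φ ψ : E), realForm H f ((a : ℂ) • φ) ψ = a * realForm H f φ ψ := by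
    intro a φ ψ
    rw [hsymm, hsm, hsymm]
  have hIl : ∀ φ ψ : E, realForm H f (Complex.I • φ) ψ = - realForm H f φ (Complex.I • ψ) := by
    intro φ ψ
    rw [← hII φ (Complex.I • ψ), hII', hneg, neg_neg]
  let B : E →ₗ⋆[ℂ] E →ₗ[ℂ] ℂ := LinearMap.mk₂'ₛₗ (starRingEnd ℂ) (RingHom.id ℂ)
    (fun φ ψ => (realForm H f φ ψ : ℂ) - Complex.I * realForm H f φ (Complex.I • ψ))
    (fun φ ψ χ => by rw [haddl, haddl]; push_cast; ring)
    (fun c φ ψ => by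
      rw [hdec c φ, haddl, haddl, hsml, hsml, hsml, hsml, hIl, hIl, hII', hneg]
      apply Complex.ext <;> simp <;> ring)
    (fun φ ψ χ => by rw [smul_add, hadd, hadd]; push_cast; ring)
    (fun c φ ψ => by
      rw [smul_comm, hdec c ψ, hdec c (Complex.I • ψ), hadd, hadd, hsm, hsm, hsm, hsm, hII', hneg]
      apply Complex.ext <;> simp <;> ring)
  have hB : ∀ φ ψ, B φ ψ
      = (realForm H f φ ψ : ℂ) - Complex.I * realForm H f φ (Complex.I • ψ) := fun _ _ => rfl
  let B' : E →L⋆[ℂ] E →L[ℂ] ℂ := B.mkContinuous₂ (2 * C) (fun φ ψ => by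
    rw [hB]
    refine (norm_sub_le _ _).trans ?_
    rw [norm_mul, Complex.norm_I, one_mul, Complex.norm_real, Complex.norm_real]
    have h1 := abs_realForm_le H hf hC φ ψ
    have h2 := abs_realForm_le H hf hC φ (Complex.I • ψ)
    rw [norm_smul, Complex.norm_I, one_mul] at h2
    rw [Real.norm_eq_abs, Real.norm_eq_abs]
    linarith)
  refine ⟨InnerProductSpace.continuousLinearMapOfBilin B', fun ψ => ?_⟩
  rw [← inner_conj_symm, InnerProductSpace.continuousLinearMapOfBilin_apply]
  change (starRingEnd ℂ) (B ψ ψ) = _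
  rw [hB, realForm_self H hf hC, realForm_self_I H hf hC]
  simp

theorem isBorelCalculus_borelCalculus (H : E →L[ℂ] E) {f : ℝ → ℝ} (hf : Measurable f) {C : ℝ}
    (hC : ∀ t, |f t| ≤ C) : IsBorelCalculus H f (borelCalculus H f) := by
  have h := exists_isBorelCalculus H hf hC
  rw [borelCalculus, dif_pos h]
  exact h.choose_spec

end BorelCalculus

section Physics

/-- The bulk Hilbert space `ℓ²(ℤ²) ⊗ ℂᴺ`, as square-summable functions `ℤ² → ℂᴺ`. -/
abbrev BulkSpace (N : ℕ) : Type :=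
  lp (fun _ : ℤ × ℤ => EuclideanSpace ℂ (Fin N)) 2

/-- Bounded operators on the bulk Hilbert space. -/
abbrev BulkOp (N : ℕ) : Type := BulkSpace N →L[ℂ] BulkSpace N

variable {N : ℕ}

/-- The `N × N` block `A_{xy} = ⟨δ_x, A δ_y⟩`, as an operator on `ℂᴺ`. -/
def block (A : BulkOp N) (x y : ℤ × ℤ) :
    EuclideanSpace ℂ (Fin N) →L[ℂ] EuclideanSpace ℂ (Fin N) :=
  lp.evalCLM ℂ (fun _ : ℤ × ℤ => EuclideanSpace ℂ (Fin N)) 2 x ∘L A ∘L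
    lp.singleContinuousLinearMap ℂ (fun _ : ℤ × ℤ => EuclideanSpace ℂ (Fin N)) 2 y

/-- Local operators: `‖A_{xy}‖ ≤ C_α (1 + ‖x - y‖)^(-α)` for all sufficiently large `α`. -/
def IsLocal (A : BulkOp N) : Prop :=
  ∀ᶠ α : ℕ in atTop, ∃ C : ℝ, ∀ x y : ℤ × ℤ,
    ‖block A x y‖ ≤ C * (1 + ‖x - y‖) ^ (-(α : ℤ))

/-- A family of weakly-local operators with estimates that are uniform on the family: there is `ν`
such that for all sufficiently large `m` there is `C_m` with
`‖A_{xy}‖ ≤ C_m (1 + ‖x - y‖)^(-m) (1 + ‖x‖)^ν` for all members `A` and all `x, y`. -/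
def UniformlyWeaklyLocal (𝒜 : Set (BulkOp N)) : Prop :=
  ∃ ν : ℕ, ∀ᶠ m : ℕ in atTop, ∃ C : ℝ, ∀ A ∈ 𝒜, ∀ x y : ℤ × ℤ,
    ‖block A x y‖ ≤ C * (1 + ‖x - y‖) ^ (-(m : ℤ)) * (1 + ‖x‖) ^ ν

/-- A Hamiltonian is a local self-adjoint operator. -/
def IsHamiltonian (H : BulkOp N) : Prop :=
  IsSelfAdjoint H ∧ IsLocal H

/-- The Borel functions `f` with `‖f‖_∞ ≤ 1` that are constant on `(-∞, inf Δ]` and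
on `[sup Δ, ∞)`. -/
def IsGapFunction (Δ : Set ℝ) (f : ℝ → ℝ) : Prop :=
  Measurable f ∧ (∀ t, |f t| ≤ 1) ∧
    (∀ s ∈ lowerBounds Δ, ∀ t ∈ lowerBounds Δ, f s = f t) ∧
    (∀ s ∈ upperBounds Δ, ∀ t ∈ upperBounds Δ, f s = f t)

/-- `H` is a Hamiltonian with a mobility gap on `Δ`: the operators `f(H)` are weakly-local,
uniformly in the gap functions `f`, and the eigenvalues of `H` in `Δ` have finite multiplicity. -/
def IsMobilityGapped (H : BulkOp N) (Δ : Set ℝ) : Prop :=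
  IsHamiltonian H ∧
    UniformlyWeaklyLocal {A | ∃ f, IsGapFunction Δ f ∧ A = borelCalculus H f} ∧
    ∀ E ∈ Δ, FiniteDimensional ℂ
      (Module.End.eigenspace (H : BulkSpace N →ₗ[ℂ] BulkSpace N) (E : ℂ))

/-- The Fermi projection `χ_{(-∞, μ)}(H)`. -/
def fermiProjection (H : BulkOp N) (μ : ℝ) : BulkOp N :=
  borelCalculus H ((Set.Iio μ).indicator fun _ => 1)

/-- The operator of multiplication by a function `u : ℤ² → ℂ` with `|u| ≤ 1`. -/
def multOp (N : ℕ) (u : ℤ × ℤ → ℂ) (hu : ∀ x, ‖u x‖ ≤ 1) : BulkOp N :=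
  lp.mapCLM 2 (fun x => u x • ContinuousLinearMap.id ℂ (EuclideanSpace ℂ (Fin N))) zero_le_one
    fun x => ContinuousLinearMap.opNorm_le_bound _ zero_le_one fun v => by
      simpa [norm_smul] using mul_le_mul_of_nonneg_right (hu x) (norm_nonneg v)

theorem multOp_apply (u : ℤ × ℤ → ℂ) (hu : ∀ x, ‖u x‖ ≤ 1) (ψ : BulkSpace N) (x : ℤ × ℤ) :
    multOp N u hu ψ x = u x • ψ x := rfl

/-- The projection `Λ₁` onto the right half plane `x₁ ≥ 0`. -/
def rightProj (N : ℕ) : BulkOp N :=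
  multOp N (fun x => if 0 ≤ x.1 then 1 else 0) fun x => by split_ifs <;> simp

/-- The projection `Λ₂` onto the upper half plane `x₂ ≥ 0`. -/
def upperProj (N : ℕ) : BulkOp N :=
  multOp N (fun x => if 0 ≤ x.2 then 1 else 0) fun x => by split_ifs <;> simp

/-- The flux insertion operator `U = exp(i arg(X₁ + i X₂))` (with `arg 0 = 0` at the origin). -/
def fluxOp (N : ℕ) : BulkOp N :=
  multOp N (fun x => Complex.exp (Complex.I * (Complex.arg ((x.1 : ℂ) + Complex.I * (x.2 : ℂ)) : ℂ)))
    fun x => by rw [mul_comm, Complex.norm_exp_ofReal_mul_I]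

/-- The operator `P A P + P^⊥`, with `P^⊥ = 1 - P`. -/
def compress (P A : BulkOp N) : BulkOp N :=
  P * A * P + (1 - P)

/-- `𝕎₁ A = Λ₁ exp(-2πi A) Λ₁ + 1 - Λ₁`. -/
def windingOp (A : BulkOp N) : BulkOp N :=
  compress (rightProj N) (NormedSpace.exp ((-(2 * Real.pi * Complex.I) : ℂ) • A))

/-- The integer Fredholm index `dim ker F - dim ker F*`. -/
def index (F : BulkOp N) : ℤ :=
  (Module.finrank ℂ F.ker : ℤ) - Module.finrank ℂ (ContinuousLinearMap.adjoint F).ker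

/-- The index `dim ker F mod 2`. -/
def indexTwo (F : BulkOp N) : ZMod 2 :=
  (Module.finrank ℂ F.ker : ZMod 2)

/-- A Fermionic time-reversal symmetry: an antilinear, antiunitary `Θ` with `Θ² = -1` that commutes
with the (unbounded) position operators `X₁` and `X₂`. In the last two fields, the first equation
says that `ψ` is in the domain of `X_j` and `φ = X_j ψ`, the second one that `Θ ψ` is in the domain
of `X_j` and `Θ φ = X_j Θ ψ`. -/
structure TimeReversal (N : ℕ) where
  toFun : BulkSpace N →ₗ⋆[ℂ] BulkSpace N
  inner_map : ∀ ψ φ, ⟪toFun ψ, toFun φ⟫_ℂ = ⟪φ, ψ⟫_ℂ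
  sq_eq_neg : ∀ ψ, toFun (toFun ψ) = -ψ
  comm_fst : ∀ ψ φ : BulkSpace N, (∀ x : ℤ × ℤ, φ x = (x.1 : ℂ) • ψ x) →
    ∀ x : ℤ × ℤ, toFun φ x = (x.1 : ℂ) • toFun ψ x
  comm_snd : ∀ ψ φ : BulkSpace N, (∀ x : ℤ × ℤ, φ x = (x.2 : ℂ) • ψ x) →
    ∀ x : ℤ × ℤ, toFun φ x = (x.2 : ℂ) • toFun ψ x

/-- `H` is time-reversal invariant: `[H, Θ] = 0`. -/
def IsTRI (Θ : TimeReversal N) (H : BulkOp N) : Prop :=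
  ∀ ψ, H (Θ.toFun ψ) = Θ.toFun (H ψ)

/-- `Θ`-odd Fredholm operators: `F` is Fredholm and `F = -Θ F* Θ`. -/
def IsOddFredholm (Θ : TimeReversal N) (F : BulkOp N) : Prop :=
  F.IsFredholm ∧ ∀ ψ, F ψ = -Θ.toFun (ContinuousLinearMap.adjoint F (Θ.toFun ψ))

end Physics

end FluxKitaev

end

open FluxKitaev

noncomputable section

/-! Everything takes place modulo the closed ideal of norm limits of finite-rank operators
(`compactIdeal`). Call `g : ℤ² → ℂ` slowly varying if `|g x - g y| ‖x‖ ≤ C ‖x - y‖`; bounded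
functions of direction such as `U` have this property. Weak locality allows polynomial growth in
`x`, but interpolation with the trivial bound `‖A_{xy}‖ ≤ ‖A‖` reduces the growth to a square root,
and `IsWeaklyLocal.commutator_mem` follows: `P` commutes with slowly varying functions in the Calkin
algebra. If `μ = inf Δ`, `P` itself need not be weakly local, but it is so up to the finite-rank
eigenprojection at `μ`.

Half-plane indicators are not slowly varying. However, near the vertical axis `Λ₂` agrees with a
slowly varying step function `f` which takes only the values `0` and `1` there, so `exp(2πi P Λ₂ P)
- 1` is compact when localized to a cone about that axis (`calkin_coneFun_mul_expInterpolation`).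
Away from this cone `Λ₁` is slowly varying. Hence `Λ₁` commutes with the exponential modulo
compacts, which gives Fredholmness.

Deform `Λ₂` to `f` on the right half plane. The resulting operator equals `P U' P + 1 - P` modulo
compacts, where `U'` (`sectorPhase`) is `exp(2πi f)` on the right half plane and `1` on the left
(`calkin_compress_expInterpolation_zero`). Both `U` and `U'` wind once around the circle. With the
phases used here `U` stays uniformly away from `U'`, so the segment from `U` to `-U'` consists of
invertible functions; the sign is absorbed by the unitary `1 - 2P`. Thus three norm-continuous paths
of Fredholm operators connect the two sides, up to this sign. The adjoint of the last operator is
`𝕎₁(P Λ₂ P)`, whence the minus sign in the integer identity.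

The integer index is locally constant by comparison with a generalized inverse. For the index modulo
two, every path is kept inside `{F : Θ F = F* Θ}`. There `⟨Θ x, G y⟩` is a skew bilinear form on a
space of dimension `dim ker F` with null space `ker G`, for `G` near `F`; since skew forms have even
rank, the parity of `dim ker` is locally constant (`eventually_finrank_ker_eq_of_odd`). -/

namespace FluxKitaev

/-! ### The Calkin algebra and Atkinson's criterion -/

section Calkin

variable {E : Type*} [NormedAddCommGroup E] [InnerProductSpace ℂ E]

variable (E) in
/-- The ideal of bounded operators of finite rank. -/
def finiteRankIdeal : Ideal (E →L[ℂ] E) where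
  carrier := {A | (A : E →ₗ[ℂ] E).HasFiniteRange}
  add_mem' ha hb := ha.add hb
  zero_mem' := LinearMap.HasFiniteRange.zero
  smul_mem' c _ ha := LinearMap.HasFiniteRange.comp_left ha (v := (c : E →ₗ[ℂ] E))

theorem mem_finiteRankIdeal {A : E →L[ℂ] E} :
    A ∈ finiteRankIdeal E ↔ (A : E →ₗ[ℂ] E).HasFiniteRange := Iff.rfl

theorem finiteRankIdeal_mul_mem {A : E →L[ℂ] E} (hA : A ∈ finiteRankIdeal E) (B : E →L[ℂ] E) :
    A * B ∈ finiteRankIdeal E :=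
  LinearMap.HasFiniteRange.comp_right (v := (A : E →ₗ[ℂ] E)) (u := (B : E →ₗ[ℂ] E)) hA

variable (E) in
/-- The ideal of norm limits of operators of finite rank. -/
def compactIdeal : Ideal (E →L[ℂ] E) := (finiteRankIdeal E).closure

theorem isClosed_compactIdeal : IsClosed (compactIdeal E : Set (E →L[ℂ] E)) := by
  rw [compactIdeal, Ideal.coe_closure]
  exact isClosed_closure

theorem finiteRankIdeal_le_compactIdeal : finiteRankIdeal E ≤ compactIdeal E := fun _ hx => by
  rw [← SetLike.mem_coe, compactIdeal, Ideal.coe_closure]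
  exact subset_closure hx

instance : (compactIdeal E).IsTwoSided where
  mul_mem_of_left {a} b ha := by
    rw [← SetLike.mem_coe, compactIdeal, Ideal.coe_closure] at ha ⊢
    exact map_mem_closure (f := fun x => x * b) (by fun_prop) ha
      fun x hx => finiteRankIdeal_mul_mem hx b

/-- The quotient map onto the Calkin algebra. -/
abbrev calkin : (E →L[ℂ] E) →+* (E →L[ℂ] E) ⧸ compactIdeal E :=
  Ideal.Quotient.mk (compactIdeal E)

theorem calkin_eq_iff {A B : E →L[ℂ] E} : calkin A = calkin B ↔ A - B ∈ compactIdeal E :=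
  Ideal.Quotient.eq

theorem exists_finiteRank_of_mem_compactIdeal {A : E →L[ℂ] E} (hA : A ∈ compactIdeal E) {ε : ℝ}
    (hε : 0 < ε) : ∃ B ∈ finiteRankIdeal E, ‖A - B‖ < ε := by
  rw [← SetLike.mem_coe, compactIdeal, Ideal.coe_closure, Metric.mem_closure_iff] at hA
  obtain ⟨B, hB, h⟩ := hA ε hε
  exact ⟨B, hB, by rwa [← dist_eq_norm]⟩

theorem mem_compactIdeal_of_forall {A : E →L[ℂ] E}
    (h : ∀ ε > 0, ∃ B ∈ finiteRankIdeal E, ‖A - B‖ ≤ ε) : A ∈ compactIdeal E := by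
  rw [← SetLike.mem_coe, compactIdeal, Ideal.coe_closure, Metric.mem_closure_iff]
  intro ε hε
  obtain ⟨B, hB, h⟩ := h (ε / 2) (half_pos hε)
  exact ⟨B, hB, by rw [dist_eq_norm]; linarith⟩

variable [CompleteSpace E]

/-- An operator that is congruent to `1` modulo compact operators is, up to an invertible factor,
congruent to `1` modulo operators of finite rank. -/
theorem exists_unit_of_sub_one_mem {T : E →L[ℂ] E} (hT : T - 1 ∈ compactIdeal E) :
    ∃ V : (E →L[ℂ] E)ˣ, (V : E →L[ℂ] E) - T ∈ finiteRankIdeal E := by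
  obtain ⟨B, hB, h⟩ := exists_finiteRank_of_mem_compactIdeal hT one_pos
  -- `T - B = 1 + (T - 1 - B)` is invertible by the Neumann series, the bracket having norm below
  -- `1`.
  refine ⟨Units.oneSub (-(T - 1 - B)) (by rwa [norm_neg]), ?_⟩
  have : ((Units.oneSub (-(T - 1 - B)) (by rwa [norm_neg]) : (E →L[ℂ] E)ˣ) : E →L[ℂ] E) - T
      = -B := by
    rw [Units.val_oneSub]; abel
  rw [this]
  exact (finiteRankIdeal E).neg_mem hB

/-- Correcting `G` by invertible factors on either side gives a left inverse `L` and a right inverse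
`R` of `F` modulo finite rank. As in any ring, the two agree in the quotient, so `R` is a two-sided
quasi-inverse. -/
theorem isFredholm_of_mul_sub_one_mem {F G : E →L[ℂ] E} (h₁ : G * F - 1 ∈ compactIdeal E)
    (h₂ : F * G - 1 ∈ compactIdeal E) : F.IsFredholm := by
  obtain ⟨V, hV⟩ := exists_unit_of_sub_one_mem h₁
  obtain ⟨W, hW⟩ := exists_unit_of_sub_one_mem h₂
  have hl : ((V⁻¹ : (E →L[ℂ] E)ˣ) : E →L[ℂ] E) * G * F - 1 ∈ finiteRankIdeal E := by
    have := (finiteRankIdeal E).neg_mem ((finiteRankIdeal E).mul_mem_left (↑V⁻¹) hV)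
    rwa [mul_sub, Units.inv_mul, neg_sub, ← mul_assoc] at this
  have hr : F * (G * ((W⁻¹ : (E →L[ℂ] E)ˣ) : E →L[ℂ] E)) - 1 ∈ finiteRankIdeal E := by
    have := (finiteRankIdeal E).neg_mem (finiteRankIdeal_mul_mem hW (↑W⁻¹))
    rwa [sub_mul, Units.mul_inv, neg_sub, mul_assoc] at this
  set L : E →L[ℂ] E := ((V⁻¹ : (E →L[ℂ] E)ˣ) : E →L[ℂ] E) * G
  set R : E →L[ℂ] E := G * ((W⁻¹ : (E →L[ℂ] E)ˣ) : E →L[ℂ] E)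
  have hLR : R - L ∈ finiteRankIdeal E := by
    have h3 := finiteRankIdeal_mul_mem hl R
    have h4 := (finiteRankIdeal E).mul_mem_left L hr
    have : R - L = L * (F * R - 1) - (L * F - 1) * R := by noncomm_ring
    rw [this]
    exact (finiteRankIdeal E).sub_mem h4 h3
  have hRF : R * F - 1 ∈ finiteRankIdeal E := by
    have : R * F - 1 = (R - L) * F + (L * F - 1) := by noncomm_ring
    rw [this]
    exact (finiteRankIdeal E).add_mem (finiteRankIdeal_mul_mem hLR F) hl
  refine ContinuousLinearMap.IsFredholm.of_isQuasiInverse (v := R) ⟨?_, ?_⟩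
  · exact LinearMap.FiniteRangeSetoid.equiv_iff_hasFiniteRange.mpr hRF
  · exact LinearMap.FiniteRangeSetoid.equiv_iff_hasFiniteRange.mpr hr

theorem isFredholm_of_calkin_mul_eq_one {F G : E →L[ℂ] E} (h₁ : calkin G * calkin F = 1)
    (h₂ : calkin F * calkin G = 1) : F.IsFredholm := by
  refine isFredholm_of_mul_sub_one_mem (G := G) ?_ ?_
  · rw [← calkin_eq_iff]; simpa using h₁
  · rw [← calkin_eq_iff]; simpa using h₂

end Calkin

/-! ### Linear algebra behind the stability of the indices -/

section LocalConstancy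

variable {V : Type*} [AddCommGroup V] [Module ℂ V]

/-- If `1 + L (G - F)` is invertible, `L` a generalized inverse of `F`, then it identifies
`ker (L G)` with `ker F`. -/
theorem ker_mul_eq_comap_ker {F L G : Module.End ℂ V} (hF : F * L * F = F) (hL : L * F * L = L) :
    LinearMap.ker (L * G) = (LinearMap.ker F).comap (1 + L * (G - F)) := by
  ext x
  simp only [LinearMap.mem_ker, Submodule.mem_comap]
  rw [← Module.End.mul_apply]
  have h1 : F * (1 + L * (G - F)) = F * (L * G) := by
    rw [mul_add, mul_sub, mul_sub, ← mul_assoc F L F, hF]; noncomm_ring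
  have h2 : L * G = L * (F * (L * G)) := by
    rw [← mul_assoc F, ← mul_assoc, ← mul_assoc, hL]
  constructor
  · intro h
    rw [h1, Module.End.mul_apply, h, map_zero]
  · intro h
    rw [h2, ← h1, Module.End.mul_apply, h, map_zero]

theorem finrank_ker_mul_eq {F L G : Module.End ℂ V} (hF : F * L * F = F) (hL : L * F * L = L)
    (hX : Function.Bijective ⇑(1 + L * (G - F) : Module.End ℂ V)) :
    Module.finrank ℂ (LinearMap.ker (L * G)) = Module.finrank ℂ (LinearMap.ker F) := by
  rw [ker_mul_eq_comap_ker hF hL]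
  exact (LinearEquiv.ofSubmodule' (LinearEquiv.ofBijective _ hX) (LinearMap.ker F)).finrank_eq

theorem finiteDimensional_ker_mul {F L G : Module.End ℂ V} (hF : F * L * F = F)
    (hL : L * F * L = L) (hX : Function.Bijective ⇑(1 + L * (G - F) : Module.End ℂ V))
    [FiniteDimensional ℂ (LinearMap.ker F)] : FiniteDimensional ℂ (LinearMap.ker (L * G)) := by
  rw [ker_mul_eq_comap_ker hF hL]
  exact (LinearEquiv.ofSubmodule' (LinearEquiv.ofBijective _ hX) (LinearMap.ker F)).symm.finiteDimensional

/-- Count dimensions in the exact sequence `0 → ker G → ker (L G) → ker L → V / ran G → 0`, whose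
second map is `G`, using `dim ker (L G) = dim ker F`. -/
theorem finrank_coker_add {F L G : Module.End ℂ V} (hF : F * L * F = F) (hL : L * F * L = L)
    (hX : Function.Bijective ⇑(1 + L * (G - F) : Module.End ℂ V)) [FiniteDimensional ℂ (LinearMap.ker F)]
    [FiniteDimensional ℂ (LinearMap.ker L)] :
    Module.finrank ℂ (V ⧸ LinearMap.range G) + Module.finrank ℂ (LinearMap.ker F)
      = Module.finrank ℂ (LinearMap.ker L) + Module.finrank ℂ (LinearMap.ker G) := by
  have := finiteDimensional_ker_mul hF hL hX
  let g : LinearMap.ker (L * G) →ₗ[ℂ] LinearMap.ker L :=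
    G.restrict (fun x hx => by simpa using hx)
  have hg : ∀ x, (g x : V) = G x := fun x => rfl
  let q : LinearMap.ker L →ₗ[ℂ] V ⧸ LinearMap.range G :=
    (LinearMap.range G).mkQ ∘ₗ (LinearMap.ker L).subtype
  have hq : Function.Surjective q := by
    intro y
    obtain ⟨y, rfl⟩ := Submodule.mkQ_surjective _ y
    -- Applying `L F` to this equation turns it into `L G x = L y`, so `y - G x` is a representative
    -- in `ker L`.
    obtain ⟨x, hx⟩ := hX.2 (L y)
    have h1 : F x = F (L (F x)) := by
      conv_lhs => rw [← hF]
      rfl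
    have h2 : L (F (L y)) = L y := by
      conv_rhs => rw [← hL]
      rfl
    have h3 : L (F (L (G x))) = L (G x) := by
      conv_rhs => rw [← hL]
      rfl
    have hx' : x + (L (G x) - L (F x)) = L y := by simpa using hx
    have h4 : L (G x) = L y := by
      have := congrArg (fun z => L (F z)) hx'
      simp only [map_add, map_sub, ← h1, h2, h3] at this
      simpa using this
    refine ⟨⟨y - G x, by simp [h4]⟩, ?_⟩
    simp [q]
  have hqk : LinearMap.ker q = LinearMap.range g := by
    ext ⟨c, hc⟩
    simp only [LinearMap.mem_ker, q, LinearMap.comp_apply, Submodule.subtype_apply,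
      Submodule.mkQ_apply, Submodule.Quotient.mk_eq_zero, LinearMap.mem_range]
    constructor
    · rintro ⟨x, rfl⟩
      exact ⟨⟨x, by simpa using hc⟩, rfl⟩
    · rintro ⟨x, hx⟩
      exact ⟨x, congrArg Subtype.val hx⟩
  have e1 := LinearMap.finrank_range_add_finrank_ker g
  have e2 := LinearMap.finrank_range_add_finrank_ker q
  rw [hqk, LinearMap.range_eq_top.mpr hq, finrank_top] at e2
  have e3 : Module.finrank ℂ (LinearMap.ker g) = Module.finrank ℂ (LinearMap.ker G) := by
    have : LinearMap.ker g = (LinearMap.ker G).comap (LinearMap.ker (L * G)).subtype := by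
      ext x
      simp [Subtype.ext_iff, hg]
    rw [this]
    refine (Submodule.comapSubtypeEquivOfLe ?_).finrank_eq
    intro x hx
    simp only [LinearMap.mem_ker, Module.End.mul_apply] at hx ⊢
    rw [hx, map_zero]
  rw [finrank_ker_mul_eq hF hL hX] at e1
  omega

/-- A skew-symmetric bilinear form has even rank. -/
theorem even_finrank_sub_of_skew {W : Type*} [AddCommGroup W] [Module ℂ W]
    [FiniteDimensional ℂ W] (b : W →ₗ[ℂ] W →ₗ[ℂ] ℂ) (hb : ∀ x y, b x y = -b y x) :
    (Module.finrank ℂ W : ZMod 2) = Module.finrank ℂ (LinearMap.ker b) := by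
  obtain ⟨Q, hQ⟩ := (LinearMap.ker b).exists_isCompl
  have hd := Submodule.finrank_add_eq_of_isCompl hQ
  let B : LinearMap.BilinForm ℂ Q := b.domRestrict₁₂ Q Q
  have hBnd : B.Nondegenerate := by
    have hsym : ∀ x y, B x y = - B y x := fun x y => hb x y
    have hl : B.SeparatingLeft := by
      intro x hx
      have : (x : W) ∈ LinearMap.ker b := by
        rw [LinearMap.mem_ker]
        ext w
        obtain ⟨k, hk, q, hq, rfl⟩ := Submodule.mem_sup.mp
          (hQ.sup_eq_top ▸ Submodule.mem_top : w ∈ LinearMap.ker b ⊔ Q)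
        have h1 : b x k = 0 := by rw [hb, LinearMap.mem_ker.mp hk]; simp
        have h2 : b x q = 0 := hx ⟨q, hq⟩
        simp [h1, h2]
      have h0 := (Submodule.disjoint_def.mp hQ.disjoint) x this x.2
      exact Subtype.ext h0
    refine ⟨hl, fun x hx => hl x fun y => ?_⟩
    rw [hsym, hx y, neg_zero]
  let v := Module.finBasis ℂ Q
  have hdet := (LinearMap.BilinForm.nondegenerate_iff_det_ne_zero v).mp hBnd
  set A := LinearMap.BilinForm.toMatrix v B
  have hA : A.transpose = -A := by
    ext i j
    simp only [A, Matrix.transpose_apply, Matrix.neg_apply, LinearMap.BilinForm.toMatrix_apply]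
    exact hb _ _
  -- On a complement of the null space the Gram matrix is invertible and skew, which is impossible
  -- in odd size.
  have h1 : A.det = (-1) ^ Module.finrank ℂ Q * A.det := by
    conv_lhs => rw [← Matrix.det_transpose, hA, Matrix.det_neg, Fintype.card_fin]
  have heven : Even (Module.finrank ℂ Q) := by
    by_contra hodd
    rw [Nat.not_even_iff_odd] at hodd
    rw [hodd.neg_one_pow] at h1
    exact hdet (by linear_combination h1 / 2)
  rw [← hd, Nat.cast_add, heven.natCast_zmod_two, add_zero]

end LocalConstancy

/-! ### Local constancy of the integer index and of the parity -/

section FredholmPath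

open Topology

variable {E : Type*} [NormedAddCommGroup E] [InnerProductSpace ℂ E] [CompleteSpace E]

/-- The Moore-Penrose inverse of a Fredholm operator. -/
theorem exists_moorePenrose {F : E →L[ℂ] E} (hF : F.IsFredholm) :
    ∃ L : E →L[ℂ] E, F * L * F = F ∧ L * F * L = L ∧
      L.ker = F.rangeᗮ ∧ ∀ x y, F x = 0 → ⟪x, L y⟫_ℂ = 0 := by
  have := hF.isClosed_range.completeSpace_coe
  have := hF.finite_ker
  let pkg := hF.fredholmPackage (F.ker.isTopCompl_orthogonal)
    (F.range.isTopCompl_orthogonal)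
  have hproj : ∀ (dec : FredholmDecomposition ℂ E) (z : dec.X₁), dec.proj z = z :=
    fun dec z => by simp
  have hL : ∀ x, pkg.quasiInverse x = (pkg.equiv.symm (pkg.decCodom.proj x) : E) := fun x => rfl
  have hF' : ∀ x, F x = (pkg.equiv (pkg.decDom.proj x) : E) := fun x => by
    conv_lhs => rw [pkg.eq_equiv]
    rfl
  have hdom : ∀ x, F (pkg.decDom.proj x : E) = F x := by
    intro x
    rw [hF' (pkg.decDom.proj x : E), hF' x, hproj]
  have h1 : ∀ x, pkg.quasiInverse (F x) = pkg.decDom.proj x := by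
    intro x
    rw [hL, hF']
    simp
  have h2 : ∀ x, F (pkg.quasiInverse x) = pkg.decCodom.proj x := by
    intro x
    rw [hL, hF']
    simp
  refine ⟨pkg.quasiInverse, ?_, ?_, ?_, ?_⟩
  · ext x
    change F (pkg.quasiInverse (F x)) = F x
    rw [h1, hdom]
  · ext x
    change pkg.quasiInverse (F (pkg.quasiInverse x)) = pkg.quasiInverse x
    rw [h2, hL, hL, hproj]
  · ext x
    rw [LinearMap.mem_ker]
    change pkg.quasiInverse x = 0 ↔ _
    rw [hL]
    have : (pkg.equiv.symm (pkg.decCodom.proj x) : E) = 0 ↔ pkg.decCodom.proj x = 0 := by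
      simp
    rw [this]
    change _ ↔ x ∈ pkg.decCodom.X₀
    simp
  · intro x y hx
    have : (pkg.quasiInverse y) ∈ pkg.decDom.X₁ := by
      rw [hL]; exact Subtype.property _
    exact (Submodule.mem_orthogonal _ _).mp this x hx

/-- Neumann series: `L (G - F)` has norm below `1` for `G` close to `F`. -/
theorem eventually_bijective (F L : E →L[ℂ] E) :
    ∀ᶠ G : E →L[ℂ] E in 𝓝 F, Function.Bijective
      ⇑(1 + (L : E →ₗ[ℂ] E) * ((G : E →ₗ[ℂ] E) - F) : Module.End ℂ E) := by
  have hc : Tendsto (fun G => ‖-(L * (G - F))‖) (𝓝 F) (𝓝 0) := by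
    have : Continuous fun G => ‖-(L * (G - F))‖ := by fun_prop
    simpa using this.tendsto F
  filter_upwards [hc.eventually_lt_const one_pos] with G hG
  let u := Units.oneSub (-(L * (G - F))) hG
  have hu : ∀ x, (u : E →L[ℂ] E) x
      = (1 + (L : E →ₗ[ℂ] E) * ((G : E →ₗ[ℂ] E) - F) : Module.End ℂ E) x := by
    intro x
    simp [u, Units.val_oneSub]
  refine Function.bijective_iff_has_inverse.mpr ⟨fun x => (↑u⁻¹ : E →L[ℂ] E) x, fun x => ?_, fun x => ?_⟩
  · rw [← hu]
    change ((↑u⁻¹ : E →L[ℂ] E) * u) x = x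
    simp
  · rw [← hu]
    change ((u : E →L[ℂ] E) * ↑u⁻¹) x = x
    simp

theorem finrank_ker_adjoint {F : E →L[ℂ] E} (hF : F.IsFredholm) :
    Module.finrank ℂ (ContinuousLinearMap.adjoint F).ker = Module.finrank ℂ (E ⧸ F.range) := by
  have := hF.isClosed_range.completeSpace_coe
  rw [← ContinuousLinearMap.orthogonal_range]
  exact (Submodule.quotientEquivOfIsCompl _ _
    (Submodule.isTopCompl_orthogonal F.range).isCompl).finrank_eq.symm

theorem finiteDimensional_orthogonal_range {F : E →L[ℂ] E} (hF : F.IsFredholm) :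
    FiniteDimensional ℂ F.rangeᗮ := by
  have := hF.isClosed_range.completeSpace_coe
  exact .of_fg (hF.finite_coker.fg_of_isCompl (Submodule.isTopCompl_orthogonal F.range).isCompl)

/-- For the Moore-Penrose inverse, `ker L = (ran F)ᗮ = ker F*`, so `finrank_coker_add` is exactly
the equality of the two indices. -/
theorem eventually_index_eq {F : E →L[ℂ] E} (hF : F.IsFredholm) :
    ∀ᶠ G : E →L[ℂ] E in 𝓝 F, G.IsFredholm →
      (Module.finrank ℂ G.ker : ℤ) - Module.finrank ℂ (ContinuousLinearMap.adjoint G).ker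
      = (Module.finrank ℂ F.ker : ℤ) - Module.finrank ℂ (ContinuousLinearMap.adjoint F).ker := by
  obtain ⟨L, h1, h2, h3, -⟩ := exists_moorePenrose hF
  have := hF.finite_ker
  have : FiniteDimensional ℂ L.ker := by
    rw [h3]; exact finiteDimensional_orthogonal_range hF
  filter_upwards [eventually_bijective F L] with G hX hG
  have h1' : (F : E →ₗ[ℂ] E) * (L : E →ₗ[ℂ] E) * (F : E →ₗ[ℂ] E) = F :=
    congrArg ContinuousLinearMap.toLinearMap h1
  have h2' : (L : E →ₗ[ℂ] E) * (F : E →ₗ[ℂ] E) * (L : E →ₗ[ℂ] E) = L :=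
    congrArg ContinuousLinearMap.toLinearMap h2
  have e := finrank_coker_add (F := (F : E →ₗ[ℂ] E)) (L := (L : E →ₗ[ℂ] E))
    (G := (G : E →ₗ[ℂ] E)) h1' h2' hX
  have h4 : Module.finrank ℂ L.ker = Module.finrank ℂ (ContinuousLinearMap.adjoint F).ker := by
    rw [h3, ContinuousLinearMap.orthogonal_range]
  rw [finrank_ker_adjoint hG]
  omega

/-- The condition `F = -Θ F* Θ`, in the form `Θ F = F* Θ`. -/
theorem eventually_finrank_ker_eq_of_odd (Θ : E →ₗ⋆[ℂ] E) (hΘ : ∀ ψ φ, ⟪Θ ψ, Θ φ⟫_ℂ = ⟪φ, ψ⟫_ℂ)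
    (hΘ2 : ∀ ψ, Θ (Θ ψ) = -ψ) {F : E →L[ℂ] E} (hF : F.IsFredholm)
    (hodd : ∀ ψ, Θ (F ψ) = ContinuousLinearMap.adjoint F (Θ ψ)) :
    ∀ᶠ G : E →L[ℂ] E in 𝓝 F, (∀ ψ, Θ (G ψ) = ContinuousLinearMap.adjoint G (Θ ψ)) →
      (Module.finrank ℂ G.ker : ZMod 2) = Module.finrank ℂ F.ker := by
  obtain ⟨L, h1, h2, h3, h4⟩ := exists_moorePenrose hF
  have := hF.finite_ker
  filter_upwards [eventually_bijective F L] with G hX hG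
  have h1' : (F : E →ₗ[ℂ] E) * (L : E →ₗ[ℂ] E) * (F : E →ₗ[ℂ] E) = F :=
    congrArg ContinuousLinearMap.toLinearMap h1
  have h2' : (L : E →ₗ[ℂ] E) * (F : E →ₗ[ℂ] E) * (L : E →ₗ[ℂ] E) = L :=
    congrArg ContinuousLinearMap.toLinearMap h2
  have := finiteDimensional_ker_mul h1' h2' hX
  have hfin := finrank_ker_mul_eq h1' h2' hX
  set W : Submodule ℂ E := LinearMap.ker ((L : E →ₗ[ℂ] E) * (G : E →ₗ[ℂ] E)) with hW
  let b : W →ₗ[ℂ] W →ₗ[ℂ] ℂ := LinearMap.mk₂ ℂ (fun x y => ⟪Θ x, G y⟫_ℂ)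
    (fun x y z => by simp) (fun c x y => by simp [mul_comm])
    (fun x y z => by simp) (fun c x y => by simp)
  have hb : ∀ x y : W, b x y = ⟪Θ x, G y⟫_ℂ := fun _ _ => rfl
  have hskew : ∀ x y, b x y = - b y x := by
    intro x y
    rw [hb, hb, ← hΘ, hΘ2, hG, inner_neg_right, ContinuousLinearMap.adjoint_inner_left]
  -- For `x` in the null space, `G x ∈ ker L = ker F*`, so by oddness `k = -Θ G x` lies in `ker F`.
  -- The bijection `1 + L (G - F)` yields `y ∈ W` with `y = k + L F y`. Then `b x y = 0` gives `⟨k,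
  -- y⟩ = 0`, while `ran L ⟂ ker F` gives `⟨k, y⟩ = ‖k‖²`. Hence `k = 0` and `G x = 0`.
  have hker : LinearMap.ker b = G.ker.comap W.subtype := by
    ext x
    rw [LinearMap.mem_ker, Submodule.mem_comap]
    constructor
    · intro hx
      have hc : G x ∈ F.rangeᗮ := by
        rw [← h3]
        exact x.2
      rw [ContinuousLinearMap.orthogonal_range] at hc
      have hFk : F (-Θ (G x)) = 0 := by
        have : Θ (F (-Θ (G x))) = 0 := by
          rw [hodd, map_neg, hΘ2, neg_neg]
          exact hc
        have h5 := hΘ2 (F (-Θ (G x)))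
        rw [this, map_zero] at h5
        exact (neg_eq_zero.mp h5.symm)
      obtain ⟨y, hy⟩ := hX.2 (-Θ (G x))
      have hyW : y ∈ W := by
        rw [hW, ker_mul_eq_comap_ker h1' h2', Submodule.mem_comap, hy]
        exact hFk
      have hy' : y + (L (G y) - L (F y)) = -Θ (G x) := by simpa using hy
      have hLG : L (G y) = 0 := hyW
      have h6 : b x ⟨y, hyW⟩ = 0 := by rw [hx]; rfl
      rw [hskew, neg_eq_zero, hb] at h6
      have h7 : G x = Θ (-Θ (G x)) := by rw [map_neg, hΘ2, neg_neg]
      set k := -Θ (G x)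
      rw [h7, hΘ] at h6
      have h8 : y = k + L (F y) := by rw [← hy', hLG]; abel
      change ⟪k, y⟫_ℂ = 0 at h6
      rw [h8, inner_add_right, h4 k _ hFk, add_zero, inner_self_eq_zero] at h6
      rw [h6, map_zero] at h7
      exact h7
    · intro hx
      ext y
      rw [hskew, hb]
      have : G x = 0 := hx
      rw [this]; simp
  have hle : G.ker ≤ W := by
    intro x hx
    have : G x = 0 := hx
    simp [hW, this]
  have e := even_finrank_sub_of_skew b hskew
  rw [hker, hfin] at e
  rw [← (Submodule.comapSubtypeEquivOfLe hle).finrank_eq]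
  exact e.symm

end FredholmPath

/-! ### Invariance of the indices along paths -/

section BulkPath

open Topology

variable {N : ℕ}

theorem index_eq_of_path {γ : unitInterval → BulkOp N} (hγ : Continuous γ)
    (hF : ∀ t, (γ t).IsFredholm) : index (γ 0) = index (γ 1) := by
  have : IsLocallyConstant fun t => index (γ t) := by
    rw [IsLocallyConstant.iff_eventually_eq]
    intro t
    filter_upwards [hγ.continuousAt.eventually (eventually_index_eq (hF t))] with s hs
    exact hs (hF s)
  exact this.apply_eq_of_preconnectedSpace 0 1

/-- The condition `F = -Θ F* Θ`, in the form `Θ F = F* Θ`. -/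
def IsOdd (Θ : TimeReversal N) (F : BulkOp N) : Prop :=
  ∀ ψ, Θ.toFun (F ψ) = ContinuousLinearMap.adjoint F (Θ.toFun ψ)

theorem IsOdd.isOddFredholm {Θ : TimeReversal N} {F : BulkOp N} (h : IsOdd Θ F)
    (hF : F.IsFredholm) : IsOddFredholm Θ F :=
  ⟨hF, fun ψ => by rw [← h, Θ.sq_eq_neg, neg_neg]⟩

theorem indexTwo_eq_of_path (Θ : TimeReversal N) {γ : unitInterval → BulkOp N} (hγ : Continuous γ)
    (hF : ∀ t, (γ t).IsFredholm) (hodd : ∀ t, IsOdd Θ (γ t)) :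
    indexTwo (γ 0) = indexTwo (γ 1) := by
  have : IsLocallyConstant fun t => indexTwo (γ t) := by
    rw [IsLocallyConstant.iff_eventually_eq]
    intro t
    filter_upwards [hγ.continuousAt.eventually (eventually_finrank_ker_eq_of_odd Θ.toFun
      Θ.inner_map Θ.sq_eq_neg (hF t) (hodd t))] with s hs
    exact hs (hodd s)
  exact this.apply_eq_of_preconnectedSpace 0 1

end BulkPath

/-! ### Multiplication operators as a star representation -/

section Multiplication

open BoundedContinuousFunction

variable {N : ℕ}

/-- Bounded functions on the lattice. -/
abbrev LatticeFun : Type := BoundedContinuousFunction (ℤ × ℤ) ℂ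

/-- A bounded function on the lattice. -/
def latticeFun (g : ℤ × ℤ → ℂ) (C : ℝ) (hg : ∀ x, ‖g x‖ ≤ C) : LatticeFun :=
  ofNormedAddCommGroupDiscrete g C hg

@[simp]
theorem latticeFun_apply (g : ℤ × ℤ → ℂ) (C : ℝ) (hg : ∀ x, ‖g x‖ ≤ C) (x : ℤ × ℤ) :
    latticeFun g C hg x = g x := rfl

theorem bulkOp_ext {A B : BulkOp N} (h : ∀ ψ x, A ψ x = B ψ x) : A = B :=
  ContinuousLinearMap.ext fun ψ => lp.ext (funext fun x => h ψ x)

theorem norm_smul_id_le (g : LatticeFun) (x : ℤ × ℤ) :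
    ‖g x • ContinuousLinearMap.id ℂ (EuclideanSpace ℂ (Fin N))‖ ≤ ‖g‖ :=
  ContinuousLinearMap.opNorm_le_bound _ (norm_nonneg g) fun v => by
    simpa [norm_smul] using mul_le_mul_of_nonneg_right (g.norm_coe_le_norm x) (norm_nonneg v)

/-- Multiplication by a bounded function. -/
def mulOpFun (N : ℕ) (g : LatticeFun) : BulkOp N :=
  lp.mapCLM 2 (fun x => g x • ContinuousLinearMap.id ℂ (EuclideanSpace ℂ (Fin N))) (norm_nonneg g)
    (norm_smul_id_le g)

theorem mulOpFun_apply (g : LatticeFun) (ψ : BulkSpace N) (x : ℤ × ℤ) :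
    mulOpFun N g ψ x = g x • ψ x := rfl

/-- The representation of bounded functions by multiplication operators. -/
def mulOp (N : ℕ) : LatticeFun →⋆ₐ[ℂ] BulkOp N where
  toFun := mulOpFun N
  map_one' := bulkOp_ext fun ψ x => by simp [mulOpFun_apply]
  map_mul' f g := bulkOp_ext fun ψ x => by
    change (f * g) x • ψ x = f x • (g x • ψ x)
    rw [smul_smul]; rfl
  map_zero' := bulkOp_ext fun ψ x => by simp [mulOpFun_apply]
  map_add' f g := bulkOp_ext fun ψ x => by
    change (f + g) x • ψ x = f x • ψ x + g x • ψ x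
    rw [← add_smul]; rfl
  commutes' c := bulkOp_ext fun ψ x => by
    change (algebraMap ℂ LatticeFun c) x • ψ x = c • ψ x
    rw [BoundedContinuousFunction.algebraMap_apply]; simp
  map_star' g := by
    rw [ContinuousLinearMap.star_eq_adjoint, ContinuousLinearMap.eq_adjoint_iff]
    intro φ ψ
    rw [lp.inner_eq_tsum, lp.inner_eq_tsum]
    refine tsum_congr fun x => ?_
    rw [mulOpFun_apply, mulOpFun_apply, inner_smul_left, inner_smul_right]
    simp

@[simp]
theorem mulOp_apply (g : LatticeFun) (ψ : BulkSpace N) (x : ℤ × ℤ) :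
    mulOp N g ψ x = g x • ψ x := rfl

theorem norm_mulOp_le (g : LatticeFun) : ‖mulOp N g‖ ≤ ‖g‖ :=
  lp.norm_mapCLM_le 2 _ (norm_nonneg g) (norm_smul_id_le g)

theorem continuous_mulOp : Continuous (mulOp N) :=
  AddMonoidHomClass.continuous_of_bound (mulOp N) 1 fun g => by
    simpa using norm_mulOp_le g

end Multiplication

/-! ### Matrix blocks, the Schur test and truncation to finite sets -/

section Blocks

variable {N : ℕ}

theorem block_apply (A : BulkOp N) (x y : ℤ × ℤ) (v : EuclideanSpace ℂ (Fin N)) :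
    block A x y v = A (lp.single 2 y v) x := rfl

theorem block_sub (A B : BulkOp N) (x y : ℤ × ℤ) :
    block (A - B) x y = block A x y - block B x y := by
  ext1 v; simp [block_apply]

theorem mulOp_single (g : LatticeFun) (y : ℤ × ℤ) (v : EuclideanSpace ℂ (Fin N)) :
    mulOp N g (lp.single 2 y v) = g y • lp.single 2 y v := by
  apply lp.ext
  funext x
  rw [mulOp_apply, lp.coeFn_smul, Pi.smul_apply]
  by_cases h : x = y
  · subst h; rfl
  · rw [lp.single_apply_ne _ _ _ h]; simp

theorem block_mul_mulOp (A : BulkOp N) (g : LatticeFun) (x y : ℤ × ℤ) :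
    block (A * mulOp N g) x y = g y • block A x y := by
  ext1 v
  rw [block_apply, mul_apply_eq_comp, mulOp_single, map_smul, lp.coeFn_smul]
  rfl

theorem block_mulOp_mul (A : BulkOp N) (g : LatticeFun) (x y : ℤ × ℤ) :
    block (mulOp N g * A) x y = g x • block A x y := by
  ext1 v
  rw [block_apply, mul_apply_eq_comp, mulOp_apply]
  rfl

theorem norm_block_le (A : BulkOp N) (x y : ℤ × ℤ) : ‖block A x y‖ ≤ ‖A‖ := by
  refine ContinuousLinearMap.opNorm_le_bound _ (norm_nonneg _) fun v => ?_
  rw [block_apply]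
  refine (lp.norm_apply_le_norm (by norm_num) _ x).trans ((A.le_opNorm _).trans ?_)
  rw [lp.norm_single (by norm_num)]

theorem hasSum_block (A : BulkOp N) (ψ : BulkSpace N) (x : ℤ × ℤ) :
    HasSum (fun y => block A x y (ψ y)) (A ψ x) := by
  have h := lp.hasSum_single (p := 2) (by norm_num) ψ
  exact (h.mapL A).mapL (lp.evalCLM ℂ (fun _ : ℤ × ℤ => EuclideanSpace ℂ (Fin N)) 2 x)

theorem hasSum_norm_sq (ψ : BulkSpace N) : HasSum (fun x => ‖ψ x‖ ^ 2) (‖ψ‖ ^ 2) := by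
  have := lp.hasSum_norm (p := 2) (by norm_num) ψ
  simpa using this

/-- The substitution `(x, y) ↦ (x - y, x)` turns the double sum into a product; its companion below
keeps `y` instead of `x`. -/
theorem hasSum_sub_mul_left {G : Type*} [AddCommGroup G] {κ b : G → ℝ} {K B : ℝ}
    (hκ : HasSum κ K) (hκ0 : ∀ z, 0 ≤ κ z) (hb : HasSum b B) (hb0 : ∀ z, 0 ≤ b z) :
    HasSum (fun p : G × G => κ (p.1 - p.2) * b p.1) (K * B) := by
  have h := hκ.mul hb (hκ.summable.mul_of_nonneg hb.summable hκ0 hb0)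
  let e : G × G ≃ G × G :=
    { toFun := fun p => (p.1 - p.2, p.1)
      invFun := fun p => (p.2, p.2 - p.1)
      left_inv := fun p => by simp
      right_inv := fun p => by simp }
  exact e.hasSum_iff.mpr h

theorem hasSum_sub_mul_right {G : Type*} [AddCommGroup G] {κ b : G → ℝ} {K B : ℝ}
    (hκ : HasSum κ K) (hκ0 : ∀ z, 0 ≤ κ z) (hb : HasSum b B) (hb0 : ∀ z, 0 ≤ b z) :
    HasSum (fun p : G × G => κ (p.1 - p.2) * b p.2) (K * B) := by
  have h := hκ.mul hb (hκ.summable.mul_of_nonneg hb.summable hκ0 hb0)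
  let e : G × G ≃ G × G :=
    { toFun := fun p => (p.1 - p.2, p.2)
      invFun := fun p => (p.1 + p.2, p.2)
      left_inv := fun p => by simp
      right_inv := fun p => by simp }
  exact e.hasSum_iff.mpr h

/-- The Schur test for a convolution kernel. -/
theorem norm_le_of_norm_block_le (A : BulkOp N) {κ : ℤ × ℤ → ℝ} {K : ℝ} (hκ : HasSum κ K)
    (hK : 0 < K) (h : ∀ x y, ‖block A x y‖ ≤ κ (x - y)) : ‖A‖ ≤ K := by
  have hκ0 : ∀ z, 0 ≤ κ z := fun z => by
    simpa using (norm_nonneg _).trans (h z 0)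
  refine ContinuousLinearMap.opNorm_le_bound _ hK.le fun ψ => ?_
  have hφ := hasSum_norm_sq (A ψ)
  have hψ := hasSum_norm_sq ψ
  have hblock := hasSum_block A ψ
  generalize A ψ = φ at hφ hblock ⊢
  have hs1 := hasSum_sub_mul_left hκ hκ0 hφ fun _ => sq_nonneg _
  have hs2 := hasSum_sub_mul_right hκ hκ0 hψ fun _ => sq_nonneg _
  have ht := (hs2.mul_left (K ^ 2)).add hs1
  have hfib := ht.prod_fiberwise fun x => (ht.summable.prod_factor x).hasSum
  have hle : ∀ x, 2 * K * ‖φ x‖ ^ 2 ≤ ∑' y, (K ^ 2 * (κ (x - y) * ‖ψ y‖ ^ 2)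
      + κ (x - y) * ‖φ x‖ ^ 2) := by
    intro x
    have hb := (hblock x).const_smul ((2 * K * ‖φ x‖ : ℝ) : ℂ)
    have h2 := tsum_of_norm_bounded (ht.summable.prod_factor x).hasSum (f := fun y =>
      ((2 * K * ‖φ x‖ : ℝ) : ℂ) • block A x y (ψ y)) fun y => by
        rw [norm_smul, Complex.norm_real, Real.norm_of_nonneg (by positivity)]
        have h3 : ‖block A x y (ψ y)‖ ≤ κ (x - y) * ‖ψ y‖ :=
          ContinuousLinearMap.le_of_opNorm_le _ (h x y) _
        -- The weight `K` in `2 K ‖ψ y‖ ‖φ x‖ ≤ K² ‖ψ y‖² + ‖φ x‖²` is chosen so that summation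
        -- gives `2 K ‖φ‖² ≤ K³ ‖ψ‖² + K ‖φ‖²`.
        have h4 := mul_nonneg (hκ0 (x - y)) (sq_nonneg (K * ‖ψ y‖ - ‖φ x‖))
        have h5 := mul_le_mul_of_nonneg_left h3 (by positivity : 0 ≤ 2 * K * ‖φ x‖)
        dsimp only
        linarith
    rw [hb.tsum_eq, norm_smul, Complex.norm_real, Real.norm_of_nonneg (by positivity)] at h2
    calc 2 * K * ‖φ x‖ ^ 2 = 2 * K * ‖φ x‖ * ‖φ x‖ := by ring
      _ ≤ _ := h2
  have h6 := hasSum_le hle (hφ.mul_left (2 * K)) hfib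
  have h7 : ‖φ‖ ^ 2 ≤ (K * ‖ψ‖) ^ 2 := by
    refine le_of_mul_le_mul_left ?_ hK
    linarith
  exact (pow_le_pow_iff_left₀ (norm_nonneg _) (by positivity) two_ne_zero).mp h7

theorem mulOp_indicator_mem_finiteRankIdeal (g : LatticeFun) (s : Finset (ℤ × ℤ))
    (hg : ∀ x, x ∉ s → g x = 0) : mulOp N g ∈ finiteRankIdeal (BulkSpace N) := by
  have : mulOp N g = ∑ y ∈ s, lp.singleContinuousLinearMap ℂ
      (fun _ : ℤ × ℤ => EuclideanSpace ℂ (Fin N)) 2 y ∘L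
      (g y • lp.evalCLM ℂ (fun _ : ℤ × ℤ => EuclideanSpace ℂ (Fin N)) 2 y) := by
    refine bulkOp_ext fun ψ x => ?_
    rw [sum_apply, lp.coeFn_sum, Finset.sum_apply]
    simp only [ContinuousLinearMap.comp_apply, lp.singleContinuousLinearMap_apply]
    by_cases hx : x ∈ s
    · rw [Finset.sum_eq_single x]
      · rw [lp.single_apply_self]; rfl
      · intro y _ hy
        exact lp.single_apply_ne _ _ _ hy.symm
      · exact fun h => absurd hx h
    · rw [mulOp_apply, hg x hx, zero_smul, Finset.sum_eq_zero]
      intro y hy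
      exact lp.single_apply_ne _ _ _ fun h => hx (h ▸ hy)
  rw [this]
  refine (finiteRankIdeal (BulkSpace N)).sum_mem fun y _ => ?_
  rw [mem_finiteRankIdeal]
  exact LinearMap.HasFiniteRange.comp_right 
    (u := (g y • lp.evalCLM ℂ (fun _ : ℤ × ℤ => EuclideanSpace ℂ (Fin N)) 2 y).toLinearMap)
    (v := (lp.singleContinuousLinearMap ℂ
      (fun _ : ℤ × ℤ => EuclideanSpace ℂ (Fin N)) 2 y).toLinearMap)
    LinearMap.HasFiniteRange.of_finite_dom

end Blocks

/-! ### Weak locality and compactness of commutators -/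

section Locality

variable {N : ℕ}

/-- Weakly-local operators. -/
def IsWeaklyLocal (A : BulkOp N) : Prop :=
  ∃ ν : ℕ, ∀ᶠ m : ℕ in atTop, ∃ C : ℝ, ∀ x y : ℤ × ℤ,
    ‖block A x y‖ ≤ C * (1 + ‖x - y‖) ^ (-(m : ℤ)) * (1 + ‖x‖) ^ ν

theorem UniformlyWeaklyLocal.isWeaklyLocal {𝒜 : Set (BulkOp N)} (h : UniformlyWeaklyLocal 𝒜)
    {A : BulkOp N} (hA : A ∈ 𝒜) : IsWeaklyLocal A := by
  obtain ⟨ν, h⟩ := h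
  refine ⟨ν, h.mono ?_⟩
  rintro m ⟨C, hC⟩
  exact ⟨C, hC A hA⟩

/-- Interpolation between the polynomial bound of a weakly-local operator and its boundedness. -/
theorem IsWeaklyLocal.exists_bound {A : BulkOp N} (hA : IsWeaklyLocal A) :
    ∃ D : ℝ, 0 ≤ D ∧ ∀ x y : ℤ × ℤ,
      ‖block A x y‖ * (1 + ‖x - y‖) ^ 5 ≤ D * √(1 + ‖y‖) := by
  obtain ⟨ν, h⟩ := hA
  obtain ⟨m₀, hm₀⟩ := eventually_atTop.mp h
  set k := max ν m₀ + 1 with hk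
  have hνk : ν ≤ k := by omega
  -- Since `1 + ‖x‖ ≤ n r`, the extra `ν` powers of decay pay for the factor `n ^ ν`. The remaining
  -- `10 k` become `n ^ 5` after the `2k`-th root, while `r ^ k` becomes `√r`.
  obtain ⟨C, hC⟩ := hm₀ (10 * k + ν) (by omega)
  set c := max ‖A‖ 1
  set D := max 1 (c ^ (2 * k - 1) * |C|)
  have hc : 1 ≤ c := le_max_right _ _
  have hD : 1 ≤ D := le_max_left _ _
  refine ⟨√D, Real.sqrt_nonneg _, fun x y => ?_⟩
  set p := ‖block A x y‖
  have hp0 : 0 ≤ p := norm_nonneg _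
  have hpc : p ≤ c := (norm_block_le A x y).trans (le_max_left _ _)
  set n := 1 + ‖x - y‖
  set r := 1 + ‖y‖
  have hn : 1 ≤ n := by simp [n]
  have hr : 1 ≤ r := by simp [r]
  have hxr : 1 + ‖x‖ ≤ n * r := by
    have : ‖x‖ ≤ ‖x - y‖ + ‖y‖ := by simpa using norm_add_le (x - y) y
    have h2 := mul_nonneg (norm_nonneg (x - y)) (norm_nonneg y)
    simp only [n, r]
    linarith
  have h1 : p * n ^ (10 * k) ≤ |C| * r ^ k := by
    have h2 : p ≤ C * n ^ (-((10 * k + ν : ℕ) : ℤ)) * (1 + ‖x‖) ^ ν := hC x y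
    have h3 : p ≤ |C| * (n ^ (10 * k + ν))⁻¹ * (n * r) ^ ν := by
      rw [zpow_neg, zpow_natCast] at h2
      refine h2.trans ?_
      gcongr
      exact le_abs_self C
    calc p * n ^ (10 * k) ≤ |C| * (n ^ (10 * k + ν))⁻¹ * (n * r) ^ ν * n ^ (10 * k) := by gcongr
      _ = |C| * r ^ ν := by
        rw [pow_add, mul_pow]; field_simp
      _ ≤ |C| * r ^ k := by gcongr
  -- One of the `2 k` factors `p` is estimated by weak locality, the others by the operator norm.
  have h2 : (p ^ 2 * n ^ 10) ^ k ≤ (D * r) ^ k := by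
    calc (p ^ 2 * n ^ 10) ^ k = p ^ (2 * k - 1) * (p * n ^ (10 * k)) := by
          have : 2 * k = (2 * k - 1) + 1 := by omega
          rw [mul_pow, ← pow_mul, ← pow_mul, this, pow_succ]
          simp only [Nat.add_sub_cancel]
          ring
      _ ≤ c ^ (2 * k - 1) * (|C| * r ^ k) := by gcongr
      _ = c ^ (2 * k - 1) * |C| * r ^ k := by ring
      _ ≤ D ^ k * r ^ k := by
          gcongr
          exact (le_max_right _ _).trans (le_self_pow₀ hD (by omega))
      _ = (D * r) ^ k := by rw [mul_pow]
  have h3 : p ^ 2 * n ^ 10 ≤ D * r :=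
    le_of_pow_le_pow_left₀ (by omega) (by positivity) h2
  rw [← Real.sqrt_mul (by positivity)]
  refine Real.le_sqrt_of_sq_le ?_
  calc (p * n ^ 5) ^ 2 = p ^ 2 * n ^ 10 := by ring
    _ ≤ _ := h3

theorem summable_inv_one_add_abs_sq : Summable fun n : ℤ => ((1 + |(n : ℝ)|) ^ 2)⁻¹ := by
  have h : Summable fun n : ℕ => ((1 + (n : ℝ)) ^ 2)⁻¹ := by
    have := (summable_nat_add_iff 1).mpr (Real.summable_nat_pow_inv (p := 2).mpr (by norm_num))
    refine this.congr fun n => ?_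
    push_cast
    rw [add_comm]
  refine Summable.of_nat_of_neg (h.congr fun n => ?_) (h.congr fun n => ?_)
  · simp
  · simp

theorem summable_inv_one_add_norm_pow : Summable fun z : ℤ × ℤ => ((1 + ‖z‖) ^ 4)⁻¹ := by
  have h := summable_inv_one_add_abs_sq.mul_of_nonneg summable_inv_one_add_abs_sq
    (fun _ => by positivity) (fun _ => by positivity)
  refine Summable.of_nonneg_of_le (fun _ => by positivity) (fun z => ?_) h
  rw [← mul_inv]
  have h1 : |(z.1 : ℝ)| ≤ ‖z‖ := by
    have := norm_fst_le z
    rwa [Int.norm_eq_abs] at this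
  have h2 : |(z.2 : ℝ)| ≤ ‖z‖ := by
    have := norm_snd_le z
    rwa [Int.norm_eq_abs] at this
  refine inv_anti₀ (by positivity) ?_
  calc (1 + |(z.1 : ℝ)|) ^ 2 * (1 + |(z.2 : ℝ)|) ^ 2 ≤ (1 + ‖z‖) ^ 2 * (1 + ‖z‖) ^ 2 := by gcongr
    _ = (1 + ‖z‖) ^ 4 := by ring

/-- Functions that vary slowly at infinity. -/
def SlowlyVarying (g : LatticeFun) : Prop :=
  ∃ C : ℝ, ∀ x y : ℤ × ℤ, ‖g x - g y‖ * ‖x‖ ≤ C * ‖x - y‖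

/-- The commutator of a weakly-local operator and a slowly varying function is compact. -/
theorem IsWeaklyLocal.commutator_mem {A : BulkOp N} (hA : IsWeaklyLocal A) {g : LatticeFun}
    (hg : SlowlyVarying g) : A * mulOp N g - mulOp N g * A ∈ compactIdeal (BulkSpace N) := by
  obtain ⟨D, hD, hA⟩ := hA.exists_bound
  obtain ⟨C, hC⟩ := hg
  set T := A * mulOp N g - mulOp N g * A with hT
  have hblock : ∀ x y, block T x y = (g y - g x) • block A x y := fun x y => by
    rw [hT, block_sub, block_mul_mulOp, block_mulOp_mul]
    exact (sub_smul _ _ _).symm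
  set C' := |C| + 2 * ‖g‖
  have hC' : 0 ≤ C' := by positivity
  -- Slow variation gains `1 / (1 + ‖y‖)` against the growth `√(1 + ‖y‖)` and costs one of the five
  -- powers of off-diagonal decay. Four powers are still summable on `ℤ²`.
  have hbound : ∀ x y, ‖block T x y‖ ≤ C' * D / √(1 + ‖y‖) * ((1 + ‖x - y‖) ^ 4)⁻¹ := by
    intro x y
    have h1 : ‖g y - g x‖ * (1 + ‖y‖) ≤ C' * (1 + ‖x - y‖) := by
      have h2 := hC y x
      rw [norm_sub_rev y x] at h2
      have h3 : ‖g y - g x‖ ≤ 2 * ‖g‖ := by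
        have := norm_sub_le (g y) (g x)
        linarith [g.norm_coe_le_norm x, g.norm_coe_le_norm y]
      have h4 : C * ‖x - y‖ ≤ |C| * ‖x - y‖ := by gcongr; exact le_abs_self C
      have h5 : 0 ≤ 2 * ‖g‖ * ‖x - y‖ := by positivity
      have h6 : 0 ≤ |C| := abs_nonneg C
      simp only [C']
      linarith
    have hs : √(1 + ‖y‖) * √(1 + ‖y‖) = 1 + ‖y‖ := Real.mul_self_sqrt (by positivity)
    have hs0 : 0 < √(1 + ‖y‖) := Real.sqrt_pos.mpr (by positivity)
    rw [hblock, norm_smul, ← div_eq_mul_inv, le_div_iff₀ (by positivity), le_div_iff₀ hs0]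
    refine le_of_mul_le_mul_right ?_ (mul_pos hs0 (by positivity : 0 < 1 + ‖x - y‖))
    calc ‖g y - g x‖ * ‖block A x y‖ * (1 + ‖x - y‖) ^ 4 * √(1 + ‖y‖)
          * (√(1 + ‖y‖) * (1 + ‖x - y‖))
        = (‖g y - g x‖ * (1 + ‖y‖)) * (‖block A x y‖ * (1 + ‖x - y‖) ^ 5) := by
          linear_combination ‖g y - g x‖ * ‖block A x y‖ * (1 + ‖x - y‖) ^ 5 * hs
      _ ≤ (C' * (1 + ‖x - y‖)) * (D * √(1 + ‖y‖)) := by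
          exact mul_le_mul h1 (hA x y) (by positivity) (by positivity)
      _ = C' * D * (√(1 + ‖y‖) * (1 + ‖x - y‖)) := by ring
  set κ : ℤ × ℤ → ℝ := fun z => ((1 + ‖z‖) ^ 4)⁻¹ with hκ
  have hκs : Summable κ := summable_inv_one_add_norm_pow
  set K := ∑' z, κ z
  have hK : 0 < K := hκs.tsum_pos (fun z => by positivity) 0 (by simp [hκ])
  refine mem_compactIdeal_of_forall fun ε hε => ?_
  -- For `‖y‖ > R` the prefactor `C' D / √(1 + ‖y‖)` is at most `ε / K`, so the part of `T` outside
  -- the ball has norm at most `ε` by the Schur test.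
  set R := (C' * D * K / ε) ^ 2 with hR
  have hfin : (Metric.closedBall (0 : ℤ × ℤ) R).Finite :=
    isCompact_iff_finite.mp (isCompact_closedBall _ _)
  let s := hfin.toFinset
  classical
  let χ : LatticeFun := latticeFun (fun x => if x ∈ s then 1 else 0) 1 fun x => by
    split_ifs <;> simp
  refine ⟨T * mulOp N χ, (finiteRankIdeal (BulkSpace N)).mul_mem_left _
    (mulOp_indicator_mem_finiteRankIdeal χ s fun x hx => by simp [χ, hx]), ?_⟩
  have hsum : HasSum (fun z => ε / K * κ z) ε := by
    have := hκs.hasSum.mul_left (ε / K)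
    rwa [div_mul_cancel₀ _ hK.ne'] at this
  refine norm_le_of_norm_block_le _ hsum hε fun x y => ?_
  rw [block_sub, block_mul_mulOp]
  by_cases hy : y ∈ s
  · have : χ y = 1 := by simp [χ, hy]
    rw [this, one_smul, sub_self, norm_zero]
    positivity
  · have h0 : χ y = 0 := by simp [χ, hy]
    have h2 : block T x y - (0 : ℂ) • block T x y = block T x y := by ext1 v; simp
    rw [h0, h2]
    refine (hbound x y).trans (mul_le_mul_of_nonneg_right ?_ (by positivity))
    have hyR : R < ‖y‖ := by simpa [s] using hy
    have h1 : C' * D * K / ε ≤ √(1 + ‖y‖) := Real.le_sqrt_of_sq_le (by linarith)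
    have hs0 : 0 < √(1 + ‖y‖) := Real.sqrt_pos.mpr (by positivity)
    rw [div_le_iff₀ hε] at h1
    rw [div_le_div_iff₀ hs0 hK]
    linarith

end Locality

/-! ### Strong convergence in the Borel calculus -/

section Borel

open Topology

variable {E : Type*} [NormedAddCommGroup E] [InnerProductSpace ℂ E] [CompleteSpace E]

theorem IsBorelCalculus.isSelfAdjoint {H A : E →L[ℂ] E} {f : ℝ → ℝ} (h : IsBorelCalculus H f A) :
    IsSelfAdjoint A := by
  rw [ContinuousLinearMap.isSelfAdjoint_iff_isSymmetric, LinearMap.isSymmetric_iff_inner_map_self_real]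
  intro ψ
  have := h ψ
  rw [inner_conj_symm]
  change ⟪ψ, A ψ⟫_ℂ = ⟪A ψ, ψ⟫_ℂ
  rw [← inner_conj_symm (A ψ) ψ, this, Complex.conj_ofReal]

theorem isBorelCalculus_cfc (H : E →L[ℂ] E) (g : C_c(ℝ, ℝ)) :
    IsBorelCalculus H g (cfc (fun t : ℝ => g t) H) := by
  intro ψ
  have hsa : IsSelfAdjoint (cfc (fun t : ℝ => g t) H) := cfc_predicate _ _
  rw [ContinuousLinearMap.isSelfAdjoint_iff_isSymmetric] at hsa
  rw [integral_spectralMeasure]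
  have h1 := hsa ψ ψ
  have h2 := inner_conj_symm (𝕜 := ℂ) ψ (cfc (fun t : ℝ => g t) H ψ)
  change ⟪cfc (fun t : ℝ => g t) H ψ, ψ⟫_ℂ = _ at h1
  rw [h1] at h2
  exact (Complex.conj_eq_iff_re.mp h2).symm

theorem norm_sq_cfc_apply (H : E →L[ℂ] E) (g : C_c(ℝ, ℝ)) (ψ : E) :
    ‖cfc (fun t : ℝ => g t) H ψ‖ ^ 2 = ∫ t, g t ^ 2 ∂(spectralMeasure H ψ) := by
  have hsa : IsSelfAdjoint (cfc (fun t : ℝ => g t) H) := cfc_predicate _ _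
  rw [ContinuousLinearMap.isSelfAdjoint_iff_isSymmetric] at hsa
  have h := integral_spectralMeasure H ψ (g * g)
  have hg : Continuous (fun t : ℝ => g t) := g.continuous
  have hm := cfc_mul (a := H) (fun t : ℝ => g t) (fun t : ℝ => g t)
    hg.continuousOn hg.continuousOn
  simp only [CompactlySupportedContinuousMap.mul_apply, ← pow_two] at h hm
  rw [h, hm, pow_two (cfc (fun t : ℝ => g t) H), mul_apply_eq_comp]
  have h1 := hsa ψ (cfc (fun t : ℝ => g t) H ψ)
  change ⟪cfc (fun t : ℝ => g t) H ψ, cfc (fun t : ℝ => g t) H ψ⟫_ℂ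
    = ⟪ψ, cfc (fun t : ℝ => g t) H (cfc (fun t : ℝ => g t) H ψ)⟫_ℂ at h1
  rw [← h1, ← RCLike.re_eq_complex_re, inner_self_eq_norm_sq]

/-- Bounded pointwise convergence implies strong convergence. -/
theorem IsBorelCalculus.tendsto_cfc_apply {H A : E →L[ℂ] E} {f : ℝ → ℝ}
    (hA : IsBorelCalculus H f A) {g : ℕ → C_c(ℝ, ℝ)} (hg : ∀ n t, |g n t| ≤ 1)
    (hgf : ∀ t, Tendsto (fun n => g n t) atTop (𝓝 (f t))) (ψ : E) :
    Tendsto (fun n => cfc (fun t : ℝ => g n t) H ψ) atTop (𝓝 (A ψ)) := by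
  have hgm : ∀ n, Measurable (g n) := fun n => (g n).continuous.measurable
  have hfm : Measurable f := measurable_of_tendsto_metrizable hgm (tendsto_pi_nhds.mpr hgf)
  have hf1 : ∀ t, |f t| ≤ 1 := fun t =>
    le_of_tendsto ((hgf t).abs) (Eventually.of_forall fun n => hg n t)
  -- Since `‖g_n(H) ψ - g_m(H) ψ‖² = ∫ (g_n - g_m)² ≤ 2 (a n + a m)`, the vectors form a Cauchy
  -- sequence. The limit is then identified with `A ψ` weakly, by polarization.
  set a : ℕ → ℝ := fun n => ∫ t, (g n t - f t) ^ 2 ∂(spectralMeasure H ψ)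
  have ha : Tendsto a atTop (𝓝 0) := by
    have := tendsto_integral_of_dominated_convergence (μ := spectralMeasure H ψ)
      (F := fun n t => (g n t - f t) ^ 2) (f := fun _ => 0) (fun _ => 4)
      (fun n => (((hgm n).sub hfm).pow_const 2).aestronglyMeasurable) (integrable_const _)
      (fun n => Eventually.of_forall fun t => by
        have h1 := abs_le.mp (hg n t)
        have h2 := abs_le.mp (hf1 t)
        rw [Real.norm_eq_abs, abs_of_nonneg (sq_nonneg _)]
        nlinarith)
      (Eventually.of_forall fun t => by
        have := ((hgf t).sub_const (f t)).pow 2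
        simpa using this)
    simpa using this
  have hcau : CauchySeq fun n => cfc (fun t : ℝ => g n t) H ψ := by
    have hbd : ∀ n m, ‖cfc (fun t : ℝ => g n t) H ψ - cfc (fun t : ℝ => g m t) H ψ‖ ^ 2
        ≤ 2 * (a n + a m) := by
      intro n m
      have h1 := norm_sq_cfc_apply H (g n - g m) ψ
      have hs := cfc_sub (a := H) (fun t : ℝ => g n t) (fun t : ℝ => g m t)
        (g n).continuous.continuousOn (g m).continuous.continuousOn
      simp only [CompactlySupportedContinuousMap.sub_apply] at h1
      rw [hs, sub_apply] at h1
      rw [h1]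
      have hi : ∀ k, Integrable (fun t => (g k t - f t) ^ 2) (spectralMeasure H ψ) := fun k =>
        integrable_spectralMeasure H ψ (((hgm k).sub hfm).pow_const 2) (C := 4) fun t => by
          have h1 := abs_le.mp (hg k t)
          have h2 := abs_le.mp (hf1 t)
          rw [abs_of_nonneg (sq_nonneg _)]
          nlinarith
      rw [← integral_add (hi n) (hi m), ← integral_const_mul]
      refine integral_mono ?_ (((hi n).add (hi m)).const_mul 2) fun t => ?_
      · exact integrable_spectralMeasure H ψ (((hgm n).sub (hgm m)).pow_const 2) (C := 4) fun t => by
          have h1 := abs_le.mp (hg n t)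
          have h2 := abs_le.mp (hg m t)
          rw [abs_of_nonneg (sq_nonneg _)]
          nlinarith
      · dsimp only
        nlinarith [sq_nonneg (g n t - f t + (g m t - f t))]
    rw [Metric.cauchySeq_iff]
    intro ε hε
    obtain ⟨n₀, hn₀⟩ := eventually_atTop.mp (ha.eventually_lt_const (show 0 < ε ^ 2 / 4 by positivity))
    refine ⟨n₀, fun n hn m hm => ?_⟩
    rw [dist_eq_norm]
    refine lt_of_pow_lt_pow_left₀ 2 hε.le ((hbd n m).trans_lt ?_)
    linarith [hn₀ n hn, hn₀ m hm]
  obtain ⟨L, hL⟩ := cauchySeq_tendsto_of_complete hcau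
  have hweak : ∀ χ : E, Tendsto (fun n => ⟪cfc (fun t : ℝ => g n t) H χ, χ⟫_ℂ) atTop
      (𝓝 ⟪A χ, χ⟫_ℂ) := by
    intro χ
    have h1 : Tendsto (fun n => ∫ t, g n t ∂(spectralMeasure H χ)) atTop
        (𝓝 (∫ t, f t ∂(spectralMeasure H χ))) :=
      tendsto_integral_of_dominated_convergence (fun _ => 1)
        (fun n => (hgm n).aestronglyMeasurable) (integrable_const _)
        (fun n => Eventually.of_forall fun t => hg n t) (Eventually.of_forall hgf)
    have h2 : ∀ {B : E →L[ℂ] E} {k : ℝ → ℝ}, IsBorelCalculus H k B →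
        ⟪B χ, χ⟫_ℂ = ((∫ t, k t ∂(spectralMeasure H χ) : ℝ) : ℂ) := by
      intro B k hB
      rw [← inner_conj_symm, hB χ, Complex.conj_ofReal]
    rw [h2 hA]
    simp_rw [fun n => h2 (isBorelCalculus_cfc H (g n))]
    exact (Complex.continuous_ofReal.tendsto _).comp h1
  have hL' : L = A ψ := by
    refine ext_inner_right ℂ fun φ => ?_
    have h1 : Tendsto (fun n => ⟪cfc (fun t : ℝ => g n t) H ψ, φ⟫_ℂ) atTop (𝓝 ⟪L, φ⟫_ℂ) :=
      hL.inner tendsto_const_nhds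
    refine tendsto_nhds_unique h1 ?_
    have hp : ∀ B : E →L[ℂ] E, ⟪B ψ, φ⟫_ℂ = _ := fun B =>
      inner_map_polarization' (B : E →ₗ[ℂ] E) ψ φ
    simp_rw [hp]
    exact ((((hweak _).sub (hweak _)).sub ((hweak _).const_mul _)).add
      ((hweak _).const_mul _)).div_const _
  rwa [hL'] at hL

/-- By strong convergence `⟨ψ, A² ψ⟩ = ‖A ψ‖² = lim ∫ g_n² = ∫ f² = ∫ f`, so `A²` is also `f(H)` and
uniqueness applies. Multiplicativity of the Borel calculus is not needed. -/
theorem IsBorelCalculus.mul_self_of_idempotent {H A : E →L[ℂ] E} {f : ℝ → ℝ}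
    (hA : IsBorelCalculus H f A) (hf : ∀ t, f t ^ 2 = f t) {g : ℕ → C_c(ℝ, ℝ)}
    (hg : ∀ n t, |g n t| ≤ 1) (hgf : ∀ t, Tendsto (fun n => g n t) atTop (𝓝 (f t))) :
    A * A = A := by
  refine IsBorelCalculus.unique (H := H) (f := f) (fun ψ => ?_) hA
  have hsa := hA.isSelfAdjoint
  rw [ContinuousLinearMap.isSelfAdjoint_iff_isSymmetric] at hsa
  rw [mul_apply_eq_comp]
  have h2 : ⟪ψ, A (A ψ)⟫_ℂ = ⟪A ψ, A ψ⟫_ℂ := (hsa ψ (A ψ)).symm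
  rw [h2, inner_self_eq_norm_sq_to_K]
  have h3 := ((hA.tendsto_cfc_apply hg hgf ψ).norm).pow 2
  simp_rw [norm_sq_cfc_apply] at h3
  have h4 : Tendsto (fun n => ∫ t, g n t ^ 2 ∂(spectralMeasure H ψ)) atTop
      (𝓝 (∫ t, f t ∂(spectralMeasure H ψ))) := by
    refine tendsto_integral_of_dominated_convergence (fun _ => 1)
      (fun n => ((g n).continuous.measurable.pow_const 2).aestronglyMeasurable) (integrable_const _)
      (fun n => Eventually.of_forall fun t => ?_) (Eventually.of_forall fun t => ?_)
    · rw [norm_pow, Real.norm_eq_abs]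
      exact pow_le_one₀ (abs_nonneg _) (hg n t)
    · rw [← hf t]
      exact (hgf t).pow 2
  rw [← tendsto_nhds_unique h3 h4]
  norm_cast

end Borel

/-! ### The Fermi projection -/

section Fermi

open Topology

/-- The projection of the real line onto the unit interval. -/
def clamp (t : ℝ) : ℝ := max 0 (min 1 t)

theorem continuous_clamp : Continuous clamp := by unfold clamp; fun_prop

theorem clamp_nonneg (t : ℝ) : 0 ≤ clamp t := le_max_left _ _

theorem clamp_le_one (t : ℝ) : clamp t ≤ 1 := max_le zero_le_one (min_le_left _ _)

theorem clamp_of_nonpos {t : ℝ} (h : t ≤ 0) : clamp t = 0 := by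
  rw [clamp, min_eq_right (h.trans zero_le_one), max_eq_left h]

theorem clamp_of_one_le {t : ℝ} (h : 1 ≤ t) : clamp t = 1 := by
  rw [clamp, min_eq_left h, max_eq_right zero_le_one]

theorem clamp_of_mem {t : ℝ} (h₀ : 0 ≤ t) (h₁ : t ≤ 1) : clamp t = t := by
  rw [clamp, min_eq_right h₁, max_eq_right h₀]

theorem abs_clamp_sub_le (s t : ℝ) : |clamp s - clamp t| ≤ |s - t| := by
  have h1 := abs_max_sub_max_le_abs (min 1 s) (min 1 t) 0
  have h2 := abs_min_sub_min_le_max 1 s 1 t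
  simp only [sub_self, abs_zero, abs_nonneg, max_eq_right] at h2
  rw [max_comm _ 0, max_comm _ 0] at h1
  exact h1.trans h2

theorem exists_approx_Iio (μ : ℝ) : ∃ g : ℕ → C_c(ℝ, ℝ), (∀ n t, |g n t| ≤ 1) ∧
    ∀ t, Tendsto (fun n => g n t) atTop (𝓝 ((Set.Iio μ).indicator (fun _ => 1) t)) := by
  -- The first factor vanishes for `t ≥ μ`, matching the open half-line; the second makes the
  -- support compact.
  refine ⟨fun n => ⟨⟨fun t => clamp (n * (μ - t)) * clamp (n - |t|), ?_⟩, ?_⟩, fun n t => ?_,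
    fun t => ?_⟩
  · exact (continuous_clamp.comp (by fun_prop)).mul (continuous_clamp.comp (by fun_prop))
  · refine HasCompactSupport.of_support_subset_isCompact (isCompact_Icc (a := -(n : ℝ)) (b := n)) ?_
    intro t ht
    by_contra hmem
    refine ht ?_
    have : (n : ℝ) - |t| ≤ 0 := by
      by_contra hlt
      exact hmem (abs_le.mp (by linarith))
    change clamp (n * (μ - t)) * clamp (n - |t|) = 0
    rw [clamp_of_nonpos this, mul_zero]
  · change |clamp (n * (μ - t)) * clamp (n - |t|)| ≤ 1
    rw [abs_of_nonneg (mul_nonneg (clamp_nonneg _) (clamp_nonneg _))]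
    exact mul_le_one₀ (clamp_le_one _) (clamp_nonneg _) (clamp_le_one _)
  · change Tendsto (fun n : ℕ => clamp (n * (μ - t)) * clamp (n - |t|)) _ _
    by_cases ht : t < μ
    · rw [Set.indicator_of_mem (Set.mem_Iio.mpr ht)]
      refine tendsto_const_nhds.congr' ?_
      have h1 : Tendsto (fun n : ℕ => (n : ℝ) * (μ - t)) atTop atTop :=
        tendsto_natCast_atTop_atTop.atTop_mul_const (sub_pos.mpr ht)
      have h2 : Tendsto (fun n : ℕ => (n : ℝ) - |t|) atTop atTop :=
        tendsto_atTop_add_const_right _ _ tendsto_natCast_atTop_atTop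
      filter_upwards [h1.eventually_ge_atTop 1, h2.eventually_ge_atTop 1] with n hn1 hn2
      rw [clamp_of_one_le hn1, clamp_of_one_le hn2, one_mul]
    · rw [Set.indicator_of_notMem (by simpa using ht)]
      refine tendsto_const_nhds.congr fun n => ?_
      rw [clamp_of_nonpos, zero_mul]
      exact mul_nonpos_of_nonneg_of_nonpos (Nat.cast_nonneg _) (by linarith)

/-- The last bound makes `(H - μ) g_n(H)` tend to `0` in norm, which places the limit in the
eigenspace. -/
theorem exists_approx_singleton (μ : ℝ) : ∃ g : ℕ → C_c(ℝ, ℝ), (∀ n t, |g n t| ≤ 1) ∧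
    (∀ t, Tendsto (fun n => g n t) atTop (𝓝 (({μ} : Set ℝ).indicator (fun _ => 1) t))) ∧
    ∀ n t, |(t - μ) * g n t| ≤ ((n : ℝ) + 1)⁻¹ := by
  refine ⟨fun n => ⟨⟨fun t => clamp (1 - (n + 1) * |t - μ|), ?_⟩, ?_⟩, fun n t => ?_,
    fun t => ?_, fun n t => ?_⟩
  · exact continuous_clamp.comp (by fun_prop)
  · refine HasCompactSupport.of_support_subset_isCompact (isCompact_Icc (a := μ - 1) (b := μ + 1)) ?_
    intro t ht
    by_contra hmem
    refine ht ?_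
    change clamp (1 - (n + 1) * |t - μ|) = 0
    refine clamp_of_nonpos ?_
    have : 1 ≤ |t - μ| := by
      by_contra hlt
      have := abs_le.mp (not_le.mp hlt).le
      exact hmem ⟨by linarith, by linarith⟩
    have hn : (0 : ℝ) ≤ n := Nat.cast_nonneg n
    nlinarith
  · change |clamp (1 - (n + 1) * |t - μ|)| ≤ 1
    rw [abs_of_nonneg (clamp_nonneg _)]
    exact clamp_le_one _
  · change Tendsto (fun n : ℕ => clamp (1 - (n + 1) * |t - μ|)) _ _
    by_cases ht : t = μ
    · subst ht
      rw [Set.indicator_of_mem (Set.mem_singleton t)]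
      refine tendsto_const_nhds.congr fun n => ?_
      rw [sub_self, abs_zero, mul_zero, sub_zero, clamp_of_one_le le_rfl]
    · rw [Set.indicator_of_notMem (by simpa using ht)]
      refine tendsto_const_nhds.congr' ?_
      have h1 : Tendsto (fun n : ℕ => (n : ℝ) * |t - μ|) atTop atTop :=
        tendsto_natCast_atTop_atTop.atTop_mul_const (abs_pos.mpr (sub_ne_zero.mpr ht))
      filter_upwards [h1.eventually_ge_atTop 1] with n hn1
      rw [clamp_of_nonpos]
      linarith [abs_nonneg (t - μ)]
  · change |(t - μ) * clamp (1 - (n + 1) * |t - μ|)| ≤ _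
    have hn : (0 : ℝ) < (n : ℝ) + 1 := by positivity
    rw [abs_mul, abs_of_nonneg (clamp_nonneg _)]
    by_cases h : (n + 1) * |t - μ| ≤ 1
    · have h1 : |t - μ| ≤ ((n : ℝ) + 1)⁻¹ := by
        rw [inv_eq_one_div, le_div_iff₀ hn]; linarith
      exact (mul_le_of_le_one_right (abs_nonneg _) (clamp_le_one _)).trans h1
    · rw [clamp_of_nonpos (by linarith), mul_zero]
      positivity

theorem abs_indicator_one_le (s : Set ℝ) (t : ℝ) : |s.indicator (fun _ => (1 : ℝ)) t| ≤ 1 := by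
  by_cases h : t ∈ s <;> simp [h]

section

variable {E : Type*} [NormedAddCommGroup E] [InnerProductSpace ℂ E] [CompleteSpace E]

theorem isBorelCalculus_indicator (H : E →L[ℂ] E) {s : Set ℝ} (hs : MeasurableSet s) :
    IsBorelCalculus H (s.indicator fun _ => 1) (borelCalculus H (s.indicator fun _ => 1)) :=
  isBorelCalculus_borelCalculus H (measurable_const.indicator hs) (abs_indicator_one_le s)

/-- The spectral projection of a point maps into the eigenspace. -/
theorem borelCalculus_singleton_mem_eigenspace {H : E →L[ℂ] E} (hH : IsSelfAdjoint H) (μ : ℝ)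
    (ψ : E) : borelCalculus H (({μ} : Set ℝ).indicator fun _ => 1) ψ
      ∈ Module.End.eigenspace (H : E →ₗ[ℂ] E) (μ : ℂ) := by
  obtain ⟨g, hg, hgf, hgn⟩ := exists_approx_singleton μ
  have h := (isBorelCalculus_indicator H (measurableSet_singleton μ)).tendsto_cfc_apply hg hgf ψ
  set A := borelCalculus H (({μ} : Set ℝ).indicator fun _ => 1)
  have h1 : Tendsto (fun n => (H - (μ : ℂ) • (1 : E →L[ℂ] E)) (cfc (fun t : ℝ => g n t) H ψ)) atTop
      (𝓝 ((H - (μ : ℂ) • (1 : E →L[ℂ] E)) (A ψ))) :=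
    ((H - (μ : ℂ) • (1 : E →L[ℂ] E)).continuous.tendsto _).comp h
  have h2 : Tendsto (fun n => (H - (μ : ℂ) • (1 : E →L[ℂ] E)) (cfc (fun t : ℝ => g n t) H ψ)) atTop
      (𝓝 0) := by
    refine squeeze_zero_norm (a := fun n : ℕ => ((n : ℝ) + 1)⁻¹ * ‖ψ‖) (fun n => ?_) ?_
    · have hc : (H - (μ : ℂ) • (1 : E →L[ℂ] E)) = cfc (fun t : ℝ => t - μ) H := by
        rw [cfc_sub (fun t : ℝ => t) (fun _ : ℝ => μ) H, cfc_id' ℝ H, cfc_const μ H,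
          Algebra.algebraMap_eq_smul_one]
        congr 1
      have hm := cfc_mul (a := H) (fun t : ℝ => t - μ) (fun t : ℝ => g n t)
        (by fun_prop) (g n).continuous.continuousOn
      rw [hc, ← mul_apply_eq_comp, ← hm]
      refine ContinuousLinearMap.le_of_opNorm_le _ (norm_cfc_le (by positivity) fun t _ => ?_) ψ
      rw [Real.norm_eq_abs]
      exact hgn n t
    · have : Tendsto (fun n : ℕ => ((n : ℝ) + 1)⁻¹) atTop (𝓝 0) := by
        simpa [one_div] using tendsto_one_div_add_atTop_nhds_zero_nat (𝕜 := ℝ)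
      simpa using this.mul_const ‖ψ‖
  have h3 := tendsto_nhds_unique h1 h2
  rw [Module.End.mem_eigenspace_iff]
  have h4 : H (A ψ) - (μ : ℂ) • A ψ = 0 := h3
  exact sub_eq_zero.mp h4

end

variable {N : ℕ}

theorem isSelfAdjoint_fermiProjection (H : BulkOp N) (μ : ℝ) :
    IsSelfAdjoint (fermiProjection H μ) :=
  (isBorelCalculus_indicator H measurableSet_Iio).isSelfAdjoint

theorem fermiProjection_mul_self (H : BulkOp N) (μ : ℝ) :
    fermiProjection H μ * fermiProjection H μ = fermiProjection H μ := by
  obtain ⟨g, hg, hgf⟩ := exists_approx_Iio μ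
  refine (isBorelCalculus_indicator H measurableSet_Iio).mul_self_of_idempotent (fun t => ?_) hg hgf
  by_cases h : t ∈ Set.Iio μ <;> simp [h]

/-- The Fermi projection of a mobility-gapped Hamiltonian is weakly-local up to an operator of
finite rank. -/
theorem IsMobilityGapped.exists_isWeaklyLocal {H : BulkOp N} {Δ : Set ℝ}
    (hH : IsMobilityGapped H Δ) (hΔ : Δ.Nontrivial) {μ : ℝ} (hμ : μ ∈ Δ) :
    ∃ A : BulkOp N, IsWeaklyLocal A ∧ fermiProjection H μ - A ∈ compactIdeal (BulkSpace N) := by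
  -- If `μ = inf Δ`, the indicator of `(-∞, μ)` jumps at the endpoint of `(-∞, inf Δ]` and is no gap
  -- function. That of `(-∞, μ]` is one, and the difference is the projection onto an eigenspace of
  -- finite dimension.
  by_cases hlow : μ ∈ lowerBounds Δ
  · refine ⟨borelCalculus H ((Set.Iic μ).indicator fun _ => 1),
      hH.2.1.isWeaklyLocal ⟨_, ⟨measurable_const.indicator measurableSet_Iic,
        abs_indicator_one_le _, fun s hs t ht => ?_, fun s hs t ht => ?_⟩, rfl⟩, ?_⟩
    · rw [Set.indicator_of_mem (Set.mem_Iic.mpr (hs hμ)),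
        Set.indicator_of_mem (Set.mem_Iic.mpr (ht hμ))]
    -- A second point of `Δ` forces every upper bound above `μ`, where the indicator vanishes.
    · obtain ⟨b, hb, hbμ⟩ := hΔ.exists_ne μ
      have hlt : μ < b := lt_of_le_of_ne (hlow hb) hbμ.symm
      rw [Set.indicator_of_notMem, Set.indicator_of_notMem]
      · simpa using hlt.trans_le (ht hb)
      · simpa using hlt.trans_le (hs hb)
    · refine finiteRankIdeal_le_compactIdeal ?_
      have hEq : fermiProjection H μ - borelCalculus H ((Set.Iic μ).indicator fun _ => 1)
          = - borelCalculus H (({μ} : Set ℝ).indicator fun _ => 1) := by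
        rw [sub_eq_iff_eq_add, eq_neg_add_iff_add_eq, add_comm]
        refine IsBorelCalculus.unique (H := H) (f := (Set.Iic μ).indicator fun _ => 1) (fun ψ => ?_)
          (isBorelCalculus_indicator H measurableSet_Iic)
        rw [add_apply, inner_add_right, fermiProjection,
          isBorelCalculus_indicator H measurableSet_Iio ψ,
          isBorelCalculus_indicator H (measurableSet_singleton μ) ψ, ← Complex.ofReal_add,
          ← integral_add]
        · congr 2
          ext t
          rcases lt_trichotomy t μ with h | h | h
          · simp [h, h.le, h.ne]
          · simp [h]
          · simp [h, h.le, h.ne']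
        · exact integrable_spectralMeasure H ψ (measurable_const.indicator measurableSet_Iio)
            (abs_indicator_one_le _)
        · exact integrable_spectralMeasure H ψ
            (measurable_const.indicator (measurableSet_singleton μ)) (abs_indicator_one_le _)
      rw [hEq]
      refine (finiteRankIdeal (BulkSpace N)).neg_mem ?_
      rw [mem_finiteRankIdeal, LinearMap.hasFiniteRange_iff_range]
      have := hH.2.2 μ hμ
      refine Submodule.FG.of_le (Submodule.fg_iff_finiteDimensional _ |>.mpr this) ?_
      rintro _ ⟨ψ, rfl⟩
      exact borelCalculus_singleton_mem_eigenspace hH.1.1 μ ψ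
  · refine ⟨fermiProjection H μ,
      hH.2.1.isWeaklyLocal ⟨_, ⟨measurable_const.indicator measurableSet_Iio,
        abs_indicator_one_le _, fun s hs t ht => ?_, fun s hs t ht => ?_⟩, rfl⟩, ?_⟩
    · rw [Set.indicator_of_mem, Set.indicator_of_mem]
      · exact lt_of_le_of_ne (ht hμ) fun h => hlow (h ▸ ht)
      · exact lt_of_le_of_ne (hs hμ) fun h => hlow (h ▸ hs)
    · rw [Set.indicator_of_notMem, Set.indicator_of_notMem]
      · simpa using ht hμ
      · simpa using hs hμ
    · rw [sub_self]; exact zero_mem _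

/-- The Fermi projection commutes with slowly varying functions up to compact operators. -/
theorem IsMobilityGapped.commute_calkin {H : BulkOp N} {Δ : Set ℝ}
    (hH : IsMobilityGapped H Δ) (hΔ : Δ.Nontrivial) {μ : ℝ} (hμ : μ ∈ Δ) {g : LatticeFun}
    (hg : SlowlyVarying g) :
    Commute (calkin (fermiProjection H μ)) (calkin (mulOp N g)) := by
  obtain ⟨A, hA, hPA⟩ := hH.exists_isWeaklyLocal hΔ hμ
  rw [← calkin_eq_iff] at hPA
  rw [hPA, Commute, SemiconjBy, ← map_mul, ← map_mul, calkin_eq_iff]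
  exact hA.commutator_mem hg

end Fermi

/-! ### Time-reversal symmetry as a real star automorphism -/

theorem starAlgHom_cfc_eq_self {E : Type*} [NormedAddCommGroup E] [InnerProductSpace ℂ E]
    [CompleteSpace E] (φ : (E →L[ℂ] E) →⋆ₐ[ℝ] (E →L[ℂ] E)) (hφ : Continuous φ) {H : E →L[ℂ] E}
    (hH : φ H = H) (hsa : IsSelfAdjoint H) {g : ℝ → ℝ} (hg : Continuous g) :
    φ (cfc g H) = cfc g H := by
  have := StarAlgHomClass.map_cfc φ g H hg.continuousOn hφ hsa (hH.symm ▸ hsa)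
  rwa [hH] at this

/-- `φ` fixes every continuous function of `H`, and these determine the Riesz measure. The
homomorphism is over `ℝ` because conjugation by an antiunitary is antilinear. -/
theorem spectralMeasure_eq_of_starAlgHom {E : Type*} [NormedAddCommGroup E]
    [InnerProductSpace ℂ E] [CompleteSpace E] (φ : (E →L[ℂ] E) →⋆ₐ[ℝ] (E →L[ℂ] E))
    (hφ : Continuous φ) {H : E →L[ℂ] E} (hH : φ H = H) (hsa : IsSelfAdjoint H) {ψ ψ' : E}
    (h : ∀ A, φ A = A → (⟪ψ', A ψ'⟫_ℂ).re = (⟪ψ, A ψ⟫_ℂ).re) :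
    spectralMeasure H ψ' = spectralMeasure H ψ := by
  have : spectralFunctional H ψ' = spectralFunctional H ψ := by
    ext g
    exact h _ (starAlgHom_cfc_eq_self φ hφ hH hsa g.continuous)
  rw [spectralMeasure, this, spectralMeasure]

section TimeReversalSymmetry

variable {N : ℕ}

theorem TimeReversal.norm_map (Θ : TimeReversal N) (ψ : BulkSpace N) : ‖Θ.toFun ψ‖ = ‖ψ‖ := by
  rw [@norm_eq_sqrt_re_inner ℂ, @norm_eq_sqrt_re_inner ℂ _ _ _ _ ψ, Θ.inner_map]

/-- A time-reversal symmetry as a continuous antilinear map. -/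
def TimeReversal.clm (Θ : TimeReversal N) : BulkSpace N →L⋆[ℂ] BulkSpace N :=
  Θ.toFun.mkContinuous 1 fun ψ => by rw [Θ.norm_map, one_mul]

/-- The map `A ↦ Θ⁻¹ A Θ`. -/
def TimeReversal.conjFun (Θ : TimeReversal N) (A : BulkOp N) : BulkOp N :=
  -(Θ.clm.comp (A.comp Θ.clm))

theorem TimeReversal.conjFun_apply (Θ : TimeReversal N) (A : BulkOp N) (ψ : BulkSpace N) :
    Θ.conjFun A ψ = -Θ.toFun (A (Θ.toFun ψ)) := rfl

theorem TimeReversal.inner_left (Θ : TimeReversal N) (ψ φ : BulkSpace N) :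
    ⟪Θ.toFun ψ, φ⟫_ℂ = -⟪Θ.toFun φ, ψ⟫_ℂ := by
  have : φ = -Θ.toFun (Θ.toFun φ) := by rw [Θ.sq_eq_neg, neg_neg]
  conv_lhs => rw [this, inner_neg_right, Θ.inner_map]

/-- The automorphism `A ↦ Θ⁻¹ A Θ` of the real star algebra of bounded operators. -/
def TimeReversal.conj (Θ : TimeReversal N) : BulkOp N →⋆ₐ[ℝ] BulkOp N where
  toFun := Θ.conjFun
  map_one' := ContinuousLinearMap.ext fun ψ => by
    rw [Θ.conjFun_apply, one_apply_eq_self, Θ.sq_eq_neg, neg_neg,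
      one_apply_eq_self]
  map_mul' A B := ContinuousLinearMap.ext fun ψ => by
    rw [mul_apply_eq_comp, Θ.conjFun_apply, Θ.conjFun_apply, Θ.conjFun_apply, map_neg,
      Θ.sq_eq_neg, neg_neg, mul_apply_eq_comp]
  map_zero' := ContinuousLinearMap.ext fun ψ => by
    rw [Θ.conjFun_apply]; simp
  map_add' A B := ContinuousLinearMap.ext fun ψ => by
    rw [Θ.conjFun_apply, add_apply, add_apply, map_add, neg_add]; rfl
  commutes' r := ContinuousLinearMap.ext fun ψ => by
    rw [Θ.conjFun_apply, Algebra.algebraMap_eq_smul_one]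
    have h : ∀ φ : BulkSpace N, (r • (1 : BulkOp N)) φ = (r : ℂ) • φ := fun φ => rfl
    rw [h, h, LinearMap.map_smulₛₗ, Complex.conj_ofReal, Θ.sq_eq_neg, smul_neg, neg_neg]
  map_star' A := by
    rw [ContinuousLinearMap.star_eq_adjoint, ContinuousLinearMap.star_eq_adjoint,
      ContinuousLinearMap.eq_adjoint_iff]
    intro φ ψ
    rw [Θ.conjFun_apply, Θ.conjFun_apply, inner_neg_left, Θ.inner_left, neg_neg,
      ContinuousLinearMap.adjoint_inner_right, inner_neg_right, ← inner_conj_symm φ, Θ.inner_left,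
      map_neg, neg_neg, inner_conj_symm]

theorem TimeReversal.conj_apply (Θ : TimeReversal N) (A : BulkOp N) (ψ : BulkSpace N) :
    Θ.conj A ψ = -Θ.toFun (A (Θ.toFun ψ)) := rfl

theorem TimeReversal.continuous_conj (Θ : TimeReversal N) : Continuous Θ.conj :=
  AddMonoidHomClass.continuous_of_bound Θ.conj 1 fun A => by
    rw [one_mul]
    refine ContinuousLinearMap.opNorm_le_bound _ (norm_nonneg _) fun ψ => ?_
    rw [Θ.conj_apply, norm_neg, Θ.norm_map]
    exact (A.le_opNorm _).trans (by rw [Θ.norm_map])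

theorem TimeReversal.conj_smul (Θ : TimeReversal N) (c : ℂ) (A : BulkOp N) :
    Θ.conj (c • A) = (starRingEnd ℂ c) • Θ.conj A :=
  ContinuousLinearMap.ext fun ψ => by
    rw [smul_apply, Θ.conj_apply, Θ.conj_apply, smul_apply, LinearMap.map_smulₛₗ, smul_neg]

theorem TimeReversal.conj_eq_self_iff (Θ : TimeReversal N) (A : BulkOp N) :
    Θ.conj A = A ↔ ∀ ψ, A (Θ.toFun ψ) = Θ.toFun (A ψ) := by
  constructor
  · intro h ψ
    conv_lhs => rw [← h, Θ.conj_apply, Θ.sq_eq_neg, map_neg, map_neg, neg_neg]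
  · intro h
    ext1 ψ
    rw [Θ.conj_apply, h, Θ.sq_eq_neg, neg_neg]

theorem isOdd_iff (Θ : TimeReversal N) (F : BulkOp N) : IsOdd Θ F ↔ Θ.conj F = star F := by
  rw [ContinuousLinearMap.star_eq_adjoint]
  constructor
  · intro h
    ext1 ψ
    rw [Θ.conj_apply, h, Θ.sq_eq_neg, map_neg, neg_neg]
  · intro h ψ
    rw [← h, Θ.conj_apply, Θ.sq_eq_neg, map_neg, map_neg, neg_neg]

/-- `Θ` preserves the joint eigenspaces of `X₁` and `X₂`, the eigenvalues being real, so it maps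
vectors supported at a site to vectors supported at the same site. -/
theorem TimeReversal.map_single_apply_ne (Θ : TimeReversal N) {x y : ℤ × ℤ} (h : x ≠ y)
    (v : EuclideanSpace ℂ (Fin N)) : Θ.toFun (lp.single 2 y v) x = 0 := by
  by_contra h0
  refine h (Prod.ext ?_ ?_)
  · have h1 := Θ.comm_fst (lp.single 2 y v) ((y.1 : ℂ) • lp.single 2 y v) (fun z => by
      rw [lp.coeFn_smul, Pi.smul_apply]
      by_cases hz : z = y
      · rw [hz]
      · rw [lp.single_apply_ne _ _ _ hz, smul_zero, smul_zero]) x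
    rw [LinearMap.map_smulₛₗ, lp.coeFn_smul, Pi.smul_apply, map_intCast] at h1
    have h2 := smul_left_injective ℂ h0 h1
    exact_mod_cast h2.symm
  · have h1 := Θ.comm_snd (lp.single 2 y v) ((y.2 : ℂ) • lp.single 2 y v) (fun z => by
      rw [lp.coeFn_smul, Pi.smul_apply]
      by_cases hz : z = y
      · rw [hz]
      · rw [lp.single_apply_ne _ _ _ hz, smul_zero, smul_zero]) x
    rw [LinearMap.map_smulₛₗ, lp.coeFn_smul, Pi.smul_apply, map_intCast] at h1
    have h2 := smul_left_injective ℂ h0 h1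
    exact_mod_cast h2.symm

/-- `Θ` preserves sites and is antilinear, so the scalar `g y` comes out conjugated; continuity
extends this from single sites to all vectors. -/
theorem TimeReversal.conj_mulOp (Θ : TimeReversal N) (g : LatticeFun) :
    Θ.conj (mulOp N g) = mulOp N (star g) := by
  have h1 : ∀ (y : ℤ × ℤ) (v : EuclideanSpace ℂ (Fin N)),
      mulOp N g (Θ.toFun (lp.single 2 y v)) = Θ.toFun (mulOp N (star g) (lp.single 2 y v)) := by
    intro y v
    rw [mulOp_single, LinearMap.map_smulₛₗ]
    apply lp.ext
    funext x
    rw [mulOp_apply, lp.coeFn_smul, Pi.smul_apply]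
    by_cases h : x = y
    · subst h
      simp
    · rw [Θ.map_single_apply_ne h, smul_zero, smul_zero]
  have h2 : ∀ ψ, mulOp N g (Θ.toFun ψ) = Θ.toFun (mulOp N (star g) ψ) := by
    intro ψ
    have hψ := lp.hasSum_single (p := 2) (by norm_num) ψ
    have ha := ((mulOp N g).comp Θ.clm).hasSum hψ
    have hb := (Θ.clm.comp (mulOp N (star g))).hasSum hψ
    refine ha.unique (hb.congr_fun ?_)
    intro y
    exact h1 y (ψ y)
  ext1 ψ
  rw [Θ.conj_apply, h2, Θ.sq_eq_neg, neg_neg]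

theorem TimeReversal.spectralMeasure_map (Θ : TimeReversal N) {H : BulkOp N} (hH : IsTRI Θ H)
    (hsa : IsSelfAdjoint H) (ψ : BulkSpace N) :
    spectralMeasure H (Θ.toFun ψ) = spectralMeasure H ψ := by
  refine spectralMeasure_eq_of_starAlgHom Θ.conj Θ.continuous_conj
    ((Θ.conj_eq_self_iff H).mpr hH) hsa fun A hA => ?_
  rw [(Θ.conj_eq_self_iff A).mp hA, Θ.inner_map, ← inner_conj_symm, Complex.conj_re]

theorem TimeReversal.conj_fermiProjection (Θ : TimeReversal N) {H : BulkOp N} (hH : IsTRI Θ H)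
    (hsa : IsSelfAdjoint H) (μ : ℝ) : Θ.conj (fermiProjection H μ) = fermiProjection H μ := by
  refine IsBorelCalculus.unique (fun ψ => ?_) (isBorelCalculus_indicator H measurableSet_Iio)
  rw [Θ.conj_apply, inner_neg_right, ← inner_conj_symm, Θ.inner_left, map_neg, neg_neg,
    fermiProjection, isBorelCalculus_indicator H measurableSet_Iio, Θ.spectralMeasure_map hH hsa,
    Complex.conj_ofReal]

theorem isOdd_compress (Θ : TimeReversal N) {P A : BulkOp N} (hP : Θ.conj P = P)
    (hPsa : IsSelfAdjoint P) (hA : Θ.conj A = star A) : IsOdd Θ (compress P A) := by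
  rw [isOdd_iff, compress]
  simp only [map_add, map_mul, map_sub, map_one, hP, hA, star_add, star_sub, star_mul, star_one,
    hPsa.star_eq, mul_assoc]

/-- Conjugation by `Θ` and the adjoint both fix `A` and both conjugate the scalar `c`. -/
theorem TimeReversal.conj_exp (Θ : TimeReversal N) {A : BulkOp N} (hA : Θ.conj A = A)
    (hsa : IsSelfAdjoint A) (c : ℂ) :
    Θ.conj (NormedSpace.exp (c • A)) = star (NormedSpace.exp (c • A)) := by
  let _ := NormedAlgebra.restrictScalars ℚ ℂ (BulkOp N)
  rw [NormedSpace.map_exp Θ.conj Θ.continuous_conj, NormedSpace.star_exp, Θ.conj_smul, hA,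
    star_smul, hsa.star_eq]
  rfl

end TimeReversalSymmetry

/-! ### Slowly varying functions on the lattice -/

section LatticeFunctions

variable {N : ℕ}

theorem exp_latticeFun_apply (g : LatticeFun) (x : ℤ × ℤ) :
    NormedSpace.exp g x = Complex.exp (g x) := by
  let _ := NormedAlgebra.restrictScalars ℚ ℂ LatticeFun
  let ev : LatticeFun →+* ℂ :=
    { toFun := fun g => g x
      map_one' := rfl
      map_mul' := fun _ _ => rfl
      map_zero' := rfl
      map_add' := fun _ _ => rfl }
  rw [Complex.exp_eq_exp_ℂ]
  exact NormedSpace.map_exp ev (BoundedContinuousFunction.evalCLM ℂ x).continuous g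

theorem exp_mulOp (g : LatticeFun) : NormedSpace.exp (mulOp N g) = mulOp N (NormedSpace.exp g) := by
  let _ := NormedAlgebra.restrictScalars ℚ ℂ LatticeFun
  let _ := NormedAlgebra.restrictScalars ℚ ℂ (BulkOp N)
  exact (NormedSpace.map_exp (mulOp N) continuous_mulOp g).symm

theorem norm_lattice_eq (x : ℤ × ℤ) : ‖x‖ = max |(x.1 : ℝ)| |(x.2 : ℝ)| := by
  rw [Prod.norm_def, Int.norm_eq_abs, Int.norm_eq_abs]

theorem abs_fst_le (x : ℤ × ℤ) : |(x.1 : ℝ)| ≤ ‖x‖ := by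
  rw [norm_lattice_eq]; exact le_max_left _ _

theorem abs_snd_le (x : ℤ × ℤ) : |(x.2 : ℝ)| ≤ ‖x‖ := by
  rw [norm_lattice_eq]; exact le_max_right _ _

/-- The slope `x₂ / ‖x‖` of a lattice point. -/
def slope (x : ℤ × ℤ) : ℝ := x.2 / ‖x‖

theorem slope_mul_norm (x : ℤ × ℤ) : slope x * ‖x‖ = x.2 := by
  rcases eq_or_ne x 0 with rfl | hx
  · simp
  · exact div_mul_cancel₀ _ (norm_ne_zero_iff.mpr hx)

theorem abs_slope_le (x : ℤ × ℤ) : |slope x| ≤ 1 := by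
  rw [slope, abs_div, abs_norm]
  exact div_le_one_of_le₀ (abs_snd_le x) (norm_nonneg _)

/-- Multiplying by `‖x‖` leaves differences of the Lipschitz functions `x₂` and `‖x‖`, the latter
with a bounded coefficient. -/
theorem abs_slope_sub_mul_le (x y : ℤ × ℤ) : |slope x - slope y| * ‖x‖ ≤ 2 * ‖x - y‖ := by
  have h : (slope x - slope y) * ‖x‖ = ((x.2 : ℝ) - y.2) + slope y * (‖y‖ - ‖x‖) := by
    rw [sub_mul, slope_mul_norm, mul_sub, slope_mul_norm]; ring
  have h1 : |(x.2 : ℝ) - y.2| ≤ ‖x - y‖ := by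
    have := abs_snd_le (x - y)
    simpa using this
  have h2 : |‖y‖ - ‖x‖| ≤ ‖x - y‖ := by
    rw [abs_sub_comm]; exact abs_norm_sub_norm_le x y
  calc |slope x - slope y| * ‖x‖ = |(slope x - slope y) * ‖x‖| := by rw [abs_mul, abs_norm]
    _ ≤ |(x.2 : ℝ) - y.2| + |slope y| * |‖y‖ - ‖x‖| := by
        rw [h, ← abs_mul]; exact abs_add_le _ _
    _ ≤ ‖x - y‖ + 1 * ‖x - y‖ := by
        gcongr
        exact abs_slope_le y
    _ = 2 * ‖x - y‖ := by ring

theorem norm_ofReal_clamp_le (t : ℝ) : ‖(clamp t : ℂ)‖ ≤ 1 := by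
  rw [Complex.norm_real, Real.norm_of_nonneg (clamp_nonneg t)]
  exact clamp_le_one t

/-- A slowly varying version of the indicator function of the upper half plane. -/
def stepFun : LatticeFun :=
  latticeFun (fun x => (clamp (1 / 2 + slope x) : ℂ)) 1 fun _ => norm_ofReal_clamp_le _

/-- A slowly varying function that is `1` near the vertical axis and `0` near the horizontal
axis. -/
def coneFun : LatticeFun :=
  latticeFun (fun x => (clamp (2 * |slope x| - 1) : ℂ)) 1 fun _ => norm_ofReal_clamp_le _

/-- The indicator function of the right half plane. -/
def rightFun : LatticeFun :=
  latticeFun (fun x => if 0 ≤ x.1 then 1 else 0) 1 fun x => by split_ifs <;> simp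

/-- The indicator function of the upper half plane. -/
def upperFun : LatticeFun :=
  latticeFun (fun x => if 0 ≤ x.2 then 1 else 0) 1 fun x => by split_ifs <;> simp

/-- The function `exp(i arg(x₁ + i x₂))`. -/
def fluxFun : LatticeFun :=
  latticeFun (fun x => Complex.exp (Complex.I * (Complex.arg ((x.1 : ℂ) + Complex.I * (x.2 : ℂ)) : ℂ)))
    1 fun x => by rw [mul_comm, Complex.norm_exp_ofReal_mul_I]

theorem rightProj_eq : rightProj N = mulOp N rightFun := rfl

theorem upperProj_eq : upperProj N = mulOp N upperFun := rfl

theorem fluxOp_eq : fluxOp N = mulOp N fluxFun := rfl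

theorem stepFun_apply (x : ℤ × ℤ) : stepFun x = (clamp (1 / 2 + slope x) : ℂ) := rfl

theorem coneFun_apply (x : ℤ × ℤ) : coneFun x = (clamp (2 * |slope x| - 1) : ℂ) := rfl

theorem rightFun_apply (x : ℤ × ℤ) : rightFun x = if 0 ≤ x.1 then 1 else 0 := rfl

theorem upperFun_apply (x : ℤ × ℤ) : upperFun x = if 0 ≤ x.2 then 1 else 0 := rfl

theorem slowlyVarying_stepFun : SlowlyVarying stepFun := by
  refine ⟨2, fun x y => ?_⟩
  rw [stepFun_apply, stepFun_apply, ← Complex.ofReal_sub, Complex.norm_real, Real.norm_eq_abs]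
  refine le_trans ?_ (abs_slope_sub_mul_le x y)
  refine mul_le_mul_of_nonneg_right ((abs_clamp_sub_le _ _).trans_eq ?_) (norm_nonneg x)
  congr 1; ring

theorem slowlyVarying_coneFun : SlowlyVarying coneFun := by
  refine ⟨4, fun x y => ?_⟩
  rw [coneFun_apply, coneFun_apply, ← Complex.ofReal_sub, Complex.norm_real, Real.norm_eq_abs]
  have h1 := abs_clamp_sub_le (2 * |slope x| - 1) (2 * |slope y| - 1)
  have h2 : 2 * |slope x| - 1 - (2 * |slope y| - 1) = 2 * (|slope x| - |slope y|) := by ring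
  rw [h2, abs_mul, abs_two] at h1
  have h3 := abs_abs_sub_abs_le_abs_sub (slope x) (slope y)
  have h4 := abs_slope_sub_mul_le x y
  calc _ ≤ 2 * |slope x - slope y| * ‖x‖ := by gcongr; linarith
    _ ≤ 4 * ‖x - y‖ := by linarith

theorem coneFun_eq_one {x : ℤ × ℤ} (hx : x ≠ 0) (h : |(x.1 : ℝ)| ≤ |(x.2 : ℝ)|) :
    coneFun x = 1 := by
  have hn : ‖x‖ = |(x.2 : ℝ)| := by rw [norm_lattice_eq, max_eq_right h]
  have h1 : |slope x| = 1 := by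
    rw [slope, abs_div, abs_norm, hn, div_self]
    rw [← hn]; exact norm_ne_zero_iff.mpr hx
  rw [coneFun_apply, h1, clamp_of_one_le (by norm_num)]
  simp

/-- The function `rightFun` varies slowly away from the vertical axis. -/
theorem slowlyVarying_rightFun_mul : SlowlyVarying (rightFun * (1 - coneFun)) := by
  obtain ⟨C, hC⟩ := slowlyVarying_coneFun
  have hval : ∀ x, (rightFun * (1 - coneFun)) x = rightFun x * (1 - coneFun x) := fun x => rfl
  -- Where `1 - coneFun` does not vanish, `‖x‖ = |x₁|` for the sup norm, which is at most the
  -- distance to any point across the vertical axis.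
  have hzero : ∀ x y : ℤ × ℤ, 0 ≤ x.1 → ¬ 0 ≤ y.1 → ‖1 - coneFun x‖ * ‖x‖ ≤ ‖x - y‖ := by
    intro x y hx hy
    have h1 : ‖1 - coneFun x‖ ≤ 1 := by
      rw [coneFun_apply, ← Complex.ofReal_one, ← Complex.ofReal_sub, Complex.norm_real,
        Real.norm_eq_abs, abs_le]
      constructor <;> linarith [clamp_nonneg (2 * |slope x| - 1), clamp_le_one (2 * |slope x| - 1)]
    rcases eq_or_ne x 0 with rfl | hx0
    · simp
    by_cases h : |(x.1 : ℝ)| ≤ |(x.2 : ℝ)|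
    · rw [coneFun_eq_one hx0 h]; simp
    · have hn : ‖x‖ = |(x.1 : ℝ)| := by rw [norm_lattice_eq, max_eq_left (not_le.mp h).le]
      have h2 : ‖x‖ ≤ ‖x - y‖ := by
        refine le_trans ?_ (abs_fst_le (x - y))
        have hx' : (0 : ℝ) ≤ x.1 := by exact_mod_cast hx
        have hy' : (y.1 : ℝ) < 0 := by exact_mod_cast not_le.mp hy
        rw [hn, abs_of_nonneg hx', Prod.fst_sub, Int.cast_sub, abs_of_nonneg (by linarith)]
        linarith
      calc _ ≤ 1 * ‖x‖ := by gcongr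
        _ ≤ _ := by linarith
  refine ⟨max C 2, fun x y => ?_⟩
  have hn : ‖x‖ ≤ ‖x - y‖ + ‖y‖ := by simpa using norm_add_le (x - y) y
  have h2 : 2 * ‖x - y‖ ≤ max C 2 * ‖x - y‖ := by gcongr; exact le_max_right _ _
  have h3 : C * ‖x - y‖ ≤ max C 2 * ‖x - y‖ := by gcongr; exact le_max_left _ _
  have h4 := norm_nonneg (x - y)
  have h1' : ∀ x, ‖1 - coneFun x‖ ≤ 1 := by
    intro x
    rw [coneFun_apply, ← Complex.ofReal_one, ← Complex.ofReal_sub, Complex.norm_real,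
      Real.norm_eq_abs, abs_le]
    constructor <;> linarith [clamp_nonneg (2 * |slope x| - 1), clamp_le_one (2 * |slope x| - 1)]
  rw [hval, hval, rightFun_apply, rightFun_apply]
  by_cases hx : 0 ≤ x.1 <;> by_cases hy : 0 ≤ y.1
  · rw [if_pos hx, if_pos hy, one_mul, one_mul, sub_sub_sub_cancel_left, norm_sub_rev]
    exact (hC x y).trans h3
  · rw [if_pos hx, if_neg hy, one_mul, zero_mul, sub_zero]
    linarith [hzero x y hx hy]
  · rw [if_neg hx, if_pos hy, one_mul, zero_mul, zero_sub, norm_neg]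
    have h5 := hzero y x hy hx
    rw [norm_sub_rev y x] at h5
    have h6 : ‖1 - coneFun y‖ * ‖x‖ ≤ ‖1 - coneFun y‖ * (‖x - y‖ + ‖y‖) := by gcongr
    have h7 : ‖1 - coneFun y‖ * ‖x - y‖ ≤ 1 * ‖x - y‖ := by gcongr; exact h1' y
    linarith
  · rw [if_neg hx, if_neg hy]
    simp only [zero_mul, sub_self, norm_zero]
    linarith

/-- A lattice point as a complex number. -/
def latticePoint (x : ℤ × ℤ) : ℂ := (x.1 : ℂ) + Complex.I * (x.2 : ℂ)

theorem norm_mul_fluxFun (x : ℤ × ℤ) : (‖latticePoint x‖ : ℂ) * fluxFun x = latticePoint x := by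
  change (‖latticePoint x‖ : ℂ) * Complex.exp (Complex.I * (Complex.arg (latticePoint x) : ℂ)) = _
  rw [mul_comm Complex.I, Complex.norm_mul_exp_arg_mul_I]

theorem norm_fluxFun (x : ℤ × ℤ) : ‖fluxFun x‖ = 1 := by
  change ‖Complex.exp (Complex.I * (Complex.arg (latticePoint x) : ℂ))‖ = 1
  rw [mul_comm, Complex.norm_exp_ofReal_mul_I]

theorem latticePoint_re (x : ℤ × ℤ) : (latticePoint x).re = x.1 := by simp [latticePoint]

theorem latticePoint_im (x : ℤ × ℤ) : (latticePoint x).im = x.2 := by simp [latticePoint]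

theorem norm_le_norm_latticePoint (x : ℤ × ℤ) : ‖x‖ ≤ ‖latticePoint x‖ := by
  rw [norm_lattice_eq, ← latticePoint_re, ← latticePoint_im]
  exact max_le (Complex.abs_re_le_norm _) (Complex.abs_im_le_norm _)

theorem norm_latticePoint_le (x : ℤ × ℤ) : ‖latticePoint x‖ ≤ 2 * ‖x‖ := by
  have := Complex.norm_le_abs_re_add_abs_im (latticePoint x)
  rw [latticePoint_re, latticePoint_im] at this
  linarith [abs_fst_le x, abs_snd_le x]

/-- The same cancellation as for `slope`, with the complex modulus in place of the sup norm;
comparing the two norms accounts for the `4`. -/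
theorem slowlyVarying_fluxFun : SlowlyVarying fluxFun := by
  refine ⟨4, fun x y => ?_⟩
  have h1 : (fluxFun x - fluxFun y) * (‖latticePoint x‖ : ℂ)
      = latticePoint (x - y) + fluxFun y * ((‖latticePoint y‖ - ‖latticePoint x‖ : ℝ) : ℂ) := by
    have h2 : latticePoint (x - y) = latticePoint x - latticePoint y := by
      simp [latticePoint]; ring
    rw [h2]
    push_cast
    linear_combination norm_mul_fluxFun x - norm_mul_fluxFun y
  have h3 : |‖latticePoint y‖ - ‖latticePoint x‖| ≤ ‖latticePoint (x - y)‖ := by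
    have h2 : latticePoint (x - y) = latticePoint x - latticePoint y := by
      simp [latticePoint]; ring
    rw [h2, abs_sub_comm]
    exact abs_norm_sub_norm_le _ _
  calc ‖fluxFun x - fluxFun y‖ * ‖x‖ ≤ ‖fluxFun x - fluxFun y‖ * ‖latticePoint x‖ := by
        gcongr; exact norm_le_norm_latticePoint x
    _ = ‖(fluxFun x - fluxFun y) * (‖latticePoint x‖ : ℂ)‖ := by simp
    _ ≤ ‖latticePoint (x - y)‖ + 1 * |‖latticePoint y‖ - ‖latticePoint x‖| := by
        rw [h1]
        refine (norm_add_le _ _).trans_eq ?_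
        rw [norm_mul, norm_fluxFun, Complex.norm_real, Real.norm_eq_abs]
    _ ≤ 4 * ‖x - y‖ := by linarith [norm_latticePoint_le (x - y)]

end LatticeFunctions

/-! ### Comparison of the flux phase with the sector phase -/

section Phase

/-- The support of `coneFun` lies in `|slope| > 1/2`, where the clamp in `stepFun` is saturated. -/
theorem coneFun_mul_upperFun : coneFun * upperFun = coneFun * stepFun := by
  ext x
  change coneFun x * upperFun x = coneFun x * stepFun x
  by_cases h : 2 * |slope x| - 1 ≤ 0
  · rw [coneFun_apply, clamp_of_nonpos h]; simp
  congr 1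
  rw [upperFun_apply, stepFun_apply]
  have hx : x ≠ 0 := by
    rintro rfl
    simp [slope] at h
  have hn : 0 < ‖x‖ := norm_pos_iff.mpr hx
  have hs := slope_mul_norm x
  by_cases h2 : 0 ≤ x.2
  · have h3 : 0 ≤ slope x := div_nonneg (by exact_mod_cast h2) hn.le
    rw [abs_of_nonneg h3] at h
    rw [if_pos h2, clamp_of_one_le (by linarith)]
    simp
  · have h3 : slope x < 0 := div_neg_of_neg_of_pos (by exact_mod_cast not_le.mp h2) hn
    rw [abs_of_neg h3] at h
    rw [if_neg h2, clamp_of_nonpos (by linarith)]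
    simp

/-- The phase `exp(2πi f)`, `f` being the slowly varying step function. -/
def stepPhase : LatticeFun := NormedSpace.exp ((2 * Real.pi * Complex.I : ℂ) • stepFun)

theorem stepPhase_apply (x : ℤ × ℤ) :
    stepPhase x = Complex.exp (2 * Real.pi * clamp (1 / 2 + slope x) * Complex.I) := by
  rw [stepPhase, exp_latticeFun_apply]
  change Complex.exp ((2 * Real.pi * Complex.I : ℂ) * (clamp (1 / 2 + slope x) : ℂ)) = _
  congr 1; ring

theorem stepPhase_eq_one {x : ℤ × ℤ} (h : 1 / 2 ≤ |slope x|) : stepPhase x = 1 := by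
  rw [stepPhase_apply]
  rcases le_abs.mp h with h | h
  · rw [clamp_of_one_le (by linarith), Complex.ofReal_one, mul_one, Complex.exp_two_pi_mul_I]
  · rw [clamp_of_nonpos (by linarith), Complex.ofReal_zero, mul_zero, zero_mul, Complex.exp_zero]

theorem coneFun_mul_stepPhase_sub_one : coneFun * (stepPhase - 1) = 0 := by
  ext x
  change coneFun x * (stepPhase x - 1) = 0
  by_cases h : 2 * |slope x| - 1 ≤ 0
  · rw [coneFun_apply, clamp_of_nonpos h]; simp
  · rw [stepPhase_eq_one (by linarith), sub_self, mul_zero]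

/-- The phase that winds once around the circle in the sector around the positive horizontal
axis, and is `1` outside. -/
def sectorPhase : LatticeFun := 1 + rightFun * (stepPhase - 1)

theorem sectorPhase_of_nonneg {x : ℤ × ℤ} (h : 0 ≤ x.1) : sectorPhase x = stepPhase x := by
  change 1 + rightFun x * (stepPhase x - 1) = _
  rw [rightFun_apply, if_pos h]; ring

theorem sectorPhase_of_neg {x : ℤ × ℤ} (h : ¬ 0 ≤ x.1) : sectorPhase x = 1 := by
  change 1 + rightFun x * (stepPhase x - 1) = _
  rw [rightFun_apply, if_neg h]; ring

theorem norm_sectorPhase (x : ℤ × ℤ) : ‖sectorPhase x‖ = 1 := by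
  by_cases h : 0 ≤ x.1
  · rw [sectorPhase_of_nonneg h, stepPhase_apply]
    have : (2 * Real.pi * clamp (1 / 2 + slope x) * Complex.I : ℂ)
        = ((2 * Real.pi * clamp (1 / 2 + slope x) : ℝ) : ℂ) * Complex.I := by push_cast; ring
    rw [this, Complex.norm_exp_ofReal_mul_I]
  · rw [sectorPhase_of_neg h, norm_one]

/-- The hypothesis gives `x₁² ≤ (16/17) |z|²` for `z = x₁ + i x₂`, and `16/17 < (49/50)²`. -/
theorem fst_le_mul_norm_latticePoint {x : ℤ × ℤ} (h : |(x.1 : ℝ)| ≤ 4 * |(x.2 : ℝ)|) :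
    (x.1 : ℝ) ≤ 49 / 50 * ‖latticePoint x‖ := by
  have h1 : ‖latticePoint x‖ ^ 2 = (x.1 : ℝ) ^ 2 + (x.2 : ℝ) ^ 2 := by
    rw [← Complex.normSq_eq_norm_sq, Complex.normSq_apply, latticePoint_re, latticePoint_im]; ring
  have h2 : (x.1 : ℝ) ^ 2 ≤ 16 * (x.2 : ℝ) ^ 2 := by
    have := pow_le_pow_left₀ (abs_nonneg _) h 2
    rw [mul_pow, sq_abs, sq_abs] at this
    linarith
  refine le_of_abs_le (abs_le_of_sq_le_sq ?_ (by positivity))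
  rw [mul_pow, h1]
  nlinarith [sq_nonneg (x.1 : ℝ), sq_nonneg (x.2 : ℝ)]

theorem re_latticePoint_mul_conj_sectorPhase_le (x : ℤ × ℤ) (hx : x ≠ 0) :
    (latticePoint x * (starRingEnd ℂ) (sectorPhase x)).re ≤ 49 / 50 * ‖latticePoint x‖ := by
  have hn : 0 < ‖x‖ := norm_pos_iff.mpr hx
  by_cases h : 0 ≤ x.1
  · have h' : (0 : ℝ) ≤ x.1 := by exact_mod_cast h
    by_cases h2 : 1 / 2 ≤ |slope x|
    · rw [sectorPhase_of_nonneg h, stepPhase_eq_one h2, map_one, mul_one, latticePoint_re]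
      refine fst_le_mul_norm_latticePoint ?_
      have h3 : |(x.2 : ℝ)| = |slope x| * ‖x‖ := by
        rw [← slope_mul_norm x, abs_mul, abs_norm]
      have h4 := abs_fst_le x
      rw [h3]
      nlinarith
    · rw [not_le] at h2
      have h3 : |(x.2 : ℝ)| = |slope x| * ‖x‖ := by
        rw [← slope_mul_norm x, abs_mul, abs_norm]
      have h4 : ‖x‖ = x.1 := by
        rcases max_choice |(x.1 : ℝ)| |(x.2 : ℝ)| with h5 | h5
        · rw [norm_lattice_eq, h5, abs_of_nonneg h']
        · rw [← norm_lattice_eq] at h5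
          nlinarith
      have h5 := abs_lt.mp h2
      have hs := slope_mul_norm x
      have hphase : sectorPhase x
          = -(Real.cos (2 * Real.pi * slope x) + Real.sin (2 * Real.pi * slope x) * Complex.I) := by
        rw [sectorPhase_of_nonneg h, stepPhase_apply,
          clamp_of_mem (by linarith) (by linarith)]
        have : (2 * Real.pi * ((1 / 2 + slope x : ℝ) : ℂ) * Complex.I : ℂ)
            = ((2 * Real.pi * slope x : ℝ) : ℂ) * Complex.I + Real.pi * Complex.I := by
          push_cast; ring
        rw [this, Complex.exp_add, Complex.exp_pi_mul_I, Complex.exp_mul_I, Complex.ofReal_cos,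
          Complex.ofReal_sin]
        ring
      have hre : (latticePoint x * (starRingEnd ℂ) (sectorPhase x)).re
          = -(x.1 * Real.cos (2 * Real.pi * slope x) + x.2 * Real.sin (2 * Real.pi * slope x)) := by
        rw [hphase, Complex.mul_re, latticePoint_re, latticePoint_im]
        simp only [map_neg, map_add, map_mul, Complex.conj_ofReal, Complex.conj_I, Complex.neg_re,
          Complex.add_re, Complex.ofReal_re, Complex.mul_re, Complex.ofReal_im, Complex.neg_im,
          Complex.add_im, Complex.mul_im, Complex.I_re, Complex.I_im]
        ring
      have hsin : 0 ≤ (x.2 : ℝ) * Real.sin (2 * Real.pi * slope x) := by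
        rw [← hs]
        rcases le_total 0 (slope x) with h6 | h6
        · have : 0 ≤ Real.sin (2 * Real.pi * slope x) :=
            Real.sin_nonneg_of_nonneg_of_le_pi (by positivity) (by nlinarith [Real.pi_pos])
          positivity
        · have : Real.sin (2 * Real.pi * slope x) ≤ 0 :=
            Real.sin_nonpos_of_nonpos_of_neg_pi_le (by nlinarith [Real.pi_pos])
              (by nlinarith [Real.pi_pos])
          exact mul_nonneg_of_nonpos_of_nonpos (mul_nonpos_of_nonpos_of_nonneg h6 hn.le) this
      rw [hre]
      -- Here the sector phase is `-exp(2πi slope)`. For `|slope| ≤ 1/4` the cosine is nonnegative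
      -- and the real part is at most `0`; for larger slopes it is at most `x₁`, and `x` is far
      -- enough from the horizontal axis.
      by_cases h7 : |slope x| ≤ 1 / 4
      · have h8 := abs_le.mp h7
        have : 0 ≤ Real.cos (2 * Real.pi * slope x) :=
          Real.cos_nonneg_of_neg_pi_div_two_le_of_le (by nlinarith [Real.pi_pos])
            (by nlinarith [Real.pi_pos])
        have := mul_nonneg h' this
        have : 0 ≤ ‖latticePoint x‖ := norm_nonneg _
        linarith
      · have h9 : (x.1 : ℝ) ≤ 49 / 50 * ‖latticePoint x‖ := by
          refine fst_le_mul_norm_latticePoint ?_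
          rw [abs_of_nonneg h', h3, ← h4]
          nlinarith
        have := mul_le_mul_of_nonneg_left (Real.neg_one_le_cos (2 * Real.pi * slope x)) h'
        linarith
  · have h' : (x.1 : ℝ) < 0 := by exact_mod_cast not_le.mp h
    rw [sectorPhase_of_neg h, map_one, mul_one, latticePoint_re]
    have : 0 ≤ ‖latticePoint x‖ := norm_nonneg _
    linarith

theorem re_fluxFun_mul_conj_sectorPhase_le (x : ℤ × ℤ) :
    (fluxFun x * (starRingEnd ℂ) (sectorPhase x)).re ≤ 49 / 50 := by
  rcases eq_or_ne x 0 with rfl | hx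
  -- The conventions `arg 0 = 0` and `slope 0 = 0 / 0 = 0` make the two phases opposite at the
  -- origin.
  · have h1 : fluxFun 0 = 1 := by
      change Complex.exp (Complex.I * (Complex.arg (latticePoint 0) : ℂ)) = 1
      simp [latticePoint]
    have h2 : sectorPhase 0 = -1 := by
      rw [sectorPhase_of_nonneg le_rfl, stepPhase_apply]
      have : clamp (1 / 2 + slope 0) = 1 / 2 := by
        rw [clamp_of_mem] <;> norm_num [slope]
      rw [this, ← Complex.exp_pi_mul_I]
      congr 1; push_cast; ring
    rw [h1, h2]; norm_num
  · have h1 := re_latticePoint_mul_conj_sectorPhase_le x hx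
    have hpos : 0 < ‖latticePoint x‖ :=
      (norm_pos_iff.mpr hx).trans_le (norm_le_norm_latticePoint x)
    rw [← norm_mul_fluxFun, mul_assoc, Complex.re_ofReal_mul, norm_mul, norm_fluxFun, mul_one,
      Complex.norm_real, norm_norm] at h1
    nlinarith

/-- The segment from `U` to `-U'`, `U'` being multiplication by `sectorPhase`. -/
def phasePath (t : ℝ) : LatticeFun := ((1 - t : ℝ) : ℂ) • fluxFun - (t : ℂ) • sectorPhase

theorem continuous_phasePath : Continuous phasePath := by unfold phasePath; fun_prop

theorem le_norm_phasePath {t : ℝ} (h0 : 0 ≤ t) (h1 : t ≤ 1) (x : ℤ × ℤ) :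
    1 / 10 ≤ ‖phasePath t x‖ := by
  have h2 := re_fluxFun_mul_conj_sectorPhase_le x
  have h3 : Complex.normSq (fluxFun x) = 1 := by rw [Complex.normSq_eq_norm_sq, norm_fluxFun]; norm_num
  have h4 : Complex.normSq (sectorPhase x) = 1 := by
    rw [Complex.normSq_eq_norm_sq, norm_sectorPhase]; norm_num
  have h5 : phasePath t x = ((1 - t : ℝ) : ℂ) * fluxFun x - (t : ℂ) * sectorPhase x := rfl
  rw [Complex.normSq_apply] at h3 h4
  rw [Complex.mul_re, Complex.conj_re, Complex.conj_im] at h2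
  have h6 : ‖phasePath t x‖ ^ 2 = (1 - t) ^ 2 + t ^ 2 - 2 * (t * (1 - t)) *
      ((fluxFun x).re * (sectorPhase x).re - (fluxFun x).im * -(sectorPhase x).im) := by
    rw [← Complex.normSq_eq_norm_sq, h5, Complex.normSq_apply]
    simp only [Complex.sub_re, Complex.sub_im, Complex.re_ofReal_mul, Complex.im_ofReal_mul]
    linear_combination (1 - t) ^ 2 * h3 + t ^ 2 * h4
  have h7 : 0 ≤ t * (1 - t) := mul_nonneg h0 (by linarith)
  have h8 := mul_le_mul_of_nonneg_left h2 h7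
  -- The right side is at least `1 - 2 t (1 - t) (1 + 49/50)`, whose minimum, at `t = 1/2`, is
  -- `1/100`.
  have h9 : (1 / 10 : ℝ) ^ 2 ≤ ‖phasePath t x‖ ^ 2 := by
    rw [h6]
    nlinarith [sq_nonneg (1 - 2 * t)]
  exact (pow_le_pow_iff_left₀ (by norm_num) (norm_nonneg _) two_ne_zero).mp h9

theorem exists_inverse_phasePath {t : ℝ} (h0 : 0 ≤ t) (h1 : t ≤ 1) :
    ∃ w : LatticeFun, phasePath t * w = 1 := by
  have hpos : ∀ x, 0 < ‖phasePath t x‖ := fun x =>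
    lt_of_lt_of_le (by norm_num) (le_norm_phasePath h0 h1 x)
  refine ⟨latticeFun (fun x => (phasePath t x)⁻¹) 10 fun x => ?_, ?_⟩
  · rw [norm_inv, inv_le_comm₀ (hpos x) (by norm_num)]
    have := le_norm_phasePath h0 h1 x
    norm_num at this ⊢
    linarith
  · ext x
    exact mul_inv_cancel₀ (norm_pos_iff.mp (hpos x))

theorem SlowlyVarying.smul {g : LatticeFun} (hg : SlowlyVarying g) (c : ℂ) :
    SlowlyVarying (c • g) := by
  obtain ⟨C, hC⟩ := hg
  refine ⟨‖c‖ * C, fun x y => ?_⟩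
  change ‖c • g x - c • g y‖ * ‖x‖ ≤ _
  rw [← smul_sub, norm_smul, mul_assoc, mul_assoc]
  exact mul_le_mul_of_nonneg_left (hC x y) (norm_nonneg c)

end Phase

/-! ### Exponentials modulo compact operators -/

section CalkinExp

variable {E : Type*} [NormedAddCommGroup E] [InnerProductSpace ℂ E] [CompleteSpace E]

theorem isFredholm_of_isUnit_calkin {F : E →L[ℂ] E} (h : IsUnit (calkin F)) : F.IsFredholm := by
  obtain ⟨b, h1, h2⟩ := isUnit_iff_exists.mp h
  obtain ⟨G, rfl⟩ := Ideal.Quotient.mk_surjective b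
  exact isFredholm_of_calkin_mul_eq_one h2 h1

theorem hasSum_exp (A : E →L[ℂ] E) :
    HasSum (fun n : ℕ => ((n.factorial : ℂ)⁻¹) • A ^ n) (NormedSpace.exp A) := by
  rw [NormedSpace.exp_eq_tsum ℂ]
  exact (NormedSpace.expSeries_summable' (𝕂 := ℂ) A).hasSum

/-- A congruence between the powers of two operators carries over to their exponentials. -/
theorem map_exp_sub_map_exp_mem (Φ Ψ : (E →L[ℂ] E) →L[ℂ] (E →L[ℂ] E)) {A B : E →L[ℂ] E}
    (h : ∀ n : ℕ, Φ (A ^ n) - Ψ (B ^ n) ∈ compactIdeal E) :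
    Φ (NormedSpace.exp A) - Ψ (NormedSpace.exp B) ∈ compactIdeal E := by
  have hs := ((hasSum_exp A).mapL Φ).sub ((hasSum_exp B).mapL Ψ)
  refine isClosed_compactIdeal.mem_of_tendsto hs (Eventually.of_forall fun s => ?_)
  refine (compactIdeal E).sum_mem fun n _ => ?_
  rw [map_smul, map_smul, ← smul_sub]
  have := (compactIdeal E).mul_mem_left (((n.factorial : ℂ)⁻¹) • (1 : E →L[ℂ] E)) (h n)
  rwa [smul_mul_assoc, one_mul] at this

theorem commute_calkin_exp {A B : E →L[ℂ] E} (h : Commute (calkin B) (calkin A)) :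
    Commute (calkin B) (calkin (NormedSpace.exp A)) := by
  rw [Commute, SemiconjBy, ← map_mul, ← map_mul, calkin_eq_iff]
  refine map_exp_sub_map_exp_mem (ContinuousLinearMap.mul ℂ (E →L[ℂ] E) B)
    ((ContinuousLinearMap.mul ℂ (E →L[ℂ] E)).flip B) fun n => ?_
  change B * A ^ n - A ^ n * B ∈ _
  rw [← calkin_eq_iff, map_mul, map_mul, map_pow]
  exact h.pow_right n

theorem exp_mul_exp_neg (A : E →L[ℂ] E) : NormedSpace.exp A * NormedSpace.exp (-A) = 1 := by
  let _ := NormedAlgebra.restrictScalars ℚ ℂ (E →L[ℂ] E)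
  rw [← NormedSpace.exp_add_of_commute (Commute.refl A).neg_right, add_neg_cancel,
    NormedSpace.exp_zero]

theorem exp_neg_mul_exp (A : E →L[ℂ] E) : NormedSpace.exp (-A) * NormedSpace.exp A = 1 := by
  have := exp_mul_exp_neg (-A)
  rwa [neg_neg] at this

/-- Only the constant term of the series survives multiplication by `B`. -/
theorem exp_mul_of_mul_eq_zero {A B : E →L[ℂ] E} (h : A * B = 0) :
    NormedSpace.exp A * B = B := by
  let _ := NormedAlgebra.restrictScalars ℚ ℂ (E →L[ℂ] E)
  have : SemiconjBy B 0 A := by rw [SemiconjBy, h, mul_zero]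
  have := this.exp_right
  rw [SemiconjBy, NormedSpace.exp_zero, mul_one] at this
  exact this.symm

end CalkinExp

/-- The cutoff `k` commutes with `p` and `s`, so it can be carried to each `g` in turn to replace it
by `s`. The `p` at the end makes the case `n = 0` correct. -/
theorem mul_pow_mul_eq {R : Type*} [Ring R] {p k s g : R} (hp : p * p = p) (hk : p * k = k * p)
    (hs : p * s = s * p) (hks : k * s = s * k) (hkg : k * g = k * s) (n : ℕ) :
    k * (p * g * p) ^ n * p = k * s ^ n * p := by
  induction n with
  | zero => simp
  | succ n ih =>
    have hksn : k * s ^ n = s ^ n * k := (Commute.pow_right hks n : Commute k (s ^ n))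
    calc k * (p * g * p) ^ (n + 1) * p = (k * (p * g * p) ^ n * p) * (g * (p * p)) := by
          rw [pow_succ]; simp only [mul_assoc, hp]
      _ = s ^ n * (k * p) * (g * p) := by rw [ih, hp, hksn]; simp only [mul_assoc]
      _ = s ^ n * p * (k * g) * p := by rw [← hk]; simp only [mul_assoc]
      _ = s ^ n * (p * k) * s * p := by rw [hkg]; simp only [mul_assoc]
      _ = s ^ n * k * (p * s) * p := by rw [hk]; simp only [mul_assoc]
      _ = k * s ^ (n + 1) * (p * p) := by rw [hs, ← hksn, pow_succ]; simp only [mul_assoc]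
      _ = k * s ^ (n + 1) * p := by rw [hp]

/-! ### Compressions, signs and adjoints -/

section Compress

variable {N : ℕ}

theorem calkin_compress (P A : BulkOp N) :
    calkin (compress P A) = calkin P * calkin A * calkin P + (1 - calkin P) := by
  simp [compress]

/-- `P` also commutes with `B = A⁻¹` modulo compacts, so the compressions of `A` and `B` are inverse
to each other there. -/
theorem isUnit_calkin_compress {P A B : BulkOp N} (hP : P * P = P) (hAB : A * B = 1)
    (hBA : B * A = 1) (h : Commute (calkin P) (calkin A)) :
    IsUnit (calkin (compress P A)) ∧ IsUnit (calkin (compress P B)) := by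
  have hp : calkin P * calkin P = calkin P := by rw [← map_mul, hP]
  have hab : calkin A * calkin B = 1 := by rw [← map_mul, hAB, map_one]
  have hba : calkin B * calkin A = 1 := by rw [← map_mul, hBA, map_one]
  rw [calkin_compress, calkin_compress]
  generalize calkin P = p at *
  generalize calkin A = a at *
  generalize calkin B = b at *
  have hpa : p * a = a * p := h
  have hpb : p * b = b * p := by
    calc p * b = b * (a * p) * b := by rw [← mul_assoc b, hba, one_mul]
      _ = b * p * (a * b) := by rw [← hpa]; simp only [mul_assoc]
      _ = b * p := by rw [hab, mul_one]
  have h1 : ∀ c : (BulkSpace N →L[ℂ] BulkSpace N) ⧸ compactIdeal (BulkSpace N), p * c = c * p →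
      p * c * p + (1 - p) = c * p + (1 - p) := by
    intro c hc
    rw [hc, mul_assoc, hp]
  rw [h1 a hpa, h1 b hpb]
  have h2 : ∀ c d : (BulkSpace N →L[ℂ] BulkSpace N) ⧸ compactIdeal (BulkSpace N), p * d = d * p →
      c * d = 1 → (c * p + (1 - p)) * (d * p + (1 - p)) = 1 := by
    intro c d hd hcd
    have h3 : c * p * (d * p) = p := by
      rw [mul_assoc, ← mul_assoc p, hd, mul_assoc d, hp, ← mul_assoc, hcd, one_mul]
    have h4 : p * (d * p) = d * p := by rw [← mul_assoc, hd, mul_assoc, hp]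
    have h5 : c * p * p = c * p := by rw [mul_assoc, hp]
    simp only [add_mul, mul_add, mul_sub, sub_mul, mul_one, one_mul, h3, h4, h5, hp]
    abel
  exact ⟨isUnit_iff_exists.mpr ⟨_, h2 a b hpb hab, h2 b a hpa hba⟩,
    isUnit_iff_exists.mpr ⟨_, h2 b a hpa hba, h2 a b hpb hab⟩⟩

theorem star_compress {P A : BulkOp N} (hP : IsSelfAdjoint P) :
    star (compress P A) = compress P (star A) := by
  simp only [compress, star_add, star_sub, star_mul, star_one, hP.star_eq, mul_assoc]

theorem continuous_compress (P : BulkOp N) : Continuous (compress P) := by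
  unfold compress
  fun_prop

/-- `1 - 2P` is `-1` on the range of `P` and `1` on its kernel. As an involution on the left it does
not change the kernel, so the sign of `A` is invisible to both indices. -/
theorem compress_neg {P A : BulkOp N} (hP : P * P = P) :
    compress P (-A) = (1 - 2 * P) * compress P A := by
  have h1 : P * (P * A * P) = P * A * P := by rw [← mul_assoc, ← mul_assoc, hP]
  simp only [compress, sub_mul, mul_add, mul_sub, one_mul, mul_one, mul_assoc, mul_neg, neg_mul,
    two_mul, add_mul, hP]
  simp only [mul_assoc] at h1
  rw [h1]
  abel

theorem ker_compress_neg {P A : BulkOp N} (hP : P * P = P) :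
    (compress P (-A)).ker = (compress P A).ker := by
  have hV : (1 - 2 * P) * (1 - 2 * P) = 1 := by
    simp only [sub_mul, mul_sub, one_mul, mul_one, two_mul, add_mul, mul_add, hP]
    abel
  ext ψ
  change compress P (-A) ψ = 0 ↔ compress P A ψ = 0
  rw [compress_neg hP, mul_apply_eq_comp]
  constructor
  · intro h
    have h2 := congrArg (fun φ => (1 - 2 * P : BulkOp N) φ) h
    beta_reduce at h2
    rw [← mul_apply_eq_comp, hV, map_zero] at h2
    exact h2
  · intro h
    rw [h, map_zero]

theorem index_compress_neg {P A : BulkOp N} (hP : P * P = P) (hsa : IsSelfAdjoint P) :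
    index (compress P (-A)) = index (compress P A) := by
  rw [index, index, ker_compress_neg hP, ← ContinuousLinearMap.star_eq_adjoint,
    ← ContinuousLinearMap.star_eq_adjoint, star_compress hsa, star_compress hsa, star_neg,
    ker_compress_neg hP]

theorem indexTwo_compress_neg {P A : BulkOp N} (hP : P * P = P) :
    indexTwo (compress P (-A)) = indexTwo (compress P A) := by
  rw [indexTwo, indexTwo, ker_compress_neg hP]

theorem index_star (F : BulkOp N) : index (star F) = -index F := by
  rw [index, index, ContinuousLinearMap.star_eq_adjoint, ContinuousLinearMap.adjoint_adjoint]
  ring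

/-- `Θ` maps `ker F` bijectively onto `ker F*`. Being antilinear, it preserves dimension only
through a semilinear equivalence over complex conjugation. -/
theorem IsOdd.indexTwo_star {Θ : TimeReversal N} {F : BulkOp N} (h : IsOdd Θ F) :
    indexTwo (star F) = indexTwo F := by
  rw [indexTwo, indexTwo, ContinuousLinearMap.star_eq_adjoint]
  refine congrArg Nat.cast ?_
  have hmaps : ∀ ψ, F ψ = 0 → ContinuousLinearMap.adjoint F (Θ.toFun ψ) = 0 := fun ψ hψ => by
    rw [← h, hψ, map_zero]
  have hmaps' : ∀ ψ, ContinuousLinearMap.adjoint F ψ = 0 → F (-Θ.toFun ψ) = 0 := fun ψ hψ => by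
    have h1 := Θ.sq_eq_neg (F (-Θ.toFun ψ))
    rw [h, map_neg, Θ.sq_eq_neg, neg_neg, hψ, map_zero] at h1
    exact neg_eq_zero.mp h1.symm
  let e : (ContinuousLinearMap.adjoint F).ker ≃+ F.ker :=
    { toFun := fun ψ => ⟨-Θ.toFun ψ, hmaps' ψ ψ.2⟩
      invFun := fun ψ => ⟨Θ.toFun ψ, hmaps ψ ψ.2⟩
      left_inv := fun ψ => Subtype.ext (by
        change Θ.toFun (-Θ.toFun (ψ : BulkSpace N)) = ψ
        rw [map_neg, Θ.sq_eq_neg, neg_neg])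
      right_inv := fun ψ => Subtype.ext (by
        change -Θ.toFun (Θ.toFun (ψ : BulkSpace N)) = ψ
        rw [Θ.sq_eq_neg, neg_neg])
      map_add' := fun ψ φ => Subtype.ext (by
        change -Θ.toFun ((ψ : BulkSpace N) + φ) = -Θ.toFun ψ + -Θ.toFun φ
        rw [map_add, neg_add]) }
  refine congrArg Cardinal.toNat (rank_eq_of_equiv_equiv (starRingEnd ℂ) e
    (Function.Involutive.bijective Complex.conj_conj) fun r ψ => Subtype.ext ?_)
  change -Θ.toFun (r • (ψ : BulkSpace N)) = (starRingEnd ℂ r) • (-Θ.toFun ψ)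
  rw [LinearMap.map_smulₛₗ, smul_neg]

theorem IsOdd.add {Θ : TimeReversal N} {F G : BulkOp N} (hF : IsOdd Θ F) (hG : IsOdd Θ G) :
    IsOdd Θ (F + G) := by
  rw [isOdd_iff] at *
  rw [map_add, star_add, hF, hG]

theorem IsOdd.ofReal_smul {Θ : TimeReversal N} {F : BulkOp N} (hF : IsOdd Θ F) (t : ℝ) :
    IsOdd Θ ((t : ℂ) • F) := by
  rw [isOdd_iff] at *
  rw [Θ.conj_smul, star_smul, hF]
  rfl

end Compress

/-! ### The homotopy from flux insertion to the winding operator -/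

section Homotopy

variable {N : ℕ}

theorem commute_calkin_mulOp (f g : LatticeFun) :
    Commute (calkin (mulOp N f)) (calkin (mulOp N g)) := by
  rw [Commute, SemiconjBy, ← map_mul, ← map_mul, ← map_mul, ← map_mul, mul_comm f]

/-- Near the support of `κ`, the exponentials of `P g P` and of `s` agree on the range of `P`
up to compact operators, if `g = s` on the support of `κ`. -/
theorem calkin_mulOp_mul_exp_sub_one {P : BulkOp N} {κ g s : LatticeFun} (hP : P * P = P)
    (hκ : Commute (calkin P) (calkin (mulOp N κ))) (hs : Commute (calkin P) (calkin (mulOp N s)))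
    (hκg : κ * g = κ * s) :
    calkin (mulOp N κ) * (calkin (NormedSpace.exp (P * mulOp N g * P)) - 1)
      = calkin (mulOp N κ) * (calkin (mulOp N (NormedSpace.exp s)) - 1) * calkin P := by
  have h1 : calkin (mulOp N κ) * calkin (NormedSpace.exp (P * mulOp N g * P)) * calkin P
      = calkin (mulOp N κ) * calkin (mulOp N (NormedSpace.exp s)) * calkin P := by
    rw [← exp_mulOp, ← map_mul, ← map_mul, ← map_mul, ← map_mul, calkin_eq_iff]
    refine map_exp_sub_map_exp_mem (ContinuousLinearMap.mulLeftRight ℂ (BulkOp N) (mulOp N κ) P)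
      (ContinuousLinearMap.mulLeftRight ℂ (BulkOp N) (mulOp N κ) P) fun n => ?_
    rw [ContinuousLinearMap.mulLeftRight_apply, ContinuousLinearMap.mulLeftRight_apply,
      ← calkin_eq_iff]
    simp only [map_mul, map_pow]
    refine mul_pow_mul_eq ?_ hκ hs (commute_calkin_mulOp κ s) ?_ n
    · rw [← map_mul, hP]
    · rw [← map_mul, ← map_mul, ← map_mul, ← map_mul, hκg]
  -- On the kernel of `P` the exponential is the identity, so `exp - 1` is unchanged by a factor `P`
  -- on the right.
  have h2 : calkin (NormedSpace.exp (P * mulOp N g * P)) * (1 - calkin P) = 1 - calkin P := by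
    have h3 : P * mulOp N g * P * (1 - P) = 0 := by
      rw [mul_assoc, mul_sub, mul_one, hP, sub_self, mul_zero]
    have h4 := congrArg calkin (exp_mul_of_mul_eq_zero h3)
    rwa [map_mul, map_sub, map_one] at h4
  have h5 := congrArg (calkin (mulOp N κ) * ·) h2
  simp only [mul_sub, mul_one, sub_mul, mul_assoc] at h1 h5 ⊢
  rw [h1] at h5
  exact sub_eq_sub_iff_sub_eq_sub.mpr h5

/-- The interpolation from `Λ₂`, modified in the right half plane, to `Λ₂`. -/
def interpolation (t : ℝ) : LatticeFun :=
  ((1 - t : ℝ) : ℂ) • (rightFun * stepFun + (1 - rightFun) * upperFun) + (t : ℂ) • upperFun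

theorem continuous_interpolation : Continuous interpolation := by
  unfold interpolation; fun_prop

theorem interpolation_one : interpolation 1 = upperFun := by simp [interpolation]

theorem star_interpolation (t : ℝ) : star (interpolation t) = interpolation t := by
  ext x
  have h : interpolation t x = ((1 - t : ℝ) : ℂ) *
      (rightFun x * stepFun x + (1 - rightFun x) * upperFun x) + (t : ℂ) * upperFun x := rfl
  change starRingEnd ℂ (interpolation t x) = _
  rw [h, rightFun_apply, stepFun_apply, upperFun_apply]
  split_ifs <;> simp

theorem star_rightFun : star rightFun = rightFun := by
  ext x
  change starRingEnd ℂ (rightFun x) = _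
  rw [rightFun_apply]
  split_ifs <;> simp

theorem rightFun_mul_self : rightFun * rightFun = rightFun := by
  ext x
  change rightFun x * rightFun x = _
  rw [rightFun_apply]
  split_ifs <;> simp

/-- Inside the cone both ends of the interpolation coincide with `stepFun`, so nothing there depends
on `t`. -/
theorem coneFun_mul_interpolation (t : ℝ) : coneFun * interpolation t = coneFun * stepFun := by
  have h : coneFun * (rightFun * stepFun + (1 - rightFun) * upperFun) = coneFun * stepFun := by
    linear_combination (1 - rightFun) * coneFun_mul_upperFun
  rw [interpolation, mul_add, mul_smul_comm, mul_smul_comm, h, coneFun_mul_upperFun, ← add_smul]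
  simp

theorem rightFun_mul_interpolation_zero :
    rightFun * (1 - coneFun) * interpolation 0 = rightFun * (1 - coneFun) * stepFun := by
  simp only [interpolation, sub_zero, Complex.ofReal_one, one_smul, Complex.ofReal_zero, zero_smul,
    add_zero]
  linear_combination (1 - coneFun) * (stepFun - upperFun) * rightFun_mul_self

theorem rightFun_mul_one_sub_coneFun_mul :
    rightFun * (1 - coneFun) * (stepPhase - 1) = rightFun * (stepPhase - 1) := by
  linear_combination -rightFun * coneFun_mul_stepPhase_sub_one

/-- Both sides equal `1 + w p`. In the application `r` is `Λ₁`, `e` the exponential, `p` the Fermi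
projection and `1 + w` the sector phase. -/
theorem mul_mul_add_one_sub_eq {R : Type*} [Ring R] {r e p w : R} (hr : r * r = r)
    (hp : p * p = p) (h : r * (e - 1) = w * p) (hpw : p * w = w * p) (hwr : w * r = w) :
    r * e * r + (1 - r) = p * (1 + w) * p + (1 - p) := by
  have h1 : r * (e - 1) * r = w * p := by rw [h, ← hpw, mul_assoc, hwr]
  rw [mul_sub, mul_one, sub_mul, hr, sub_eq_iff_eq_add] at h1
  rw [h1, mul_add, mul_one, add_mul, hp, hpw, mul_assoc w, hp]
  abel

/-- The unitary `exp(2πi P f P)`. -/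
def expInterpolation (P : BulkOp N) (t : ℝ) : BulkOp N :=
  NormedSpace.exp ((2 * Real.pi * Complex.I : ℂ) • (P * mulOp N (interpolation t) * P))

theorem smul_mul_mulOp_mul (P : BulkOp N) (c : ℂ) (f : LatticeFun) :
    c • (P * mulOp N f * P) = P * mulOp N (c • f) * P := by
  rw [map_smul, mul_smul_comm, smul_mul_assoc]

theorem continuous_expInterpolation (P : BulkOp N) : Continuous (expInterpolation P) := by
  let _ := NormedAlgebra.restrictScalars ℚ ℂ (BulkOp N)
  refine NormedSpace.exp_continuous.comp ?_
  have := (continuous_mulOp (N := N)).comp continuous_interpolation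
  exact ((continuous_const.mul this).mul continuous_const).const_smul (2 * Real.pi * Complex.I : ℂ)

/-- Orthogonal projections that commute with slowly varying functions up to compact operators. -/
structure IsEssentiallyLocalProjection (P : BulkOp N) : Prop where
  mul_self : P * P = P
  isSelfAdjoint : IsSelfAdjoint P
  commute : ∀ g, SlowlyVarying g → Commute (calkin P) (calkin (mulOp N g))

namespace IsEssentiallyLocalProjection

variable {P : BulkOp N} (hP : IsEssentiallyLocalProjection P)

include hP

theorem commute_calkin_expInterpolation {k : LatticeFun} (hk : SlowlyVarying k) (t : ℝ) :
    Commute (calkin (mulOp N k)) (calkin (expInterpolation P t)) := by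
  rw [expInterpolation, smul_mul_mulOp_mul]
  refine commute_calkin_exp ?_
  rw [map_mul, map_mul]
  exact ((hP.commute k hk).symm.mul_right (commute_calkin_mulOp _ _)).mul_right (hP.commute k hk).symm

theorem commute_calkin_stepPhase : Commute (calkin P) (calkin (mulOp N stepPhase)) := by
  rw [stepPhase, ← exp_mulOp]
  exact commute_calkin_exp (hP.commute _ (slowlyVarying_stepFun.smul _))

/-- In the cone the exponential may be replaced by that of `2πi stepFun`, which is `1` because
`stepFun` is integer-valued there. -/
theorem calkin_coneFun_mul_expInterpolation (t : ℝ) :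
    calkin (mulOp N coneFun) * (calkin (expInterpolation P t) - 1) = 0 := by
  rw [expInterpolation, smul_mul_mulOp_mul, calkin_mulOp_mul_exp_sub_one hP.mul_self
    (hP.commute _ slowlyVarying_coneFun) (hP.commute _ (slowlyVarying_stepFun.smul
      (2 * Real.pi * Complex.I))) (by
      rw [mul_smul_comm, mul_smul_comm, coneFun_mul_interpolation])]
  have := congrArg (fun f => calkin (mulOp N f)) coneFun_mul_stepPhase_sub_one
  simp only [map_mul, map_sub, map_one, map_zero] at this
  exact (congrArg (· * calkin P) this).trans (zero_mul _)

/-- This trades the sharp cutoff `Λ₁` for a slowly varying one, with which `P` commutes modulo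
compacts. -/
theorem calkin_rightFun_mul_expInterpolation (t : ℝ) :
    calkin (mulOp N rightFun) * (calkin (expInterpolation P t) - 1)
      = calkin (mulOp N (rightFun * (1 - coneFun))) * (calkin (expInterpolation P t) - 1) := by
  have h := calkin_coneFun_mul_expInterpolation hP t
  rw [mul_sub rightFun, mul_one, map_sub, map_sub, map_mul, map_mul, sub_mul, mul_assoc, h,
    mul_zero, sub_zero]

theorem commute_calkin_rightProj (t : ℝ) :
    Commute (calkin (rightProj N)) (calkin (expInterpolation P t)) := by
  have h1 := calkin_rightFun_mul_expInterpolation hP t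
  have h2 := commute_calkin_expInterpolation hP slowlyVarying_rightFun_mul t
  have h3 := commute_calkin_expInterpolation hP slowlyVarying_coneFun t
  have h4 : (calkin (expInterpolation P t) - 1) * calkin (mulOp N coneFun) = 0 := by
    have := calkin_coneFun_mul_expInterpolation hP t
    rwa [mul_sub, mul_one, h3.eq, ← sub_one_mul] at this
  have h5 : (calkin (expInterpolation P t) - 1) * calkin (mulOp N rightFun)
      = (calkin (expInterpolation P t) - 1) * calkin (mulOp N (rightFun * (1 - coneFun))) := by
    rw [mul_comm rightFun (1 - coneFun), sub_mul 1 coneFun, one_mul, map_sub, map_sub, map_mul,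
      map_mul, mul_sub, ← mul_assoc _ (calkin (mulOp N coneFun)), h4, zero_mul, sub_zero]
  have h6 : Commute (calkin (mulOp N rightFun)) (calkin (expInterpolation P t) - 1) := by
    rw [Commute, SemiconjBy, h1, h5]
    exact (h2.sub_right (Commute.one_right _)).eq
  have h7 := h6.add_right (Commute.one_right _)
  rwa [sub_add_cancel] at h7

theorem isUnit_calkin_compress_expInterpolation (t : ℝ) :
    IsUnit (calkin (compress (rightProj N) (expInterpolation P t))) ∧
      IsUnit (calkin (compress (rightProj N) (NormedSpace.exp
        (-((2 * Real.pi * Complex.I : ℂ) • (P * mulOp N (interpolation t) * P)))))) := by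
  refine isUnit_calkin_compress ?_ (exp_mul_exp_neg _) (exp_neg_mul_exp _)
    (commute_calkin_rightProj hP t)
  rw [rightProj_eq, ← map_mul, rightFun_mul_self]

/-- `stepPhase - 1` vanishes on the cone, so `rightFun` may be replaced by the slowly varying
`rightFun * (1 - coneFun)`. -/
theorem commute_calkin_phase :
    Commute (calkin P) (calkin (mulOp N (rightFun * (stepPhase - 1)))) := by
  rw [← rightFun_mul_one_sub_coneFun_mul, map_mul, map_mul, map_sub, map_sub, map_one, map_one]
  exact (hP.commute _ slowlyVarying_rightFun_mul).mul_right
    (hP.commute_calkin_stepPhase.sub_right (Commute.one_right _))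

theorem calkin_rightFun_mul_expInterpolation_zero :
    calkin (mulOp N rightFun) * (calkin (expInterpolation P 0) - 1)
      = calkin (mulOp N (rightFun * (stepPhase - 1))) * calkin P := by
  rw [hP.calkin_rightFun_mul_expInterpolation, expInterpolation, smul_mul_mulOp_mul,
    calkin_mulOp_mul_exp_sub_one hP.mul_self (hP.commute _ slowlyVarying_rightFun_mul)
    (hP.commute _ (slowlyVarying_stepFun.smul (2 * Real.pi * Complex.I))) (by
    rw [mul_smul_comm, mul_smul_comm, rightFun_mul_interpolation_zero]),
    ← rightFun_mul_one_sub_coneFun_mul, map_mul (mulOp N) _ (stepPhase - 1),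
    map_mul calkin _ (mulOp N (stepPhase - 1)), map_sub (mulOp N), map_sub calkin, map_one,
    map_one, ← stepPhase]

/-- The link between the two problems: an operator compressed to the half plane becomes one
compressed to the range of `P`. -/
theorem calkin_compress_expInterpolation_zero :
    calkin (compress (rightProj N) (expInterpolation P 0))
      = calkin (compress P (mulOp N sectorPhase)) := by
  rw [calkin_compress, calkin_compress, rightProj_eq, sectorPhase, map_add, map_add, map_one,
    map_one]
  refine mul_mul_add_one_sub_eq ?_ ?_ hP.calkin_rightFun_mul_expInterpolation_zero
    hP.commute_calkin_phase ?_
  · rw [← map_mul, ← map_mul, rightFun_mul_self]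
  · rw [← map_mul, hP.mul_self]
  · rw [← map_mul, ← map_mul]
    congr 2
    linear_combination (stepPhase - 1) * rightFun_mul_self

theorem commute_calkin_phasePath (t : ℝ) :
    Commute (calkin P) (calkin (mulOp N (phasePath t))) := by
  have h1 : Commute (calkin P) (calkin (mulOp N (((1 - t : ℝ) : ℂ) • fluxFun))) :=
    hP.commute _ (slowlyVarying_fluxFun.smul _)
  have h2 : Commute (calkin P) (calkin (mulOp N ((t : ℂ) • sectorPhase))) := by
    have h3 : Commute (calkin P) (calkin (mulOp N ((t : ℂ) • (1 : LatticeFun)))) := 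
      hP.commute _ ⟨0, fun x y => by simp⟩
    have h4 : (t : ℂ) • sectorPhase
        = ((t : ℂ) • (1 : LatticeFun)) * (1 + rightFun * (stepPhase - 1)) := by
      rw [smul_mul_assoc, one_mul, sectorPhase]
    rw [h4, map_mul, map_mul, map_add, map_add, map_one, map_one]
    exact h3.mul_right ((Commute.one_right _).add_right hP.commute_calkin_phase)
  rw [phasePath, map_sub, map_sub]
  exact h1.sub_right h2

end IsEssentiallyLocalProjection

variable {P : BulkOp N}

namespace IsEssentiallyLocalProjection

theorem isFredholm_phasePath (hP : IsEssentiallyLocalProjection P) (t : unitInterval) :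
    (compress P (mulOp N (phasePath t))).IsFredholm := by
  obtain ⟨w, hw⟩ := exists_inverse_phasePath t.2.1 t.2.2
  refine isFredholm_of_isUnit_calkin (isUnit_calkin_compress (B := mulOp N w) hP.mul_self ?_ ?_
    (hP.commute_calkin_phasePath t)).1
  · rw [← map_mul, hw, map_one]
  · rw [← map_mul, mul_comm, hw, map_one]

/-- All points of the segment have the same class in the Calkin algebra. This path takes the place
of a separate statement on compact perturbations and also preserves oddness. -/
theorem isFredholm_segment (hP : IsEssentiallyLocalProjection P) (t : ℝ) :
    (((1 - t : ℝ) : ℂ) • compress P (mulOp N sectorPhase)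
      + (t : ℂ) • compress (rightProj N) (expInterpolation P 0)).IsFredholm := by
  have h : calkin (((1 - t : ℝ) : ℂ) • compress P (mulOp N sectorPhase)
      + (t : ℂ) • compress (rightProj N) (expInterpolation P 0))
      = calkin (compress (rightProj N) (expInterpolation P 0)) := by
    have h1 := calkin_eq_iff.mp hP.calkin_compress_expInterpolation_zero.symm
    have h2 := (compactIdeal (BulkSpace N)).mul_mem_left (((1 - t : ℝ) : ℂ) • (1 : BulkOp N)) h1
    rw [calkin_eq_iff]
    convert h2 using 1
    rw [smul_mul_assoc, one_mul, smul_sub, add_sub_assoc, sub_eq_add_neg (_ • _) (_ • _)]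
    congr 1
    push_cast
    rw [sub_smul, one_smul]
    abel
  refine isFredholm_of_isUnit_calkin ?_
  rw [h]
  exact (hP.isUnit_calkin_compress_expInterpolation 0).1

theorem isFredholm_expInterpolation (hP : IsEssentiallyLocalProjection P) (t : ℝ) :
    (compress (rightProj N) (expInterpolation P t)).IsFredholm :=
  isFredholm_of_isUnit_calkin (hP.isUnit_calkin_compress_expInterpolation t).1

end IsEssentiallyLocalProjection

theorem continuous_compress_phasePath (P : BulkOp N) :
    Continuous fun t : unitInterval => compress P (mulOp N (phasePath t)) :=
  (continuous_compress P).comp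
    (continuous_mulOp.comp (continuous_phasePath.comp continuous_subtype_val))

theorem continuous_segment (A B : BulkOp N) :
    Continuous fun t : unitInterval => ((1 - t : ℝ) : ℂ) • A + (t : ℂ) • B := by
  fun_prop

theorem continuous_compress_expInterpolation (P : BulkOp N) :
    Continuous fun t : unitInterval => compress (rightProj N) (expInterpolation P t) :=
  (continuous_compress _).comp ((continuous_expInterpolation P).comp continuous_subtype_val)

theorem phasePath_zero : phasePath 0 = fluxFun := by simp [phasePath]

theorem phasePath_one : phasePath 1 = -sectorPhase := by simp [phasePath]

/-- The three paths are the phase path from `U` to `-U'`, the segment across the compact difference,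
and the deformation of the step to `Λ₂`. -/
theorem IsEssentiallyLocalProjection.index_eq (hP : IsEssentiallyLocalProjection P) :
    index (compress P (fluxOp N)) = index (compress (rightProj N) (expInterpolation P 1)) := by
  have h1 := index_eq_of_path (continuous_compress_phasePath P) hP.isFredholm_phasePath
  have h2 := index_eq_of_path (continuous_segment (compress P (mulOp N sectorPhase))
    (compress (rightProj N) (expInterpolation P 0))) fun t => hP.isFredholm_segment t
  have h3 := index_eq_of_path (continuous_compress_expInterpolation P)
    fun t => hP.isFredholm_expInterpolation t
  simp only [Set.Icc.coe_zero, Set.Icc.coe_one, sub_zero, sub_self, Complex.ofReal_one,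
    Complex.ofReal_zero, one_smul, zero_smul, add_zero, zero_add] at h1 h2 h3
  rw [phasePath_zero, phasePath_one, map_neg,
    index_compress_neg hP.mul_self hP.isSelfAdjoint] at h1
  rw [fluxOp_eq, h1, h2, h3]

theorem isSelfAdjoint_mul_mulOp_interpolation_mul (hP : IsSelfAdjoint P) (t : ℝ) :
    IsSelfAdjoint (P * mulOp N (interpolation t) * P) := by
  rw [IsSelfAdjoint, star_mul, star_mul, hP.star_eq, ← map_star, star_interpolation, mul_assoc]

theorem isSelfAdjoint_rightProj : IsSelfAdjoint (rightProj N) := by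
  rw [IsSelfAdjoint, rightProj_eq, ← map_star, star_rightFun]

theorem conj_two_pi_mul_I :
    starRingEnd ℂ (2 * Real.pi * Complex.I) = -(2 * Real.pi * Complex.I) := by
  simp [Complex.conj_ofNat]

theorem isOdd_compress_mulOp (Θ : TimeReversal N) (hP : IsSelfAdjoint P) (hΘ : Θ.conj P = P)
    (g : LatticeFun) : IsOdd Θ (compress P (mulOp N g)) :=
  isOdd_compress Θ hΘ hP (by rw [Θ.conj_mulOp, map_star])

theorem isOdd_compress_expInterpolation (Θ : TimeReversal N) (hP : IsSelfAdjoint P)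
    (hΘ : Θ.conj P = P) (t : ℝ) : IsOdd Θ (compress (rightProj N) (expInterpolation P t)) := by
  refine isOdd_compress Θ ?_ isSelfAdjoint_rightProj (Θ.conj_exp ?_
    (isSelfAdjoint_mul_mulOp_interpolation_mul hP t) _)
  · rw [rightProj_eq, Θ.conj_mulOp, star_rightFun]
  · rw [map_mul, map_mul, hΘ, Θ.conj_mulOp, star_interpolation]

theorem IsEssentiallyLocalProjection.indexTwo_eq (hP : IsEssentiallyLocalProjection P)
    (Θ : TimeReversal N) (hΘ : Θ.conj P = P) :
    indexTwo (compress P (fluxOp N))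
      = indexTwo (compress (rightProj N) (expInterpolation P 1)) := by
  have h1 := indexTwo_eq_of_path Θ (continuous_compress_phasePath P) hP.isFredholm_phasePath
    fun t => isOdd_compress_mulOp Θ hP.isSelfAdjoint hΘ _
  have h2 := indexTwo_eq_of_path Θ (continuous_segment (compress P (mulOp N sectorPhase))
    (compress (rightProj N) (expInterpolation P 0))) (fun t => hP.isFredholm_segment t)
    fun t => ((isOdd_compress_mulOp Θ hP.isSelfAdjoint hΘ _).ofReal_smul _).add
      ((isOdd_compress_expInterpolation Θ hP.isSelfAdjoint hΘ 0).ofReal_smul _)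
  have h3 := indexTwo_eq_of_path Θ (continuous_compress_expInterpolation P)
    (fun t => hP.isFredholm_expInterpolation t)
    fun t => isOdd_compress_expInterpolation Θ hP.isSelfAdjoint hΘ t
  simp only [Set.Icc.coe_zero, Set.Icc.coe_one, sub_zero, sub_self, Complex.ofReal_one,
    Complex.ofReal_zero, one_smul, zero_smul, add_zero, zero_add] at h1 h2 h3
  rw [phasePath_zero, phasePath_one, map_neg, indexTwo_compress_neg hP.mul_self] at h1
  rw [fluxOp_eq, h1, h2, h3]

theorem expInterpolation_one (P : BulkOp N) : expInterpolation P 1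
    = NormedSpace.exp ((2 * Real.pi * Complex.I : ℂ) • (P * upperProj N * P)) := by
  rw [expInterpolation, interpolation_one, upperProj_eq]

/-- The sign in the exponent of `𝕎₁` amounts to taking adjoints, which reverses the integer index
and, for odd operators, keeps the parity. -/
theorem windingOp_eq_star (hP : IsSelfAdjoint P) : windingOp (P * upperProj N * P)
    = star (compress (rightProj N) (expInterpolation P 1)) := by
  let _ := NormedAlgebra.restrictScalars ℚ ℂ (BulkOp N)
  have h := isSelfAdjoint_mul_mulOp_interpolation_mul hP 1
  rw [star_compress isSelfAdjoint_rightProj, expInterpolation, NormedSpace.star_exp, star_smul,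
    h.star_eq, windingOp, interpolation_one, upperProj_eq, ← conj_two_pi_mul_I]
  rfl

theorem IsEssentiallyLocalProjection.isFredholm_windingOp (hP : IsEssentiallyLocalProjection P) :
    (windingOp (P * upperProj N * P)).IsFredholm := by
  have := (hP.isUnit_calkin_compress_expInterpolation 1).2
  rw [interpolation_one, ← neg_smul, ← upperProj_eq] at this
  exact isFredholm_of_isUnit_calkin this

theorem IsMobilityGapped.isEssentiallyLocalProjection {H : BulkOp N} {Δ : Set ℝ}
    (hH : IsMobilityGapped H Δ) (hΔ : Δ.Nontrivial) {μ : ℝ} (hμ : μ ∈ Δ) :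
    IsEssentiallyLocalProjection (fermiProjection H μ) where
  mul_self := fermiProjection_mul_self H μ
  isSelfAdjoint := isSelfAdjoint_fermiProjection H μ
  commute _ hg := hH.commute_calkin hΔ hμ hg

theorem IsOdd.star {Θ : TimeReversal N} {F : BulkOp N} (h : IsOdd Θ F) : IsOdd Θ (star F) := by
  rw [isOdd_iff] at *
  rw [map_star, h]

end Homotopy

end FluxKitaev

end

/-! ### Assembly of the theorem -/

theorem mainTheorem5 (N : ℕ) (hN : 1 ≤ N) (H : BulkOp N)
    (Δ : Set ℝ) (hΔ : Δ.OrdConnected) (hΔ' : Δ.Nontrivial) (hH : IsMobilityGapped H Δ)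
    (μ : ℝ) (hμ : μ ∈ Δ) (P : BulkOp N) (hP : P = fermiProjection H μ) :
    -- the integer index
    ((compress P (fluxOp N)).IsFredholm ∧
      (windingOp (P * upperProj N * P)).IsFredholm ∧
      (compress (rightProj N)
        (NormedSpace.exp ((2 * Real.pi * Complex.I : ℂ) • (P * upperProj N * P)))).IsFredholm ∧
      index (compress P (fluxOp N)) =
        index (compress (rightProj N)
          (NormedSpace.exp ((2 * Real.pi * Complex.I : ℂ) • (P * upperProj N * P)))) ∧
      index (compress P (fluxOp N)) = -index (windingOp (P * upperProj N * P))) ∧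
    -- the index modulo two of a time-reversal invariant system
    (∀ Θ : TimeReversal N, IsTRI Θ H →
      IsOddFredholm Θ (compress P (fluxOp N)) ∧
      IsOddFredholm Θ (windingOp (P * upperProj N * P)) ∧
      indexTwo (compress P (fluxOp N)) = indexTwo (windingOp (P * upperProj N * P))) := by
  subst hP
  have hL := hH.isEssentiallyLocalProjection hΔ' hμ
  have hU : (compress (fermiProjection H μ) (fluxOp N)).IsFredholm := by
    have := hL.isFredholm_phasePath 0
    rwa [Set.Icc.coe_zero, phasePath_zero, ← fluxOp_eq] at this
  have hW := windingOp_eq_star hL.isSelfAdjoint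
  refine ⟨⟨hU, hL.isFredholm_windingOp, ?_, ?_, ?_⟩, fun Θ hΘ => ?_⟩
  · rw [← expInterpolation_one]
    exact hL.isFredholm_expInterpolation 1
  · rw [← expInterpolation_one]
    exact hL.index_eq
  · rw [hW, index_star, neg_neg]
    exact hL.index_eq
  · have hΘP := Θ.conj_fermiProjection hΘ hH.1.1 μ
    have hodd := isOdd_compress_expInterpolation Θ hL.isSelfAdjoint hΘP 1
    refine ⟨(isOdd_compress_mulOp Θ hL.isSelfAdjoint hΘP fluxFun).isOddFredholm hU,
      IsOdd.isOddFredholm ?_ hL.isFredholm_windingOp, ?_⟩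
    · rw [hW]
      exact hodd.star
    · rw [hW, hodd.indexTwo_star]
      exact hL.indexTwo_eq Θ hΘP
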